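/- **Setting.** Let $d,n\in\mathbb N$, let $A_1,\dots,A_d\in\mathbb R^{n\times n}$ be symmetric, $E\in\mathbb R^{n\times n}$ skew-symmetric, and let $T:\mathbb R^n\times\mathbb R^n\times\mathbb R^n\to\mathbb R^n$ be trilinear; denote its trilinear extension to $\mathbb C^n$ again by $T$. Put $A(\beta)=\sum_\ell\beta_\ell A_\ell$, $A(\partial)=\sum_\ell A_\ell\partial_\ell$ and $\mathcal L(\alpha,\beta)=-\alpha I+A(\beta)-\mathrm iE$. Let $\widehat f(k)=(2\pi)^{-d/2}\int f(x)e^{-\mathrm ik\cdot x}\,\mathrm dx$, $W=\{f:\widehat f\in L^1(\mathbb R^d,\mathbb C^n)\}$ with $\|f\|_W=\|\widehat f\|_{L^1}=\int|\widehat f(k)|_2\,\mathrm dk$, and $W^s=\{f:\partial^\alpha f\in W\ \text{for all}\ |\alpha|_1\le s\}$. Let $(D_\mu\widehat w)(k)=\mathrm ik_\mu\widehat w(k)$ for $\mu\in\{1,\dots,d\}$. **Assumptions.** Let $\kappa\in\mathbb R^d\setminus\{0\}$ and $\omega\in\mathbb R$. 1. $\ker\mathcal L(\omega,\kappa)$ is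 one-dimensional. 2. For every $\beta\in\mathbb R^d$ the matrix $\mathcal L(0,\beta)$ has an orthonormal basis of eigenvectors $\psi_1(\beta),\dots,\psi_n(\beta)$ with eigenvalues $\omega_1(\beta),\dots,\omega_n(\beta)\in\mathbb R$; the functions $\omega_\ell,\psi_\ell$ are $C^\infty$ on $\mathbb R^d\setminus\{0\}$; each $\omega_\ell$ is globally Lipschitz continuous on $\mathbb R^d$; $\omega=\omega_1(\kappa)$; and there is a $c>0$ with $|\omega-\omega_\ell(\beta)|\ge c$ for all $\beta\in\mathbb R^d$ and $\ell=2,\dots,n$. For $j\in\{1,3\}$ write $\lambda_{j\ell}(\theta)=-j\omega+\omega_\ell(j\kappa+\theta)$, $\psi_{j\ell}(\theta)=\psi_\ell(j\kappa+\theta)$, $\Lambda_j=\mathrm{diag}(\lambda_{j1},\dots,\lambda_{jn})$, $\Psi_j=(\psi_{j1}|\cdots|\psi_{jn})$. 3. (Non-resonance) $\mathcal L(3\omega,3\kappa)$ is regular and has no common eigenvalue with $\mathcal L(\omega,\kappa)$, i.e. $\lambda_{3i}(0)\ne\lambda_{1\ell}(0)$ for all $i,\ell$. 4. $p=p_0+\varepsilon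 p_1$ with $p_0,p_1\in W^3$ and $p_0(x)\in\ker\mathcal L(\omega,\kappa)$ for almost every $x$. Let $t_{\rm end}>0$ and, for every $\varepsilon\in(0,1]$, let $u_1,u_3\in C^1([0,t_{\rm end}/\varepsilon],W)\cap C([0,t_{\rm end}/\varepsilon],W^1)$ be a classical solution of $$\partial_tu_j+\tfrac{\mathrm i}{\varepsilon}\mathcal L(j\omega,j\kappa)u_j+A(\partial)u_j=\varepsilon\sum_{j_1+j_2+j_3=j}T(u_{j_1},u_{j_2},u_{j_3}),\quad j\in\{1,3\},\qquad u_1(0)=p,\quad u_3(0)=0,$$ for $t\in(0,t_{\rm end}/\varepsilon]$, where the sum is over $(j_1,j_2,j_3)\in\{\pm1,\pm3\}^3$ and $u_{-j}=\overline{u_j}$. Put $$z_j(t,k)=\exp\!\big(\tfrac{\mathrm it}{\varepsilon}\Lambda_j(\varepsilon k)\big)\Psi_j^*(\varepsilon k)\widehat u_j(t,k),\qquad \mathcal P_\varepsilon^\perp(k)=I-\psi_{11}(\varepsilon k)\psi_{11}^*(\varepsilon k),$$ let $P(w_1,\dots,w_n)^\top=(w_1,0,\dots,0)^\top$, $P^\perp=I-P$,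 and $$N_\varepsilon(t)=2\|Pz_1(t)\|_{L^1}+\tfrac2\varepsilon\|P^\perp z_1(t)\|_{L^1}+\tfrac2{\varepsilon^2}\|z_3(t)\|_{L^1}.$$ **Claim.** For every sufficiently large $r$ there is a $t_\star\in(0,t_{\rm end}]$, independent of $\varepsilon$, such that $$\sup_{t\in[0,t_\star/\varepsilon]}N_\varepsilon(t)\le r\quad\text{for all }\varepsilon\in(0,1],\tag{$*$}$$ and for every such $r$ and every $t_\star\in(0,t_{\rm end}]$ with $(*)$ there is a constant $C$, independent of $\varepsilon$, such that for all $\varepsilon\in(0,1]$ and all $\mu\in\{1,\dots,d\}$ $$\sup_{t\in[0,t_\star/\varepsilon]}\|D_\mu\mathcal P_\varepsilon^\perp\widehat u_1(t)\|_{L^1}=\sup_{t\in[0,t_\star/\varepsilon]}\|D_\mu P^\perp z_1(t)\|_{L^1}\le C\varepsilon,$$ $$\sup_{t\in[0,t_\star/\varepsilon]}\|D_\mu\widehat u_3(t)\|_{L^1}=\sup_{t\in[0,t_\star/\varepsilon]}\|D_\mu z_3(t)\|_{L^1}\le C\varepsilon^2.$$ -/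

import Mathlib

open MeasureTheory Matrix

noncomputable section

/-- The position / frequency space `ℝ^d` with its Euclidean structure. -/
abbrev RVec (d : ℕ) := EuclideanSpace ℝ (Fin d)

/-- The state space `ℂ^n` with the Euclidean norm `|·|₂`. -/
abbrev CVec (n : ℕ) := EuclideanSpace ℂ (Fin n)

/-- The Banach space `L¹(ℝ^d, ℂ^n)`. -/
abbrev L1Space (d n : ℕ) := Lp (CVec n) 1 (volume : Measure (RVec d))

/-- The action `M v` of a matrix on a vector of `ℂ^n`. -/
def matVec {n : ℕ} (M : Matrix (Fin n) (Fin n) ℂ) (v : CVec n) : CVec n :=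
  WithLp.toLp 2 (M *ᵥ v.ofLp)

/-- The entrywise complex conjugate of a vector of `ℂ^n`. -/
def conjVec {n : ℕ} (v : CVec n) : CVec n :=
  WithLp.toLp 2 (fun i => starRingEnd ℂ (v i))

/-! ### The Wiener algebra -/

/-- `(𝓕⁻¹ g)(x) = (2π)^(-d/2) ∫ g(k) e^{i k·x} dk`. -/
def invFourier {d n : ℕ} (g : RVec d → CVec n) (x : RVec d) : CVec n :=
  (((2 * Real.pi) ^ (-(d : ℝ) / 2) : ℝ) : ℂ) •
    ∫ k : RVec d, Complex.exp (Complex.I * ((∑ l, k l * x l : ℝ) : ℂ)) • g k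

/-- `f` belongs to the Wiener algebra `W` and `g ∈ L¹` is its Fourier transform `f̂`.
The elements of `W` are represented by their continuous representatives. -/
def HasWienerTransform {d n : ℕ} (f : RVec d → CVec n) (g : L1Space d n) : Prop :=
  ∀ x, f x = invFourier (fun k => g k) x

/-- `f ∈ W^s`: `f ∈ W`, and `∂^α f`, whose Fourier transform is `(i k)^α f̂(k)`, belongs to `W`
for every multi-index with `|α|₁ ≤ s`. -/
def MemWiener {d n : ℕ} (s : ℕ) (f : RVec d → CVec n) : Prop :=
  ∃ g : L1Space d n, HasWienerTransform f g ∧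
    ∀ α : Fin d → ℕ, ∑ l, α l ≤ s →
      Integrable (fun k : RVec d => (∏ l, (Complex.I * ((k l : ℝ) : ℂ)) ^ α l) • g k)

/-- The Fourier multiplier `(D_μ w)(k) = i k_μ w(k)`. -/
def fourierD {d n : ℕ} (μ : Fin d) (w : RVec d → CVec n) (k : RVec d) : CVec n :=
  (Complex.I * ((k μ : ℝ) : ℂ)) • w k

/-- The norm of `L¹(ℝ^d, ℂ^n)`, with value `∞` for functions that are not integrable. -/
def normL1 {d n : ℕ} (w : RVec d → CVec n) : ENNReal := ∫⁻ k, ‖w k‖ₑ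

/-! ### Friedrichs systems -/

/-- The coefficients of the system `∂_t u + A(∂) u + ε⁻¹ E u = ε T(u,u,u)`: real symmetric matrices
`A_1, …, A_d`, a real skew-symmetric matrix `E` and a real trilinear map `T`. -/
structure FriedrichsSystem (d n : ℕ) where
  A : Fin d → Matrix (Fin n) (Fin n) ℝ
  A_symm : ∀ l, (A l)ᵀ = A l
  E : Matrix (Fin n) (Fin n) ℝ
  E_skew : Eᵀ = -E
  T : (Fin n → ℝ) →ₗ[ℝ] (Fin n → ℝ) →ₗ[ℝ] (Fin n → ℝ) →ₗ[ℝ] (Fin n → ℝ)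

namespace FriedrichsSystem

variable {d n : ℕ} (S : FriedrichsSystem d n)

/-- The matrix `𝓛(α, β) = -α I + A(β) - i E` with `A(β) = ∑ β_l A_l`. -/
def dispersion (α : ℝ) (β : RVec d) : Matrix (Fin n) (Fin n) ℂ :=
  -((α : ℂ) • (1 : Matrix (Fin n) (Fin n) ℂ))
    + ∑ l, ((β l : ℝ) : ℂ) • (S.A l).map (fun a => (a : ℂ))
    - Complex.I • S.E.map (fun a => (a : ℂ))

/-- The trilinear extension of `T` to `ℂ^n × ℂ^n × ℂ^n → ℂ^n`. -/
def Tc (a b c : CVec n) : CVec n :=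
  WithLp.toLp 2 (fun l => ∑ i₁, ∑ i₂, ∑ i₃, a i₁ * b i₂ * c i₃ *
    ((S.T (Pi.single i₁ 1) (Pi.single i₂ 1) (Pi.single i₃ 1) l : ℝ) : ℂ))

end FriedrichsSystem

/-! ### The coupled system for the coefficient functions -/

/-- All indices `±1, ±3` of the coefficient functions. -/
def modes : Finset ℤ := {-3, -1, 1, 3}

/-- The positive indices `1, 3`. -/
def posModes : Finset ℤ := {1, 3}

/-- The triples `J = (j₁, j₂, j₃)` of indices with `j₁ + j₂ + j₃ = j`. -/
def triads (j : ℤ) : Finset (ℤ × ℤ × ℤ) :=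
  (modes ×ˢ modes ×ˢ modes).filter (fun J => J.1 + J.2.1 + J.2.2 = j)

/-- `u = (u_j)` is a classical solution on `[0, τ]`, with Fourier transforms `uhat = (û_j)`, of
`∂_t u_j + (i/ε) 𝓛(jω, jκ) u_j + A(∂) u_j = ε ∑_{j₁+j₂+j₃=j} T(u_{j₁}, u_{j₂}, u_{j₃})`, `j = 1, 3`,
with `u_{-j} = conj u_j` and initial data `u_1(0) = p`, `u_3(0) = 0`. As usual for classical
solutions, `u_j ∈ C¹([0, τ], W) ∩ C([0, τ], W¹)`. -/
structure IsClassicalSolution {d n : ℕ} (S : FriedrichsSystem d n) (κ : RVec d) (ω ε τ : ℝ)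
    (p : RVec d → CVec n) (u : ℤ → ℝ → RVec d → CVec n) (uhat : ℤ → ℝ → L1Space d n) : Prop where
  transform : ∀ j ∈ posModes, ∀ t ∈ Set.Icc 0 τ, HasWienerTransform (u j t) (uhat j t)
  neg_mode : ∀ j ∈ posModes, ∀ t ∈ Set.Icc 0 τ, ∀ x, u (-j) t x = conjVec (u j t x)
  contDiff_W : ∀ j ∈ posModes, ContDiffOn ℝ 1 (uhat j) (Set.Icc 0 τ)
  continuous_W1 : ∀ j ∈ posModes, ∀ μ : Fin d, ∃ v : ℝ → L1Space d n,
    ContinuousOn v (Set.Icc 0 τ) ∧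
      ∀ t ∈ Set.Icc 0 τ, (fun k => v t k) =ᵐ[volume] fourierD μ (fun k => uhat j t k)
  pde : ∀ j ∈ posModes, ∀ t ∈ Set.Ioc 0 τ, ∀ x,
    HasDerivWithinAt (fun s => u j s x)
      (-((Complex.I / (ε : ℂ)) • matVec (S.dispersion (j * ω) ((j : ℝ) • κ)) (u j t x))
        - ∑ l, matVec ((S.A l).map (fun a => (a : ℂ)))
            (fderiv ℝ (u j t) x (EuclideanSpace.single l 1))
        + (ε : ℂ) • ∑ J ∈ triads j, S.Tc (u J.1 t x) (u J.2.1 t x) (u J.2.2 t x))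
      (Set.Icc 0 τ) t
  init_one : ∀ x, u 1 0 x = p x
  init_three : ∀ x, u 3 0 x = 0

/-! ### Eigendecomposition, transformed functions and projections -/

/-- `freq l β = ω_l(β)` and `psi l β = ψ_l(β)` form a smooth eigendecomposition of
`𝓛(0, β) = A(β) - i E` with globally Lipschitz continuous eigenvalues, and `ω = ω_1(κ)` is bounded
away from the other eigenvalues. The first index is `0 : Fin n`. -/
structure IsSmoothEigendecomposition {d n : ℕ} [NeZero n] (S : FriedrichsSystem d n) (κ : RVec d)
    (ω : ℝ) (freq : Fin n → RVec d → ℝ) (psi : Fin n → RVec d → CVec n) : Prop where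
  eigen : ∀ l β, matVec (S.dispersion 0 β) (psi l β) = ((freq l β : ℝ) : ℂ) • psi l β
  orthonormal : ∀ β, Orthonormal ℂ (fun l => psi l β)
  smooth_freq : ∀ l, ContDiffOn ℝ ((⊤ : ℕ∞) : WithTop ℕ∞) (freq l) {0}ᶜ
  smooth_psi : ∀ l, ContDiffOn ℝ ((⊤ : ℕ∞) : WithTop ℕ∞) (psi l) {0}ᶜ
  first : ω = freq 0 κ
  lipschitz : ∃ C : ℝ, ∀ l β β', |freq l β' - freq l β| ≤ C * ∑ i, |β' i - β i|
  gap : ∃ C : ℝ, 0 < C ∧ ∀ l, l ≠ 0 → ∀ β, C ≤ |ω - freq l β|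

/-- The eigenvalue `λ_{jl}(θ) = -j ω + ω_l(j κ + θ)` of `𝓛_j(θ) = 𝓛(j ω, j κ + θ)`. -/
def shiftedFreq {d n : ℕ} (κ : RVec d) (ω : ℝ) (freq : Fin n → RVec d → ℝ) (j : ℤ) (l : Fin n)
    (θ : RVec d) : ℝ :=
  -(j * ω) + freq l ((j : ℝ) • κ + θ)

/-- The eigenvector `ψ_{jl}(θ) = ψ_l(j κ + θ)` of `𝓛_j(θ)`. -/
def shiftedPsi {d n : ℕ} (κ : RVec d) (psi : Fin n → RVec d → CVec n) (j : ℤ) (l : Fin n)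
    (θ : RVec d) : CVec n :=
  psi l ((j : ℝ) • κ + θ)

/-- The transformed function `z_j(t,k) = exp((i t/ε) Λ_j(ε k)) Ψ_j(ε k)^* w(k)` for `w = û_j(t)`:
its `l`-th entry is `exp((i t/ε) λ_{jl}(ε k)) ψ_{jl}(ε k)^* w(k)`. -/
def zTransform {d n : ℕ} (κ : RVec d) (ω : ℝ) (freq : Fin n → RVec d → ℝ)
    (psi : Fin n → RVec d → CVec n) (ε : ℝ) (j : ℤ) (t : ℝ) (w : RVec d → CVec n)
    (k : RVec d) : CVec n :=
  WithLp.toLp 2 (fun l =>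
    Complex.exp (Complex.I * ((t / ε * shiftedFreq κ ω freq j l (ε • k) : ℝ) : ℂ)) *
      inner ℂ (shiftedPsi κ psi j l (ε • k)) (w k))

/-- `𝒫_ε^⊥(k) w(k)` with `𝒫_ε(k) = ψ_{11}(ε k) ψ_{11}(ε k)^*` and `𝒫_ε^⊥ = I - 𝒫_ε`. -/
def epsProjPerp {d n : ℕ} [NeZero n] (κ : RVec d) (psi : Fin n → RVec d → CVec n) (ε : ℝ)
    (w : RVec d → CVec n) (k : RVec d) : CVec n :=
  w k - (inner ℂ (shiftedPsi κ psi 1 0 (ε • k)) (w k) : ℂ) • shiftedPsi κ psi 1 0 (ε • k)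

/-- `P (w_1, …, w_n) = (w_1, 0, …, 0)`, applied pointwise. -/
def firstProj {d n : ℕ} [NeZero n] (w : RVec d → CVec n) (k : RVec d) : CVec n :=
  WithLp.toLp 2 (fun l => if l = 0 then w k l else 0)

/-- `P^⊥ = I - P`, applied pointwise. -/
def firstProjPerp {d n : ℕ} [NeZero n] (w : RVec d → CVec n) (k : RVec d) : CVec n :=
  w k - firstProj w k

/-- The scaled norm `2 ‖P y₁‖ + (2/ε) ‖P^⊥ y₁‖ + (2/ε²) ‖y₃‖` of a pair `(y₁, y₃)`. -/
def scaledNorm {d n : ℕ} [NeZero n] (ε : ℝ) (y₁ y₃ : RVec d → CVec n) : ENNReal :=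
  2 * normL1 (firstProj y₁) + ENNReal.ofReal (2 / ε) * normL1 (firstProjPerp y₁)
    + ENNReal.ofReal (2 / ε ^ 2) * normL1 y₃

end

/-! On the Fourier side the modes satisfy `∂_t û_j = -(i/ε) 𝓛(jω, jκ + εk) û_j + ε N_j`, with `N_j`
a sum of trilinear convolutions. The matrix is Hermitian, so the linear flow preserves `|û_j(k)|`
for every `k`, and with it every weighted norm `∫ (1 + |k|)^s |û_j| dk`. These norms grow only
through the forcing `ε N_j` (`slopeLE_wN`), and Gronwall's inequality over a time `O(1/ε)` costs a
factor `O(1)`. This gives boundedness but no smallness. Smallness comes from oscillation and is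
extracted by normal form transformations, in which every power of `|k|` produced by an expansion at
`k = 0` is paid with one power of the weight: weight 3 for the data, weight 2 after one step, weight
1 after two. Weight 1 controls `D_μ`.

First step (`Admissible.ubd_diff`). The polarized part `p = 𝒫_ε û_1` is slow: its frequency
`λ_{11}(εk)/ε` is `O(|k|)`, because `λ_{11}(0) = 0` and `λ_{11}` is Lipschitz. The nonlinearity
`F_j` evaluated at `p` is therefore slow as well, whereas the linear equations for `𝒫_ε^⊥ û_1` and
`û_3` have frequencies of order `1/ε`: by the spectral gap `𝓛(ω, κ)` is invertible on the complement
of its kernel, and `𝓛(3ω, 3κ)` is invertible. Adding `i ε² 𝓛⁻¹ F_j` to the unknowns removes `ε F_j`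
up to terms of order `ε²`. The rest of the forcing is `ε` times something linear in the unknowns, so
both are `O(ε)` with weight 2.

Second step (`Admissible.ubd_three`). In the equation for `û_3` the nonlinearity consists of `T(p,
p, p)`, of terms linear in `𝒫_ε^⊥ û_1`, of terms containing `û_{±3}`, and of `O(ε²)`. The slow term
`T(p, p, p)` is removed to two orders. This uses two time derivatives of `p`, which exist in `L¹`
after a cutoff to `|k| ≤ 1/ε`; the cutoff costs `ε² |k|²`. In the linear terms, the spectral
component number `l` of `𝒫_ε^⊥ û_1` with respect to `𝓛(ω, κ)` oscillates with frequency
`λ_{1l}(0)/ε`, and it is removed by solving `(𝓛(3ω, 3κ) - λ_{1l}(0)) B = I`, which is possible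
exactly by non-resonance. What is left is `ε (û_3 + O(ε²))`, and Gronwall's inequality yields
`O(ε²)` with weight 1.

All constants depend on the solution only through an `L¹` bound, since weighted bounds persist as
long as the `L¹` norm is bounded (`ModeSystem.persistence`); `exists_uniform_bound` puts this
together. For the existence of `t_⋆` the `L¹` bound comes from a comparison argument on a short
interval (`exists_local_bound`), and for the second claim from `(*)` itself. As `Ψ_j` is unitary and
`exp((i t/ε) Λ_j)` only changes phases, the norms of `z_j` and of its parts are those of `û_j` and
of its projections, pointwise in `k`. -/

noncomputable section

set_option linter.unusedSectionVars false

open scoped ENNReal NNReal Topology Convolution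

/-! ### Weights and weighted `L¹` bounds -/

/-- The weight `(1 + |k|)^s`, truncated at the level `R`. -/
def wt {d : ℕ} (s : ℕ) (R : ℝ≥0∞) (k : RVec d) : ℝ≥0∞ := min ((1 + ‖k‖ₑ) ^ s) R

lemma measurable_wt {d : ℕ} (s : ℕ) (R : ℝ≥0∞) : Measurable (wt (d := d) s R) := by
  unfold wt; fun_prop

lemma wt_top {d : ℕ} (s : ℕ) (k : RVec d) : wt s ⊤ k = (1 + ‖k‖ₑ) ^ s := by simp [wt]

lemma one_le_wt {d : ℕ} (s : ℕ) {R : ℝ≥0∞} (hR : 1 ≤ R) (k : RVec d) : 1 ≤ wt s R k :=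
  le_min (one_le_pow₀ (by simp)) hR

lemma wt_le {d : ℕ} (s : ℕ) (R : ℝ≥0∞) (k : RVec d) : wt s R k ≤ R := min_le_right _ _

lemma wt_le_wt_top {d : ℕ} (s : ℕ) (R : ℝ≥0∞) (k : RVec d) : wt s R k ≤ wt s ⊤ k := by
  rw [wt_top]; exact min_le_left _ _

lemma wt_le_wt_of_le {d : ℕ} {s s' : ℕ} (h : s ≤ s') (R : ℝ≥0∞) (k : RVec d) :
    wt s R k ≤ wt s' R k :=
  min_le_min (pow_le_pow_right₀ (by simp) h) le_rfl

lemma wt_zero {d : ℕ} {R : ℝ≥0∞} (hR : 1 ≤ R) (k : RVec d) : wt 0 R k = 1 := by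
  simp [wt, hR]

lemma one_add_enorm_add_le {d : ℕ} (a b : RVec d) :
    1 + ‖a + b‖ₑ ≤ (1 + ‖a‖ₑ) * (1 + ‖b‖ₑ) := by
  calc 1 + ‖a + b‖ₑ ≤ 1 + (‖a‖ₑ + ‖b‖ₑ) := by gcongr; exact enorm_add_le a b
    _ ≤ 1 + (‖a‖ₑ + ‖b‖ₑ) + ‖a‖ₑ * ‖b‖ₑ := le_self_add
    _ = _ := by ring

/-- Where the truncation is active at `a`, the value `R` dominates already, because the second
factor is at least one. -/
lemma wt_add_le_mul {d : ℕ} (s : ℕ) (R : ℝ≥0∞) (a b : RVec d) :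
    wt s R (a + b) ≤ wt s R a * wt s ⊤ b := by
  have h1 : (1 : ℝ≥0∞) ≤ wt s ⊤ b := one_le_wt s (by simp) b
  rcases le_total ((1 + ‖a‖ₑ) ^ s) R with h | h
  · have : wt s R a = (1 + ‖a‖ₑ) ^ s := by simp [wt, h]
    rw [this, wt_top, ← mul_pow]
    exact (min_le_left _ _).trans (pow_le_pow_left₀ (by simp) (one_add_enorm_add_le a b) s)
  · have : wt s R a = R := by simp [wt, h]
    rw [this]
    exact (wt_le s R _).trans (le_mul_of_one_le_right (by simp) h1)

lemma wt_add_le_mul' {d : ℕ} (s : ℕ) (R : ℝ≥0∞) (a b : RVec d) :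
    wt s R (a + b) ≤ wt s ⊤ a * wt s R b := by
  rw [add_comm, mul_comm]; exact wt_add_le_mul s R b a

/-- The larger of the two frequencies carries the weight, at the price `2 ^ s`. Compared with the
submultiplicative bounds, this leads to convolution estimates that are linear in the weighted norms,
with plain `L¹` norms of the other factors. -/
lemma wt_add_le_add {d : ℕ} (s : ℕ) (R : ℝ≥0∞) (a b : RVec d) :
    wt s R (a + b) ≤ 2 ^ s * (wt s R a + wt s R b) := by
  have key : ∀ a b : RVec d, ‖a‖ₑ ≤ ‖b‖ₑ → wt s R (a + b) ≤ 2 ^ s * wt s R b := by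
    intro a b hab
    have h2 : 1 + ‖a + b‖ₑ ≤ 2 * (1 + ‖b‖ₑ) := by
      calc 1 + ‖a + b‖ₑ ≤ 1 + (‖a‖ₑ + ‖b‖ₑ) := by gcongr; exact enorm_add_le a b
        _ ≤ 1 + (‖b‖ₑ + ‖b‖ₑ) := by gcongr
        _ ≤ 1 + (‖b‖ₑ + ‖b‖ₑ) + 1 := le_self_add
        _ = _ := by ring
    have h1 : (1 : ℝ≥0∞) ≤ 2 ^ s := one_le_pow₀ (by norm_num)
    rcases le_total ((1 + ‖b‖ₑ) ^ s) R with h | h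
    · have : wt s R b = (1 + ‖b‖ₑ) ^ s := by simp [wt, h]
      rw [this, ← mul_pow]
      exact (min_le_left _ _).trans (pow_le_pow_left₀ (by simp) h2 s)
    · have : wt s R b = R := by simp [wt, h]
      rw [this]
      exact (wt_le s R _).trans (le_mul_of_one_le_left (by simp) h1)
  rcases le_total ‖a‖ₑ ‖b‖ₑ with h | h
  · exact (key a b h).trans (by gcongr; exact le_add_self)
  · rw [add_comm a b]
    exact (key b a h).trans (by gcongr; exact le_self_add)

lemma enorm_mul_wt_le {d : ℕ} (s : ℕ) (R : ℝ≥0∞) (k : RVec d) :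
    ‖k‖ₑ * wt s R k ≤ wt (s + 1) ⊤ k := by
  rw [wt_top, pow_succ, mul_comm]
  exact mul_le_mul' (min_le_left _ _) le_add_self

section WBd
variable {d : ℕ} {E F G : Type*} [NormedAddCommGroup E] [NormedAddCommGroup F]
  [NormedAddCommGroup G]

/-- The weighted bound `∫ w |f| ≤ c` with a nonnegative real `c`. -/
def WBd (w : RVec d → ℝ≥0∞) (f : RVec d → E) (c : ℝ) : Prop :=
  0 ≤ c ∧ ∫⁻ k, w k * ‖f k‖ₑ ≤ ENNReal.ofReal c

variable {w w' : RVec d → ℝ≥0∞} {f g : RVec d → E} {a b c : ℝ}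

lemma WBd.nonneg (h : WBd w f c) : 0 ≤ c := h.1

lemma WBd.mono (h : WBd w f c) (hc : c ≤ b) : WBd w f b :=
  ⟨h.1.trans hc, h.2.trans (ENNReal.ofReal_le_ofReal hc)⟩

lemma WBd.of_le {h : RVec d → F} (hg : WBd w' h c) (ha : 0 ≤ a)
    (hle : ∀ᵐ k, w k * ‖f k‖ₑ ≤ ENNReal.ofReal a * (w' k * ‖h k‖ₑ)) : WBd w f (a * c) := by
  refine ⟨mul_nonneg ha hg.1, (lintegral_mono_ae hle).trans ?_⟩
  rw [lintegral_const_mul' _ _ ENNReal.ofReal_ne_top, ENNReal.ofReal_mul ha]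
  gcongr
  exact hg.2

lemma WBd.of_le_one {h : RVec d → F} (hg : WBd w' h c)
    (hle : ∀ᵐ k, w k * ‖f k‖ₑ ≤ w' k * ‖h k‖ₑ) : WBd w f c := by
  simpa using hg.of_le (a := 1) zero_le_one (by simpa using hle)

lemma WBd.of_norm_le {h : RVec d → F} (hg : WBd w h c) (ha : 0 ≤ a)
    (hle : ∀ᵐ k, ‖f k‖ ≤ a * ‖h k‖) : WBd w f (a * c) := by
  refine hg.of_le ha ?_
  filter_upwards [hle] with k hk
  rw [mul_left_comm]
  gcongr
  rw [← ofReal_norm, ← ofReal_norm, ← ENNReal.ofReal_mul ha]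
  exact ENNReal.ofReal_le_ofReal hk

lemma WBd.congr (hg : WBd w f c) (hle : f =ᵐ[volume] g) : WBd w g c :=
  hg.of_le_one (by filter_upwards [hle] with k hk; rw [hk])

lemma WBd.weight_mono (hg : WBd w' f c) (h : ∀ k, w k ≤ w' k) : WBd w f c :=
  hg.of_le_one (.of_forall fun k => by gcongr; exact h k)

lemma WBd.zero : WBd w (fun _ => (0 : E)) 0 := ⟨le_rfl, by simp⟩

lemma WBd.add (hw : Measurable w) (hfm : AEStronglyMeasurable f volume)
    (hf : WBd w f a) (hg : WBd w g b) : WBd w (fun k => f k + g k) (a + b) := by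
  refine ⟨add_nonneg hf.1 hg.1, ?_⟩
  rw [ENNReal.ofReal_add hf.1 hg.1]
  calc ∫⁻ k, w k * ‖f k + g k‖ₑ ≤ ∫⁻ k, (w k * ‖f k‖ₑ + w k * ‖g k‖ₑ) := by
        refine lintegral_mono fun k => ?_
        rw [← mul_add]; gcongr; exact enorm_add_le _ _
    _ = _ := lintegral_add_left' (hw.aemeasurable.mul hfm.enorm) _
    _ ≤ _ := add_le_add hf.2 hg.2

lemma WBd.toReal_le (h : WBd w f c) : (∫⁻ k, w k * ‖f k‖ₑ).toReal ≤ c :=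
  ENNReal.toReal_le_of_le_ofReal h.1 h.2

lemma WBd.of_ne_top (h : ∫⁻ k, w k * ‖f k‖ₑ ≠ ⊤) : WBd w f (∫⁻ k, w k * ‖f k‖ₑ).toReal :=
  ⟨ENNReal.toReal_nonneg, by rw [ENNReal.ofReal_toReal h]⟩

/-- Monotone convergence along the levels `m + 1`. Truncated weighted norms are finite and
continuous on all of `L¹`, so differential inequalities are proved for them, with constants that do
not depend on the level, and the truncation is removed at the end. -/
lemma WBd.of_truncated {s : ℕ} (hf : AEStronglyMeasurable f volume)
    (h : ∀ R : ℝ≥0, 1 ≤ R → WBd (wt s R) f c) : WBd (wt s ⊤) f c := by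
  refine ⟨(h 1 le_rfl).1, ?_⟩
  have hsup : ∀ k : RVec d, wt s ⊤ k * ‖f k‖ₑ
      = ⨆ m : ℕ, wt s (((m + 1 : ℕ) : ℝ≥0) : ℝ≥0∞) k * ‖f k‖ₑ := by
    intro k
    rw [← ENNReal.iSup_mul]
    congr 1
    refine le_antisymm ?_ (iSup_le fun m => wt_le_wt_top _ _ _)
    have hfin : wt s ⊤ k ≠ ⊤ := by rw [wt_top]; finiteness
    obtain ⟨m, hm⟩ := ENNReal.exists_nat_gt hfin
    refine le_iSup_of_le m ?_
    rw [wt_top] at hm ⊢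
    refine le_min le_rfl (hm.le.trans ?_)
    push_cast
    exact le_self_add
  simp_rw [hsup]
  rw [lintegral_iSup' (f := fun (m : ℕ) k => wt s (((m + 1 : ℕ) : ℝ≥0) : ℝ≥0∞) k * ‖f k‖ₑ)
    (fun m => ((measurable_wt _ _).aemeasurable.mul hf.enorm))]
  · exact iSup_le fun m => (h _ (by simp)).2
  · refine .of_forall fun k m m' hmm => ?_
    dsimp only
    gcongr
    refine min_le_min le_rfl ?_
    exact_mod_cast Nat.succ_le_succ hmm

end WBd

section WBdLp
variable {d : ℕ} {E F G : Type*} [NormedAddCommGroup E] [NormedAddCommGroup F]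
  [NormedAddCommGroup G] [NormedSpace ℂ E] [NormedSpace ℂ F] [NormedSpace ℂ G]
variable {w w' : RVec d → ℝ≥0∞} {f g : Lp E 1 (volume : Measure (RVec d))} {a b c : ℝ}

lemma WBd.add_Lp (hw : Measurable w) (hf : WBd w f a) (hg : WBd w g b) :
    WBd w (f + g : Lp E 1 (volume : Measure (RVec d))) (a + b) :=
  (hf.add hw (Lp.aestronglyMeasurable f) hg).congr (Lp.coeFn_add f g).symm

lemma WBd.smul_Lp (hf : WBd w f a) (z : ℂ) :
    WBd w (z • f : Lp E 1 (volume : Measure (RVec d))) (‖z‖ * a) := by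
  refine hf.of_norm_le (norm_nonneg z) ?_
  filter_upwards [Lp.coeFn_smul z f] with k hk
  rw [hk, Pi.smul_apply, norm_smul]

lemma WBd.neg_Lp (hf : WBd w f a) : WBd w (-f : Lp E 1 (volume : Measure (RVec d))) a := by
  refine hf.of_le_one ?_
  filter_upwards [Lp.coeFn_neg f] with k hk
  rw [hk, Pi.neg_apply, enorm_neg]

lemma WBd.zero_Lp : WBd w (0 : Lp E 1 (volume : Measure (RVec d))) 0 :=
  WBd.zero.congr (Lp.coeFn_zero E 1 _).symm

lemma WBd.sum_Lp {ι : Type*} (hw : Measurable w) (s : Finset ι)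
    {f : ι → Lp E 1 (volume : Measure (RVec d))} {a : ι → ℝ} (h : ∀ i ∈ s, WBd w (f i) (a i)) :
    WBd w (∑ i ∈ s, f i : Lp E 1 (volume : Measure (RVec d))) (∑ i ∈ s, a i) := by
  classical
  induction s using Finset.induction_on with
  | empty => simpa using WBd.zero_Lp
  | insert i s hi ih =>
    rw [Finset.sum_insert hi, Finset.sum_insert hi]
    exact (h i (by simp)).add_Lp hw (ih fun j hj => h j (by simp [hj]))

lemma WBd.clm_Lp (hf : WBd w f a) (L : E →L[ℂ] F) : WBd w (L.compLp f) (‖L‖ * a) := by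
  refine hf.of_norm_le (norm_nonneg L) ?_
  filter_upwards [L.coeFn_compLp f] with k hk
  rw [hk]; exact L.le_opNorm _

lemma lintegral_enorm_Lp (f : Lp E 1 (volume : Measure (RVec d))) :
    ∫⁻ k, ‖f k‖ₑ = ENNReal.ofReal ‖f‖ := by
  rw [Lp.norm_def, eLpNorm_one_eq_lintegral_enorm, ENNReal.ofReal_toReal]
  rw [← eLpNorm_one_eq_lintegral_enorm]; exact Lp.eLpNorm_ne_top f

lemma WBd.norm_Lp (f : Lp E 1 (volume : Measure (RVec d))) {R : ℝ≥0} (hw : ∀ k, w k ≤ R) :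
    WBd w f (R * ‖f‖) := by
  refine ⟨by positivity, ?_⟩
  rw [ENNReal.ofReal_mul (by positivity), ← lintegral_enorm_Lp, ENNReal.ofReal_coe_nnreal,
    ← lintegral_const_mul' _ _ ENNReal.coe_ne_top]
  exact lintegral_mono fun k => by gcongr; exact hw k

lemma WBd.norm_le (hw : ∀ k, 1 ≤ w k) (h : WBd w f c) : ‖f‖ ≤ c := by
  rw [← ENNReal.ofReal_le_ofReal_iff h.1, ← lintegral_enorm_Lp]
  refine le_trans (lintegral_mono fun k => ?_) h.2
  exact le_mul_of_one_le_left (by simp) (hw k)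

end WBdLp

/-! ### Convolutions in weighted `L¹`. -/

section Conv
variable {d : ℕ} {E F G : Type*} [NormedAddCommGroup E] [NormedAddCommGroup F]
  [NormedAddCommGroup G] [NormedSpace ℂ E] [NormedSpace ℂ F] [NormedSpace ℂ G]
  [NormedSpace ℝ G]

/-- Tonelli's theorem and the translation `k = a + b`. The weight ends up at a sum of frequencies,
so each inequality for `w (a + b)` becomes a convolution estimate. -/
lemma lintegral_convolution_le (L : E →L[ℂ] F →L[ℂ] G) {f : RVec d → E} {g : RVec d → F}
    (hf : StronglyMeasurable f) (hg : StronglyMeasurable g) {w : RVec d → ℝ≥0∞}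
    (hw : Measurable w) :
    ∫⁻ k, w k * ‖(f ⋆[L] g) k‖ₑ ≤ ‖L‖ₑ * ∫⁻ a, ∫⁻ b, w (a + b) * ‖f a‖ₑ * ‖g b‖ₑ := by
  calc ∫⁻ k, w k * ‖(f ⋆[L] g) k‖ₑ
      ≤ ∫⁻ k, ∫⁻ a, ‖L‖ₑ * (w k * ‖f a‖ₑ * ‖g (k - a)‖ₑ) := by
        refine lintegral_mono fun k => ?_
        have hm : Measurable fun a => ‖f a‖ₑ * ‖g (k - a)‖ₑ :=
          hf.enorm.mul (hg.enorm.comp (measurable_const.sub measurable_id))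
        calc w k * ‖(f ⋆[L] g) k‖ₑ ≤ w k * ∫⁻ a, ‖L‖ₑ * (‖f a‖ₑ * ‖g (k - a)‖ₑ) := by
              gcongr
              rw [convolution_def]
              refine (enorm_integral_le_lintegral_enorm _).trans (lintegral_mono fun a => ?_)
              rw [← mul_assoc]
              exact (ContinuousLinearMap.le_opENorm _ _).trans
                (by gcongr; exact ContinuousLinearMap.le_opENorm _ _)
          _ = ∫⁻ a, ‖L‖ₑ * (w k * ‖f a‖ₑ * ‖g (k - a)‖ₑ) := by
              rw [← lintegral_const_mul _ (by fun_prop)]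
              refine lintegral_congr fun a => ?_
              ring
    _ = ∫⁻ a, ∫⁻ k, ‖L‖ₑ * (w k * ‖f a‖ₑ * ‖g (k - a)‖ₑ) := by
        refine lintegral_lintegral_swap ?_
        refine Measurable.aemeasurable ?_
        have h1 : Measurable fun p : RVec d × RVec d => ‖f p.2‖ₑ := hf.enorm.comp measurable_snd
        have h2 : Measurable fun p : RVec d × RVec d => ‖g (p.1 - p.2)‖ₑ :=
          hg.enorm.comp (measurable_fst.sub measurable_snd)
        have h3 : Measurable fun p : RVec d × RVec d => w p.1 := hw.comp measurable_fst
        exact ((h3.mul h1).mul h2).const_mul _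
    _ = ∫⁻ a, ‖L‖ₑ * ∫⁻ b, w (a + b) * ‖f a‖ₑ * ‖g b‖ₑ := by
        refine lintegral_congr fun a => ?_
        rw [← lintegral_add_left_eq_self _ a]
        simp only [add_sub_cancel_left]
        rw [lintegral_const_mul]
        have h2 : Measurable fun b => ‖g b‖ₑ := hg.enorm
        fun_prop
    _ = _ := by
        rw [lintegral_const_mul' _ _ (by finiteness)]

lemma lintegral_convolution_le_mul (L : E →L[ℂ] F →L[ℂ] G) {f : RVec d → E} {g : RVec d → F}
    (hf : StronglyMeasurable f) (hg : StronglyMeasurable g) {w w₁ w₂ : RVec d → ℝ≥0∞}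
    (hw : Measurable w) (hw₁ : Measurable w₁) (hw₂ : Measurable w₂)
    (h : ∀ a b, w (a + b) ≤ w₁ a * w₂ b) :
    ∫⁻ k, w k * ‖(f ⋆[L] g) k‖ₑ
      ≤ ‖L‖ₑ * ((∫⁻ a, w₁ a * ‖f a‖ₑ) * ∫⁻ b, w₂ b * ‖g b‖ₑ) := by
  refine (lintegral_convolution_le L hf hg hw).trans ?_
  gcongr
  have h1 : Measurable fun a => ‖f a‖ₑ := hf.enorm
  have h2 : Measurable fun a => ‖g a‖ₑ := hg.enorm
  rw [← lintegral_mul_const _ (by fun_prop)]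
  refine lintegral_mono fun a => ?_
  dsimp only
  rw [← lintegral_const_mul _ (by fun_prop)]
  refine lintegral_mono fun b => ?_
  calc w (a + b) * ‖f a‖ₑ * ‖g b‖ₑ ≤ (w₁ a * w₂ b) * ‖f a‖ₑ * ‖g b‖ₑ := by gcongr; exact h a b
    _ = _ := by ring

lemma lintegral_convolution_le_add (L : E →L[ℂ] F →L[ℂ] G) {f : RVec d → E} {g : RVec d → F}
    (hf : StronglyMeasurable f) (hg : StronglyMeasurable g) {w : RVec d → ℝ≥0∞}
    (hw : Measurable w) {C : ℝ≥0∞} (hC : C ≠ ⊤) (h : ∀ a b, w (a + b) ≤ C * (w a + w b)) :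
    ∫⁻ k, w k * ‖(f ⋆[L] g) k‖ₑ
      ≤ C * ‖L‖ₑ * ((∫⁻ a, w a * ‖f a‖ₑ) * (∫⁻ b, ‖g b‖ₑ)
          + (∫⁻ a, ‖f a‖ₑ) * ∫⁻ b, w b * ‖g b‖ₑ) := by
  refine (lintegral_convolution_le L hf hg hw).trans ?_
  rw [mul_comm C, mul_assoc]
  gcongr
  have h1 : Measurable fun a => ‖f a‖ₑ := hf.enorm
  have h2 : Measurable fun a => ‖g a‖ₑ := hg.enorm
  rw [← lintegral_mul_const _ (by fun_prop), ← lintegral_mul_const _ (by fun_prop),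
    ← lintegral_add_left (by fun_prop), ← lintegral_const_mul' _ _ hC]
  refine lintegral_mono fun a => ?_
  dsimp only
  rw [← lintegral_const_mul _ (by fun_prop), ← lintegral_const_mul _ (by fun_prop),
    ← lintegral_add_left (by fun_prop), ← lintegral_const_mul' _ _ hC]
  refine lintegral_mono fun b => ?_
  calc w (a + b) * ‖f a‖ₑ * ‖g b‖ₑ ≤ (C * (w a + w b)) * ‖f a‖ₑ * ‖g b‖ₑ := by
        gcongr; exact h a b
    _ = _ := by ring

end Conv

section ConvL1
variable {d : ℕ} {E F G : Type*} [NormedAddCommGroup E] [NormedAddCommGroup F]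
  [NormedAddCommGroup G] [NormedSpace ℂ E] [NormedSpace ℂ F] [NormedSpace ℂ G]
  [CompleteSpace G]

lemma Lp.integrable_one (f : Lp E 1 (volume : Measure (RVec d))) : Integrable f :=
  L1.integrable_coeFn f

/-- The convolution of two integrable functions with respect to a bounded bilinear map. -/
def convL1Aux (L : E →L[ℂ] F →L[ℂ] G) (f : Lp E 1 (volume : Measure (RVec d)))
    (g : Lp F 1 (volume : Measure (RVec d))) : Lp G 1 (volume : Measure (RVec d)) :=
  ((Lp.integrable_one f).integrable_convolution L (Lp.integrable_one g)).toL1 _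

lemma coeFn_convL1Aux (L : E →L[ℂ] F →L[ℂ] G) (f : Lp E 1 (volume : Measure (RVec d)))
    (g : Lp F 1 (volume : Measure (RVec d))) : convL1Aux L f g =ᵐ[volume] (f ⋆[L] g) :=
  Integrable.coeFn_toL1 _

lemma norm_convL1Aux_le (L : E →L[ℂ] F →L[ℂ] G) (f : Lp E 1 (volume : Measure (RVec d)))
    (g : Lp F 1 (volume : Measure (RVec d))) : ‖convL1Aux L f g‖ ≤ ‖L‖ * ‖f‖ * ‖g‖ := by
  rw [← ENNReal.ofReal_le_ofReal_iff (by positivity), ← lintegral_enorm_Lp]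
  have := lintegral_convolution_le_mul L (Lp.stronglyMeasurable f) (Lp.stronglyMeasurable g)
    (w := 1) (w₁ := 1) (w₂ := 1) measurable_const measurable_const measurable_const (by simp)
  simp only [Pi.one_apply, one_mul, lintegral_enorm_Lp] at this
  have e : ∫⁻ k, ‖convL1Aux L f g k‖ₑ = ∫⁻ k, ‖(f ⋆[L] g) k‖ₑ :=
    lintegral_congr_ae ((coeFn_convL1Aux L f g).fun_comp (fun x => ‖x‖ₑ))
  have hL : ‖L‖ₑ = ENNReal.ofReal ‖L‖ := (ofReal_norm L).symm
  rw [e]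
  refine this.trans (le_of_eq ?_)
  rw [mul_assoc, ENNReal.ofReal_mul (norm_nonneg L), ENNReal.ofReal_mul (norm_nonneg f), hL]

/-- Convolution as a bounded bilinear map on `L¹`. -/
def convL1 (L : E →L[ℂ] F →L[ℂ] G) : Lp E 1 (volume : Measure (RVec d)) →L[ℂ]
    Lp F 1 (volume : Measure (RVec d)) →L[ℂ] Lp G 1 (volume : Measure (RVec d)) :=
  LinearMap.mkContinuous₂ (LinearMap.mk₂ ℂ (convL1Aux L)
    (by
      intro f f' g
      refine Lp.ext ?_
      -- Additivity of a convolution at `k` requires both defining integrals to converge there,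
      -- which holds for almost every `k`.
      have e1 := (Lp.integrable_one f).ae_convolution_exists L (Lp.integrable_one g)
      have e2 := (Lp.integrable_one f').ae_convolution_exists L (Lp.integrable_one g)
      have e3 : (⇑(f + f') ⋆[L] ⇑g) = ((⇑f + ⇑f') ⋆[L] ⇑g) :=
        convolution_congr L (Lp.coeFn_add f f') Filter.EventuallyEq.rfl
      filter_upwards [e1, e2, coeFn_convL1Aux L f g, coeFn_convL1Aux L f' g,
        coeFn_convL1Aux L (f + f') g, Lp.coeFn_add (convL1Aux L f g) (convL1Aux L f' g)]
        with k h1 h2 h3 h4 h5 h6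
      rw [h5, h6, Pi.add_apply, h3, h4, e3]
      exact h1.add_distrib h2)
    (by
      intro z f g
      refine Lp.ext ?_
      have e3 : (⇑(z • f) ⋆[L] ⇑g) = ((z • ⇑f) ⋆[L] ⇑g) :=
        convolution_congr L (Lp.coeFn_smul z f) Filter.EventuallyEq.rfl
      filter_upwards [coeFn_convL1Aux L f g, coeFn_convL1Aux L (z • f) g,
        Lp.coeFn_smul z (convL1Aux L f g)] with k h3 h4 h5
      rw [h4, h5, Pi.smul_apply, h3, e3, smul_convolution, Pi.smul_apply])
    (by
      intro f g g'
      refine Lp.ext ?_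
      have e1 := (Lp.integrable_one f).ae_convolution_exists L (Lp.integrable_one g)
      have e2 := (Lp.integrable_one f).ae_convolution_exists L (Lp.integrable_one g')
      have e3 : (⇑f ⋆[L] ⇑(g + g')) = (⇑f ⋆[L] (⇑g + ⇑g')) :=
        convolution_congr L Filter.EventuallyEq.rfl (Lp.coeFn_add g g')
      filter_upwards [e1, e2, coeFn_convL1Aux L f g, coeFn_convL1Aux L f g',
        coeFn_convL1Aux L f (g + g'), Lp.coeFn_add (convL1Aux L f g) (convL1Aux L f g')]
        with k h1 h2 h3 h4 h5 h6
      rw [h5, h6, Pi.add_apply, h3, h4, e3]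
      exact h1.distrib_add h2)
    (by
      intro z f g
      refine Lp.ext ?_
      have e3 : (⇑f ⋆[L] ⇑(z • g)) = (⇑f ⋆[L] (z • ⇑g)) :=
        convolution_congr L Filter.EventuallyEq.rfl (Lp.coeFn_smul z g)
      filter_upwards [coeFn_convL1Aux L f g, coeFn_convL1Aux L f (z • g),
        Lp.coeFn_smul z (convL1Aux L f g)] with k h3 h4 h5
      rw [h4, h5, Pi.smul_apply, h3, e3, convolution_smul, Pi.smul_apply]))
    ‖L‖ (norm_convL1Aux_le L)

lemma coeFn_convL1 (L : E →L[ℂ] F →L[ℂ] G) (f : Lp E 1 (volume : Measure (RVec d)))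
    (g : Lp F 1 (volume : Measure (RVec d))) : convL1 L f g =ᵐ[volume] (f ⋆[L] g) :=
  coeFn_convL1Aux L f g

lemma WBd.convL1_mul (L : E →L[ℂ] F →L[ℂ] G) {f : Lp E 1 (volume : Measure (RVec d))}
    {g : Lp F 1 (volume : Measure (RVec d))} {w w₁ w₂ : RVec d → ℝ≥0∞}
    (hw : Measurable w) (hw₁ : Measurable w₁) (hw₂ : Measurable w₂)
    (h : ∀ a b, w (a + b) ≤ w₁ a * w₂ b) {a b : ℝ} (hf : WBd w₁ f a) (hg : WBd w₂ g b) :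
    WBd w (convL1 L f g) (‖L‖ * a * b) := by
  have ha := hf.1
  have hb := hg.1
  refine WBd.congr ⟨by positivity, ?_⟩ (coeFn_convL1 L f g).symm
  refine (lintegral_convolution_le_mul L (Lp.stronglyMeasurable f) (Lp.stronglyMeasurable g)
    hw hw₁ hw₂ h).trans ?_
  have hL : ‖L‖ₑ = ENNReal.ofReal ‖L‖ := (ofReal_norm L).symm
  rw [mul_assoc, ENNReal.ofReal_mul (norm_nonneg L), ENNReal.ofReal_mul ha, hL]
  gcongr
  exacts [hf.2, hg.2]

lemma WBd.convL1_add (L : E →L[ℂ] F →L[ℂ] G) {f : Lp E 1 (volume : Measure (RVec d))}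
    {g : Lp F 1 (volume : Measure (RVec d))} {w : RVec d → ℝ≥0∞}
    (hw : Measurable w) {C : ℝ} (hC : 0 ≤ C)
    (h : ∀ a b, w (a + b) ≤ ENNReal.ofReal C * (w a + w b)) {a b a₀ b₀ : ℝ}
    (hf : WBd w f a) (hg : WBd w g b) (ha₀ : ‖f‖ ≤ a₀) (hb₀ : ‖g‖ ≤ b₀) :
    WBd w (convL1 L f g) (C * ‖L‖ * (a * b₀ + a₀ * b)) := by
  have ha := hf.1
  have hb := hg.1
  have h1 := (norm_nonneg _).trans ha₀
  have h2 := (norm_nonneg _).trans hb₀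
  refine WBd.congr ⟨by positivity, ?_⟩ (coeFn_convL1 L f g).symm
  refine (lintegral_convolution_le_add L (Lp.stronglyMeasurable f) (Lp.stronglyMeasurable g)
    hw ENNReal.ofReal_ne_top h).trans ?_
  have hL : ‖L‖ₑ = ENNReal.ofReal ‖L‖ := (ofReal_norm L).symm
  rw [ENNReal.ofReal_mul (by positivity), ENNReal.ofReal_mul hC, hL,
    ENNReal.ofReal_add (by positivity) (by positivity), ENNReal.ofReal_mul ha,
    ENNReal.ofReal_mul h1, lintegral_enorm_Lp, lintegral_enorm_Lp]
  gcongr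
  exacts [hf.2, hg.2]

end ConvL1

end

noncomputable section

set_option linter.unusedSectionVars false

open scoped ENNReal NNReal Topology Convolution

/-! ### Weighted norms and energy estimates -/

/-- The weighted norm `∫ w |f|`. -/
def wN {d : ℕ} {E : Type*} [NormedAddCommGroup E] (w : RVec d → ℝ≥0∞) (f : RVec d → E) : ℝ :=
  (∫⁻ k, w k * ‖f k‖ₑ).toReal

/-- The upper right Dini derivative of `f` at `t` is at most `c`. -/
def SlopeLE (f : ℝ → ℝ) (t c : ℝ) : Prop :=
  ∀ r, c < r → ∀ᶠ z in 𝓝[>] t, (z - t)⁻¹ * (f z - f t) < r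

lemma SlopeLE.mono {f : ℝ → ℝ} {t c c' : ℝ} (h : SlopeLE f t c) (hc : c ≤ c') : SlopeLE f t c' :=
  fun r hr => h r (hc.trans_lt hr)

lemma SlopeLE.add {f g : ℝ → ℝ} {t a b : ℝ} (hf : SlopeLE f t a) (hg : SlopeLE g t b) :
    SlopeLE (fun z => f z + g z) t (a + b) := by
  intro r hr
  filter_upwards [hf (a + (r - (a + b)) / 2) (by linarith), hg (b + (r - (a + b)) / 2) (by linarith)]
    with z h1 h2
  calc (z - t)⁻¹ * (f z + g z - (f t + g t))
      = (z - t)⁻¹ * (f z - f t) + (z - t)⁻¹ * (g z - g t) := by ring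
    _ < _ := by linarith

/-- This follows from `exp y - 1 ≤ y exp y`. Without the division by `K`, the case `K = 0` has the
same form as the others. -/
lemma gronwallBound_le {δ K e x : ℝ} (hK : 0 ≤ K) (he : 0 ≤ e) (_hx : 0 ≤ x) :
    gronwallBound δ K e x ≤ (δ + e * x) * Real.exp (K * x) := by
  rcases hK.eq_or_lt with h | h
  · subst h; simp [gronwallBound_K0]
  · rw [gronwallBound_of_K_ne_0 h.ne']
    have h1 : Real.exp (K * x) - 1 ≤ K * x * Real.exp (K * x) := by
      have h2 := Real.add_one_le_exp (-(K * x))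
      have h3 : Real.exp (-(K * x)) * Real.exp (K * x) = 1 := by rw [← Real.exp_add]; simp
      nlinarith [Real.exp_pos (K * x)]
    have h4 : e / K * (Real.exp (K * x) - 1) ≤ e / K * (K * x * Real.exp (K * x)) := by gcongr
    have h5 : e / K * (K * x * Real.exp (K * x)) = e * x * Real.exp (K * x) := by
      field_simp
    linarith

/-- Norms along a differentiable curve need not be differentiable, but Gronwall's inequality only
needs the Dini derivative. -/
lemma gronwall_of_slopeLE {f : ℝ → ℝ} {T δ K e : ℝ} (hf : ContinuousOn f (Set.Icc 0 T))
    (hK : 0 ≤ K) (he : 0 ≤ e) (h0 : f 0 ≤ δ)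
    (hs : ∀ t ∈ Set.Ico 0 T, SlopeLE f t (K * f t + e)) :
    ∀ t ∈ Set.Icc 0 T, f t ≤ (δ + e * t) * Real.exp (K * t) := by
  intro t ht
  have := le_gronwallBound_of_liminf_deriv_right_le (f' := fun t => K * f t + e) (K := K) (ε := e)
    hf (fun x hx' r hr => (hs x hx' r hr).frequently) h0 (fun _ _ => le_rfl) t ht
  rw [sub_zero] at this
  exact this.trans (gronwallBound_le hK he ht.1)

/-! ### Weighted norms along skew-adjoint flows. -/

section Energy
variable {d n : ℕ}

lemma L1Space.real_smul_eq (r : ℝ) (f : L1Space d n) : r • f = (r : ℂ) • f := by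
  refine Lp.ext ?_
  filter_upwards [Lp.coeFn_smul r f, Lp.coeFn_smul (r : ℂ) f] with k h1 h2
  rw [h1, h2, Pi.smul_apply, Pi.smul_apply]
  ext i
  simp

lemma norm_add_smul_sq_of_re_inner_eq_zero {a b : CVec n} (hab : RCLike.re (inner ℂ a b : ℂ) = 0)
    (h : ℝ) : ‖a + (h : ℂ) • b‖ ^ 2 = ‖a‖ ^ 2 + h ^ 2 * ‖b‖ ^ 2 := by
  rw [norm_add_sq (𝕜 := ℂ), inner_smul_right, norm_smul, mul_pow]
  have : RCLike.re ((h : ℂ) * inner ℂ a b) = 0 := by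
    simp only [RCLike.re_to_complex, Complex.re_ofReal_mul] at hab ⊢
    rw [hab, mul_zero]
  rw [this]
  simp

/-- By Pythagoras the difference quotient lies between `0` and `h ‖b‖² / ‖a‖`. At `a = 0` it would
equal `‖b‖`, which is why `h0` is needed. -/
lemma tendsto_norm_add_smul_slope {a b : CVec n} (hab : RCLike.re (inner ℂ a b : ℂ) = 0)
    (h0 : a = 0 → b = 0) :
    Filter.Tendsto (fun h : ℝ => h⁻¹ * (‖a + (h : ℂ) • b‖ - ‖a‖)) (𝓝[>] 0) (𝓝 0) := by
  by_cases ha : a = 0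
  · simp [ha, h0 ha]
  have ha' : 0 < ‖a‖ := norm_pos_iff.2 ha
  have hup : Filter.Tendsto (fun h : ℝ => h * (‖b‖ ^ 2 / ‖a‖)) (𝓝[>] 0) (𝓝 0) := by
    have : Filter.Tendsto (fun h : ℝ => h * (‖b‖ ^ 2 / ‖a‖)) (𝓝 0) (𝓝 (0 * (‖b‖ ^ 2 / ‖a‖))) :=
      (continuous_id.mul continuous_const).tendsto _
    rw [zero_mul] at this
    exact this.mono_left nhdsWithin_le_nhds
  refine tendsto_of_tendsto_of_tendsto_of_le_of_le' tendsto_const_nhds hup ?_ ?_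
  · filter_upwards [self_mem_nhdsWithin] with h hh
    have hh : 0 < h := hh
    have hsq := norm_add_smul_sq_of_re_inner_eq_zero hab h
    have : ‖a‖ ≤ ‖a + (h : ℂ) • b‖ := by
      refine (sq_le_sq₀ (norm_nonneg _) (norm_nonneg _)).1 ?_
      rw [hsq]; nlinarith [sq_nonneg (h * ‖b‖)]
    exact mul_nonneg (inv_nonneg.2 hh.le) (by linarith)
  · filter_upwards [self_mem_nhdsWithin] with h hh
    have hh : 0 < h := hh
    have hsq := norm_add_smul_sq_of_re_inner_eq_zero hab h
    have hX := norm_nonneg (a + (h : ℂ) • b)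
    set X := ‖a + (h : ℂ) • b‖
    rw [inv_mul_le_iff₀ hh, ← mul_div_assoc, ← mul_div_assoc, le_div_iff₀ ha']
    have hle : ‖a‖ ≤ X := by
      refine (sq_le_sq₀ (norm_nonneg _) hX).1 ?_
      rw [hsq]; nlinarith [sq_nonneg (h * ‖b‖)]
    nlinarith

lemma wN_add_le {w : RVec d → ℝ≥0∞} (hw : Measurable w) {R : ℝ≥0} (hR : ∀ k, w k ≤ R)
    (f g : L1Space d n) :
    wN w (f + g : L1Space d n) ≤ wN w f + wN w g := by
  have hfin : ∀ f : L1Space d n, ∫⁻ k, w k * ‖f k‖ₑ ≠ ⊤ := fun f =>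
    ((WBd.norm_Lp f hR).2.trans_lt ENNReal.ofReal_lt_top).ne
  exact ((WBd.of_ne_top (hfin f)).add_Lp hw (WBd.of_ne_top (hfin g))).toReal_le

lemma WBd.wN_Lp {w : RVec d → ℝ≥0∞} {R : ℝ≥0} (hR : ∀ k, w k ≤ R)
    (f : L1Space d n) : WBd w f (wN w f) :=
  WBd.of_ne_top ((WBd.norm_Lp f hR).2.trans_lt ENNReal.ofReal_lt_top).ne

lemma continuous_wN {w : RVec d → ℝ≥0∞} (hw : Measurable w) {R : ℝ≥0} (hR : ∀ k, w k ≤ R) :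
    Continuous fun f : L1Space d n => wN w f := by
  refine LipschitzWith.continuous (K := R) (LipschitzWith.of_le_add_mul _ fun f g => ?_)
  have h1 := wN_add_le hw hR g (f - g)
  rw [add_sub_cancel] at h1
  have h2 : wN w (f - g : L1Space d n) ≤ _ :=
    (WBd.norm_Lp (f - g) hR).toReal_le
  rw [dist_eq_norm]
  linarith

lemma wN_eq_integral {w : RVec d → ℝ≥0∞} (hw : Measurable w) {R : ℝ≥0} (hR : ∀ k, w k ≤ R)
    (f : RVec d → CVec n) (hf : AEStronglyMeasurable f volume) :
    wN w f = ∫ k, (w k).toReal * ‖f k‖ := by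
  rw [wN, integral_eq_lintegral_of_nonneg_ae (f := fun k => (w k).toReal * ‖f k‖)
    (.of_forall fun k => by positivity) (hw.ennreal_toReal.aestronglyMeasurable.mul hf.norm)]
  congr 1
  refine lintegral_congr fun k => ?_
  rw [ENNReal.ofReal_mul ENNReal.toReal_nonneg, ofReal_norm,
    ENNReal.ofReal_toReal ((hR k).trans_lt ENNReal.coe_lt_top).ne]

/-- Dominated convergence: the quotients vanish in the limit for almost every `k`, and the reverse
triangle inequality bounds them by `R ‖S k‖`. This majorant is integrable because the weight is
truncated. -/
lemma tendsto_wN_slope {w : RVec d → ℝ≥0∞} (hw : Measurable w) {R : ℝ≥0} (hR : ∀ k, w k ≤ R)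
    (f S : L1Space d n)
    (hS : ∀ᵐ k, RCLike.re (inner ℂ (f k) (S k) : ℂ) = 0 ∧ (f k = 0 → S k = 0)) :
    Filter.Tendsto (fun h : ℝ => h⁻¹ *
      (wN w (f + (h : ℂ) • S : L1Space d n) - wN w f)) (𝓝[>] 0) (𝓝 0) := by
  have hint : ∀ f : L1Space d n,
      Integrable (fun k => (w k).toReal * ‖f k‖) := by
    intro f
    refine (Lp.integrable_one f).norm.bdd_mul (c := R) hw.ennreal_toReal.aestronglyMeasurable
      (.of_forall fun k => ?_)
    rw [Real.norm_of_nonneg ENNReal.toReal_nonneg]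
    exact ENNReal.toReal_le_coe_of_le_coe (hR k)
  have heq : ∀ h : ℝ, h⁻¹ * (wN w (f + (h : ℂ) • S : L1Space d n) - wN w f)
      = ∫ k, (w k).toReal * (h⁻¹ * (‖f k + (h : ℂ) • S k‖ - ‖f k‖)) := by
    intro h
    rw [wN_eq_integral hw hR _ (Lp.aestronglyMeasurable _),
      wN_eq_integral hw hR _ (Lp.aestronglyMeasurable _), ← integral_sub (hint _) (hint _),
      ← integral_const_mul]
    refine integral_congr_ae ?_
    filter_upwards [Lp.coeFn_add f ((h : ℂ) • S), Lp.coeFn_smul (h : ℂ) S] with k h1 h2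
    rw [h1, Pi.add_apply, h2, Pi.smul_apply]
    ring
  simp_rw [heq]
  suffices H : Filter.Tendsto (fun h : ℝ => ∫ k, (w k).toReal *
      (h⁻¹ * (‖f k + (h : ℂ) • S k‖ - ‖f k‖))) (𝓝[>] 0) (𝓝 (∫ _ : RVec d, (0 : ℝ))) by
    rwa [integral_zero] at H
  refine tendsto_integral_filter_of_dominated_convergence (fun k => R * ‖S k‖) ?_ ?_
    ((Lp.integrable_one S).norm.const_mul _) ?_
  · refine .of_forall fun h => ?_
    refine hw.ennreal_toReal.aestronglyMeasurable.mul (AEStronglyMeasurable.const_mul ?_ _)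
    have hm1 : AEStronglyMeasurable (fun k => f k) volume := Lp.aestronglyMeasurable f
    have hm2 : AEStronglyMeasurable (fun k => S k) volume := Lp.aestronglyMeasurable S
    have hm3 : AEStronglyMeasurable (fun k => f k + (h : ℂ) • S k) volume :=
      hm1.add (hm2.const_smul (h : ℂ))
    exact hm3.norm.sub hm1.norm
  · filter_upwards [self_mem_nhdsWithin] with h hh
    have hh : 0 < h := hh
    refine .of_forall fun k => ?_
    rw [norm_mul, Real.norm_of_nonneg ENNReal.toReal_nonneg]
    refine mul_le_mul (ENNReal.toReal_le_coe_of_le_coe (hR k)) ?_ (norm_nonneg _) R.2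
    rw [norm_mul, norm_inv, Real.norm_of_nonneg hh.le, inv_mul_le_iff₀ hh, Real.norm_eq_abs]
    refine (abs_norm_sub_norm_le _ _).trans (le_of_eq ?_)
    rw [add_sub_cancel_left, norm_smul]
    simp [abs_of_pos hh]
  · filter_upwards [hS] with k hk
    have := (tendsto_norm_add_smul_slope hk.1 hk.2).const_mul (w k).toReal
    rwa [mul_zero] at this

/-- The energy estimate: a skew-adjoint generator does not contribute to the growth of a weighted
`L¹` norm. -/
lemma slopeLE_wN {w : RVec d → ℝ≥0∞} (hw : Measurable w) (hw1 : ∀ k, 1 ≤ w k) {R : ℝ≥0}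
    (hR : ∀ k, w k ≤ R) {q : ℝ → L1Space d n}
    {q' : L1Space d n} {t τ c : ℝ}
    (hq : HasDerivWithinAt q q' (Set.Icc 0 τ) t) (ht : t ∈ Set.Ico 0 τ)
    {D : RVec d → CVec n → CVec n} (hD0 : ∀ k, D k 0 = 0)
    (hD : ∀ k a, RCLike.re (inner ℂ a (D k a) : ℂ) = 0) {g : RVec d → CVec n}
    (hg : AEStronglyMeasurable g volume)
    (hq' : q' =ᵐ[volume] fun k => D k (q t k) + g k) (hgc : WBd w g c) :
    SlopeLE (fun z => wN w (q z)) t c := by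
  intro r hr
  have hgi : Integrable g := by
    refine ⟨hg, ?_⟩
    rw [hasFiniteIntegral_iff_enorm]
    refine (lintegral_mono fun k => ?_).trans_lt (hgc.2.trans_lt ENNReal.ofReal_lt_top)
    exact le_mul_of_one_le_left (by simp) (hw1 k)
  set G : L1Space d n := hgi.toL1 g with hG
  have hGg : G =ᵐ[volume] g := Integrable.coeFn_toL1 hgi
  have hGc : wN w G ≤ c := (hgc.congr hGg.symm).toReal_le
  -- `S` is the skew-adjoint part `D q` as an element of `L¹`. Being the difference of the
  -- derivative and the forcing it is integrable, although `D` may be unbounded in `k`.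
  set S : L1Space d n := q' - G with hSdef
  have hS : ∀ᵐ k, RCLike.re (inner ℂ (q t k) (S k) : ℂ) = 0 ∧ (q t k = 0 → S k = 0) := by
    filter_upwards [hq', hGg, Lp.coeFn_sub q' G] with k h1 h2 h3
    have : S k = D k (q t k) := by rw [h3, Pi.sub_apply, h1, h2, add_sub_cancel_right]
    rw [this]
    exact ⟨hD k _, fun h => by rw [h, hD0]⟩
  have hshift : Filter.Tendsto (fun z : ℝ => z - t) (𝓝[>] t) (𝓝[>] 0) := by
    refine tendsto_nhdsWithin_iff.2 ⟨?_, ?_⟩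
    · have : Filter.Tendsto (fun z : ℝ => z - t) (𝓝 t) (𝓝 (t - t)) :=
        (continuous_id.sub continuous_const).tendsto t
      rw [sub_self] at this
      exact this.mono_left nhdsWithin_le_nhds
    · filter_upwards [self_mem_nhdsWithin] with z hz
      simpa using hz
  have h1 := (tendsto_wN_slope hw hR (q t) S hS).comp hshift
  have h2 : Filter.Tendsto (fun z => ‖(z - t)⁻¹ • (q z - q t) - q'‖) (𝓝[>] t) (𝓝 0) := by
    have h3 : HasDerivWithinAt q q' (Set.Ioi t) t := by
      refine (hq.mono_of_mem_nhdsWithin ?_)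
      exact Filter.mem_of_superset (Ioc_mem_nhdsGT ht.2)
        fun z hz => ⟨ht.1.trans hz.1.le, hz.2⟩
    rw [hasDerivWithinAt_iff_tendsto_slope' (by simp)] at h3
    simpa [slope_def_module] using (h3.sub_const q').norm
  have h3 : Filter.Tendsto (fun z => (z - t)⁻¹ *
      (wN w (q t + ((z - t : ℝ) : ℂ) • S : L1Space d n) - wN w (q t))
      + (c + R * ‖(z - t)⁻¹ • (q z - q t) - q'‖)) (𝓝[>] t) (𝓝 (0 + (c + R * 0))) :=
    h1.add ((h2.const_mul _).const_add _)
  simp only [zero_add, mul_zero, add_zero] at h3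
  filter_upwards [h3.eventually_lt_const hr, self_mem_nhdsWithin] with z hz hzt
  refine lt_of_le_of_lt ?_ hz
  have hzt : 0 < z - t := sub_pos.2 hzt
  -- With `h = z - t`, the direction `h S` changes the norm only by `o(h)`, the forcing `h G` by at
  -- most `h c`, and the last term is the error in the differentiability of `q`.
  have hdec : q z = (q t + ((z - t : ℝ) : ℂ) • S) + (((z - t : ℝ) : ℂ) • G +
      ((z - t : ℝ) : ℂ) • ((z - t)⁻¹ • (q z - q t) - q')) := by
    have e : ((z - t : ℝ) : ℂ) • ((z - t)⁻¹ • (q z - q t)) = q z - q t := by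
      rw [← L1Space.real_smul_eq, smul_smul, mul_inv_cancel₀ hzt.ne', one_smul]
    rw [hSdef, smul_sub, smul_sub, e]
    abel
  have hfin : ∀ f : L1Space d n, WBd w f (wN w f) := WBd.wN_Lp hR
  have t1 := wN_add_le hw hR (q t + ((z - t : ℝ) : ℂ) • S) (((z - t : ℝ) : ℂ) • G +
      ((z - t : ℝ) : ℂ) • ((z - t)⁻¹ • (q z - q t) - q'))
  rw [← hdec] at t1
  have t2 := wN_add_le hw hR (((z - t : ℝ) : ℂ) • G)
    (((z - t : ℝ) : ℂ) • ((z - t)⁻¹ • (q z - q t) - q'))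
  have t3 : wN w (((z - t : ℝ) : ℂ) • G : L1Space d n)
      ≤ (z - t) * wN w G := by
    have := ((hfin G).smul_Lp ((z - t : ℝ) : ℂ)).toReal_le
    rwa [Complex.norm_of_nonneg hzt.le] at this
  have t4 : wN w (((z - t : ℝ) : ℂ) • ((z - t)⁻¹ • (q z - q t) - q') :
      L1Space d n) ≤ (z - t) * (R * ‖(z - t)⁻¹ • (q z - q t) - q'‖) := by
    have := ((WBd.norm_Lp ((z - t)⁻¹ • (q z - q t) - q') hR).smul_Lp ((z - t : ℝ) : ℂ)).toReal_le
    rwa [Complex.norm_of_nonneg hzt.le] at this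
  have t5 : (z - t) * wN w G ≤ (z - t) * c := by gcongr
  rw [inv_mul_le_iff₀ hzt, mul_add, mul_inv_cancel_left₀ hzt.ne']
  linarith

end Energy

/-! ### Matrix-valued Fourier multipliers. -/

section Multiplier
variable {d n : ℕ}

/-- A bounded measurable Fourier multiplier with matrix values. -/
structure Mult (d n : ℕ) where
  toFun : RVec d → CVec n →L[ℂ] CVec n
  meas : StronglyMeasurable toFun
  bound : ∃ C, ∀ k, ‖toFun k‖ ≤ C

namespace Mult

lemma integrable_apply (m : Mult d n) (f : L1Space d n) : Integrable fun k => m.toFun k (f k) := by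
  obtain ⟨C, hC⟩ := m.bound
  refine ((Lp.integrable_one f).norm.const_mul C).mono' ?_ (.of_forall fun k => ?_)
  · exact (isBoundedBilinearMap_apply (𝕜 := ℂ)).continuous.comp_aestronglyMeasurable
      (m.meas.aestronglyMeasurable.prodMk (Lp.aestronglyMeasurable f))
  · exact (ContinuousLinearMap.le_opNorm _ _).trans (by gcongr; exact hC k)

/-- The operator on `L¹` defined by a bounded multiplier. -/
def op (m : Mult d n) : L1Space d n →L[ℂ] L1Space d n :=
  LinearMap.mkContinuousOfExistsBound
    { toFun := fun f => (m.integrable_apply f).toL1 _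
      map_add' := by
        intro f g
        refine Lp.ext ?_
        filter_upwards [Integrable.coeFn_toL1 (m.integrable_apply (f + g)),
          Integrable.coeFn_toL1 (m.integrable_apply f), Integrable.coeFn_toL1 (m.integrable_apply g),
          Lp.coeFn_add f g, Lp.coeFn_add ((m.integrable_apply f).toL1 _)
            ((m.integrable_apply g).toL1 _)] with k h1 h2 h3 h4 h5
        rw [h1, h5, Pi.add_apply, h2, h3, h4, Pi.add_apply, map_add]
      map_smul' := by
        intro z f
        refine Lp.ext ?_
        filter_upwards [Integrable.coeFn_toL1 (m.integrable_apply (z • f)),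
          Integrable.coeFn_toL1 (m.integrable_apply f),
          Lp.coeFn_smul z f, Lp.coeFn_smul z ((m.integrable_apply f).toL1 _)] with k h1 h2 h4 h5
        rw [h1, RingHom.id_apply, h5, Pi.smul_apply, h2, h4, Pi.smul_apply, map_smul] }
    (by
      obtain ⟨C, hC⟩ := m.bound
      refine ⟨C, fun f => ?_⟩
      have hC0 : 0 ≤ C := (norm_nonneg _).trans (hC 0)
      have h1 : WBd 1 f ‖f‖ := by simpa using WBd.norm_Lp f (w := 1) (R := 1) (by simp)
      have h2 : WBd 1 ((m.integrable_apply f).toL1 _) (C * ‖f‖) := by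
        refine h1.of_norm_le hC0 ?_
        filter_upwards [Integrable.coeFn_toL1 (m.integrable_apply f)] with k hk
        rw [hk]
        exact (ContinuousLinearMap.le_opNorm _ _).trans (by gcongr; exact hC k)
      exact h2.norm_le (by simp))

lemma coeFn_op (m : Mult d n) (f : L1Space d n) :
    m.op f =ᵐ[volume] fun k => m.toFun k (f k) :=
  Integrable.coeFn_toL1 (m.integrable_apply f)

end Mult

end Multiplier

end

noncomputable section

set_option linter.unusedSectionVars false

open scoped ENNReal NNReal Topology Convolution FourierTransform

/-! ### The inverse Fourier transform on `L¹` -/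

section InvFourier
variable {d n : ℕ}

/-- The normalization constant `(2π)^(-d/2)`. -/
def fourierConst (d : ℕ) : ℂ := (((2 * Real.pi) ^ (-(d : ℝ) / 2) : ℝ) : ℂ)

lemma fourierConst_ne_zero (d : ℕ) : fourierConst d ≠ 0 := by
  unfold fourierConst
  exact_mod_cast (Real.rpow_pos_of_pos (by positivity) _).ne'

/-- The kernel `e^{i k·x}` equals `e^{-2πi k·y}` for `y = -x/(2π)`; only the normalization constant
remains. -/
lemma invFourier_eq (g : RVec d → CVec n) (x : RVec d) :
    invFourier g x = fourierConst d • 𝓕 g (-((2 * Real.pi)⁻¹ • x)) := by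
  rw [invFourier, fourierConst, Real.fourier_eq']
  congr 1
  refine integral_congr_ae (.of_forall fun k => ?_)
  dsimp only
  congr 2
  rw [inner_neg_right, inner_smul_right, mul_comm Complex.I]
  have : inner ℝ k x = ∑ l, k l * x l := by
    rw [PiLp.inner_apply]; simp [mul_comm]
  rw [this]
  have hpi : (Real.pi : ℂ) ≠ 0 := by exact_mod_cast Real.pi_ne_zero
  push_cast
  field_simp

lemma norm_cexp_I_mul (r : ℝ) : ‖Complex.exp (Complex.I * (r : ℂ))‖ = 1 := by
  rw [mul_comm]; exact Complex.norm_exp_ofReal_mul_I r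

lemma continuous_phase (x : RVec d) :
    Continuous fun k : RVec d => Complex.exp (Complex.I * ((∑ l, k l * x l : ℝ) : ℂ)) := by
  fun_prop

lemma integrable_phase_smul {g : RVec d → CVec n} (hg : Integrable g) (x : RVec d) :
    Integrable fun k : RVec d => Complex.exp (Complex.I * ((∑ l, k l * x l : ℝ) : ℂ)) • g k := by
  refine hg.norm.mono' ((continuous_phase x).aestronglyMeasurable.smul hg.1)
    (.of_forall fun k => ?_)
  rw [norm_smul, norm_cexp_I_mul, one_mul]

/-- The value at `x` of the inverse Fourier transform as a bounded linear map on `L¹`. -/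
def invFourierL (x : RVec d) : L1Space d n →L[ℂ] CVec n :=
  LinearMap.mkContinuousOfExistsBound
    { toFun := fun f => invFourier f x
      map_add' := by
        intro f g
        simp only [invFourier]
        rw [← smul_add, ← integral_add (integrable_phase_smul (Lp.integrable_one f) x)
          (integrable_phase_smul (Lp.integrable_one g) x)]
        congr 1
        refine integral_congr_ae ?_
        filter_upwards [Lp.coeFn_add f g] with k hk
        rw [hk, Pi.add_apply, smul_add]
      map_smul' := by
        intro z f
        simp only [invFourier, RingHom.id_apply]
        rw [smul_comm z]
        congr 1
        rw [← integral_smul]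
        refine integral_congr_ae ?_
        filter_upwards [Lp.coeFn_smul z f] with k hk
        rw [hk, Pi.smul_apply, smul_comm] }
    (by
      refine ⟨‖fourierConst d‖, fun f => ?_⟩
      have e : invFourier f x = fourierConst d • ∫ k : RVec d,
          Complex.exp (Complex.I * ((∑ l, k l * x l : ℝ) : ℂ)) • f k := rfl
      change ‖invFourier f x‖ ≤ _
      rw [e, norm_smul]
      gcongr
      refine (norm_integral_le_integral_norm _).trans (le_of_eq ?_)
      rw [L1.norm_eq_integral_norm]
      refine integral_congr_ae (.of_forall fun k => ?_)
      simp only [norm_smul, norm_cexp_I_mul, one_mul])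

lemma invFourierL_apply (x : RVec d) (f : L1Space d n) : invFourierL x f = invFourier f x := rfl

/-- The dilation by `-2π` pulls null sets back to null sets, so the change of normalization respects
statements that hold almost everywhere. -/
lemma fourier_eq_zero_of_invFourier {f : L1Space d n} (h : ∀ᵐ x, invFourier f x = 0) :
    ∀ᵐ y : RVec d, 𝓕 (f : RVec d → CVec n) y = 0 := by
  have hpi : (-(2 * Real.pi)) ≠ 0 := by have := Real.pi_pos; linarith
  have h1 : Measure.QuasiMeasurePreserving (fun y : RVec d => (-(2 * Real.pi)) • y)
      volume volume :=
    ⟨measurable_const_smul _, by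
      rw [Measure.map_addHaar_smul _ hpi]
      exact Measure.smul_absolutelyContinuous⟩
  filter_upwards [h1.ae h] with y hy
  rw [invFourier_eq] at hy
  have := (smul_eq_zero.1 hy).resolve_left (fourierConst_ne_zero d)
  rw [smul_smul] at this
  convert this using 2
  rw [← neg_smul]
  field_simp
  simp

/-- Duality: a test function is the Fourier transform of a Schwartz function `ψ`, and shifting the
transform from `ψ` to `f` gives the integral of `ψ 𝓕f`, which vanishes. This injectivity converts
identities in `x` into identities in `L¹`. -/
lemma eq_zero_of_invFourier {f : L1Space d n} (h : ∀ᵐ x, invFourier f x = 0) : f = 0 := by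
  rw [Lp.eq_zero_iff_ae_eq_zero]
  have hfi := Lp.integrable_one f
  refine ae_eq_zero_of_integral_contDiff_smul_eq_zero hfi.locallyIntegrable ?_
  intro g hg1 hg2
  have hg₁ : HasCompactSupport (Complex.ofRealCLM ∘ g) := hg2.comp_left rfl
  have hg₂ : ContDiff ℝ ((⊤ : ℕ∞) : WithTop ℕ∞) (Complex.ofRealCLM ∘ g) := by fun_prop
  set φ : SchwartzMap (RVec d) ℂ := hg₁.toSchwartzMap hg₂ with hφ
  set ψ : SchwartzMap (RVec d) ℂ := 𝓕⁻ φ with hψ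
  have hφψ : φ = 𝓕 ψ := by rw [hψ, FourierTransform.fourier_fourierInv_eq]
  calc ∫ x, g x • f x = ∫ x, (φ x) • f x := by
        refine integral_congr_ae (.of_forall fun x => ?_)
        simp [hφ]
    _ = ∫ x, (𝓕 (ψ : RVec d → ℂ) x) • f x := by
        rw [hφψ, SchwartzMap.fourier_coe]
    _ = ∫ x, ψ x • 𝓕 (f : RVec d → CVec n) x := by
        have := VectorFourier.integral_fourierIntegral_smul_eq_flip (L := innerₗ (RVec d))
          Real.continuous_fourierChar continuous_inner (ψ.integrable (μ := volume)) hfi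
        rw [flip_innerₗ] at this
        exact this
    _ = 0 := by
        rw [integral_eq_zero_of_ae]
        filter_upwards [fourier_eq_zero_of_invFourier h] with x hx
        simp [hx]

lemma eq_of_invFourier {f g : L1Space d n} (h : ∀ᵐ x, invFourier f x = invFourier g x) :
    f = g := by
  rw [← sub_eq_zero]
  refine eq_zero_of_invFourier ?_
  filter_upwards [h] with x hx
  rw [← invFourierL_apply, map_sub, invFourierL_apply, invFourierL_apply, hx, sub_self]

lemma invFourier_apply (f : L1Space d n) (x : RVec d) (i : Fin n) :
    invFourier f x i
      = fourierConst d * 𝓕 (fun k => f k i) (-((2 * Real.pi)⁻¹ • x)) := by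
  rw [invFourier_eq, PiLp.smul_apply, smul_eq_mul]
  congr 1
  rw [Real.fourier_eq', Real.fourier_eq']
  have h1 : Integrable fun k : RVec d =>
      Complex.exp (((-2 * Real.pi * inner ℝ k (-((2 * Real.pi)⁻¹ • x)) : ℝ) : ℂ) * Complex.I)
        • f k := by
    refine (Lp.integrable_one f).norm.mono' ?_ (.of_forall fun k => ?_)
    · have hc : Continuous fun k : RVec d => Complex.exp
          (((-2 * Real.pi * inner ℝ k (-((2 * Real.pi)⁻¹ • x)) : ℝ) : ℂ) * Complex.I) := by
        fun_prop
      exact hc.aestronglyMeasurable.smul (Lp.aestronglyMeasurable f)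
    · rw [norm_smul, Complex.norm_exp_ofReal_mul_I, one_mul]
  have h2 := (EuclideanSpace.proj (𝕜 := ℂ) i : CVec n →L[ℂ] ℂ).integral_comp_comm h1
  simpa using h2.symm

lemma hasFDerivAt_fourier_comp {h : RVec d → ℂ} (hi : Integrable h)
    (hi' : Integrable fun k => ‖k‖ * ‖h k‖) (x : RVec d) :
    ∃ D : RVec d →L[ℝ] ℂ, HasFDerivAt (fun x => 𝓕 h (-((2 * Real.pi)⁻¹ • x))) D x ∧
      ∀ μ, D (EuclideanSpace.single μ 1)
        = 𝓕 (fun k => Complex.I * ((k μ : ℝ) : ℂ) * h k) (-((2 * Real.pi)⁻¹ • x)) := by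
  set A : RVec d →L[ℝ] RVec d := -((2 * Real.pi)⁻¹ • ContinuousLinearMap.id ℝ (RVec d)) with hA
  have h1 := Real.hasFDerivAt_fourier hi hi' (A x)
  refine ⟨_, h1.comp x A.hasFDerivAt, fun μ => ?_⟩
  have h2 : Integrable (VectorFourier.fourierSMulRight (innerSL ℝ) h) := by
    refine (hi'.const_mul (2 * Real.pi * ‖innerSL (E := RVec d) ℝ‖)).mono'
      hi.1.fourierSMulRight (.of_forall fun k => ?_)
    refine (VectorFourier.norm_fourierSMulRight_le _ _ _).trans (le_of_eq ?_)
    ring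
  rw [ContinuousLinearMap.comp_apply, Real.fourier_continuousLinearMap_apply h2]
  have hAx : A x = -((2 * Real.pi)⁻¹ • x) := rfl
  rw [hAx]
  refine Real.fourier_congr_ae (.of_forall fun k => ?_) _
  dsimp only
  rw [VectorFourier.fourierSMulRight_apply]
  have hpi : (Real.pi : ℂ) ≠ 0 := by exact_mod_cast Real.pi_ne_zero
  have h3 : inner ℝ k (EuclideanSpace.single μ (1 : ℝ)) = k μ := by
    rw [PiLp.inner_apply]; simp [PiLp.single_apply]
  -- The factor `-(2π)⁻¹` of the dilation cancels the `-2π` in the derivative of the Fourier kernel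
  -- and leaves `i k_μ`.
  have h4 : innerSL ℝ k (A (EuclideanSpace.single μ 1)) = -((2 * Real.pi)⁻¹ * k μ) := by
    change inner ℝ k (-((2 * Real.pi)⁻¹ • EuclideanSpace.single μ (1 : ℝ))) = _
    rw [inner_neg_right, inner_smul_right, h3]
  rw [h4, smul_eq_mul, Complex.real_smul]
  push_cast
  field_simp

lemma norm_le_sum_abs (k : RVec d) : ‖k‖ ≤ ∑ l, |k l| := by
  have h : k = ∑ l, (k l) • EuclideanSpace.single l (1 : ℝ) := by
    ext i
    simp [Finset.sum_apply, Pi.single_apply]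
  conv_lhs => rw [h]
  refine (norm_sum_le _ _).trans (Finset.sum_le_sum fun l _ => ?_)
  simp [norm_smul]

/-- Even for a single partial derivative, differentiability at `x` rests on the full first moment
`‖k‖ ‖f k‖`, so all products `k_l f` have to be integrable. -/
lemma fderiv_invFourier (f : L1Space d n) (μ : Fin d) (v : L1Space d n)
    (hv : ∀ l : Fin d, ∃ v : L1Space d n, v =ᵐ[volume] fourierD l f)
    (hvμ : v =ᵐ[volume] fourierD μ f) (x : RVec d) :
    fderiv ℝ (fun x => invFourier f x) x (EuclideanSpace.single μ 1) = invFourier v x := by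
  have hfi := Lp.integrable_one f
  have hcoord : ∀ (f : L1Space d n) (i : Fin n), Integrable fun k => f k i := fun f i =>
    (EuclideanSpace.proj (𝕜 := ℂ) i : CVec n →L[ℂ] ℂ).integrable_comp (Lp.integrable_one f)
  have hmom : ∀ i, Integrable fun k : RVec d => ‖k‖ * ‖f k i‖ := by
    intro i
    have hb : Integrable fun k => ∑ l, ‖fourierD l (fun k => f k) k‖ := by
      refine integrable_finsetSum _ fun l _ => ?_
      obtain ⟨v, hv⟩ := hv l
      exact ((Lp.integrable_one v).congr hv).norm
    refine hb.mono' (continuous_norm.aestronglyMeasurable.mul (hcoord f i).1.norm)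
      (.of_forall fun k => ?_)
    rw [Real.norm_of_nonneg (by positivity)]
    calc ‖k‖ * ‖f k i‖ ≤ (∑ l, |k l|) * ‖f k‖ := by
          gcongr
          · exact norm_le_sum_abs k
          · exact PiLp.norm_apply_le _ _
      _ = _ := by
          rw [Finset.sum_mul]
          refine Finset.sum_congr rfl fun l _ => ?_
          simp [fourierD, norm_smul]
  choose D hD hDμ using fun i => hasFDerivAt_fourier_comp (hcoord f i) (hmom i) x
  have hcd : ∀ i, HasFDerivAt (fun x => invFourier f x i) (fourierConst d • D i) x := by
    intro i
    have := (hD i).const_mul (fourierConst d)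
    refine this.congr_of_eventuallyEq (.of_forall fun y => ?_)
    exact invFourier_apply f y i
  have hdiff : DifferentiableAt ℝ (fun x => invFourier f x) x :=
    (differentiableAt_piLp 2).2 fun i => (hcd i).differentiableAt
  ext i
  have h1 := ((PiLp.proj 2 (𝕜 := ℝ) (fun _ : Fin n => ℂ) i).hasFDerivAt.comp x
    hdiff.hasFDerivAt).unique (hcd i)
  have h2 := congrArg (fun L => L (EuclideanSpace.single μ 1)) h1
  have h3 : (fderiv ℝ (fun x => invFourier f x) x (EuclideanSpace.single μ 1)) i
      = fourierConst d * D i (EuclideanSpace.single μ 1) := by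
    simpa using h2
  rw [h3, hDμ, invFourier_apply]
  congr 1
  refine Real.fourier_congr_ae ?_ _
  filter_upwards [hvμ] with k hk
  rw [hk]
  simp [fourierD]

end InvFourier

end

noncomputable section

set_option linter.unusedSectionVars false

open scoped ENNReal NNReal Topology Convolution FourierTransform

/-! ### Trilinear convolutions -/

section Trilinear
variable {d n : ℕ}

instance : CompleteSpace (CVec n →L[ℂ] CVec n) := inferInstance

instance : NormedAddCommGroup (CVec n →L[ℂ] CVec n) := inferInstance

instance : NormedSpace ℂ (CVec n →L[ℂ] CVec n) := inferInstance

/-- Bounded trilinear maps on `ℂ^n`. -/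
abbrev Tri (n : ℕ) := CVec n →L[ℂ] CVec n →L[ℂ] CVec n →L[ℂ] CVec n

/-- The trilinear convolution of integrable functions. -/
def triL1 (T : Tri n) (f g h : L1Space d n) : L1Space d n :=
  convL1 (ContinuousLinearMap.id ℂ (CVec n →L[ℂ] CVec n)) (convL1 T f g) h

/-- The operator norm of a bounded bilinear map. -/
def bilNorm {E F G : Type*} [NormedAddCommGroup E] [NormedAddCommGroup F]
    [NormedAddCommGroup G] [NormedSpace ℂ E] [NormedSpace ℂ F] [NormedSpace ℂ G]
    (L : E →L[ℂ] F →L[ℂ] G) : ℝ := ‖L‖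

lemma bilNorm_nonneg {E F G : Type*} [NormedAddCommGroup E] [NormedAddCommGroup F]
    [NormedAddCommGroup G] [NormedSpace ℂ E] [NormedSpace ℂ F] [NormedSpace ℂ G]
    (L : E →L[ℂ] F →L[ℂ] G) : 0 ≤ bilNorm L := norm_nonneg L

/-- The bound of the trilinear convolution. -/
def triC (T : Tri n) : ℝ :=
  bilNorm (ContinuousLinearMap.id ℂ (CVec n →L[ℂ] CVec n)) * bilNorm T

lemma triC_nonneg (T : Tri n) : 0 ≤ triC T := mul_nonneg (bilNorm_nonneg _) (bilNorm_nonneg _)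

variable (T : Tri n) (f f' g g' h h' : L1Space d n)

lemma triL1_add₁ : triL1 T (f + f') g h = triL1 T f g h + triL1 T f' g h := by simp [triL1]
lemma triL1_add₂ : triL1 T f (g + g') h = triL1 T f g h + triL1 T f g' h := by simp [triL1]
lemma triL1_add₃ : triL1 T f g (h + h') = triL1 T f g h + triL1 T f g h' := by simp [triL1]
lemma triL1_sub₁ : triL1 T (f - f') g h = triL1 T f g h - triL1 T f' g h := by simp [triL1]
lemma triL1_sub₂ : triL1 T f (g - g') h = triL1 T f g h - triL1 T f g' h := by simp [triL1]
lemma triL1_sub₃ : triL1 T f g (h - h') = triL1 T f g h - triL1 T f g h' := by simp [triL1]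
lemma triL1_smul₁ (z : ℂ) : triL1 T (z • f) g h = z • triL1 T f g h := by simp [triL1]
lemma triL1_smul₂ (z : ℂ) : triL1 T f (z • g) h = z • triL1 T f g h := by simp [triL1]
lemma triL1_smul₃ (z : ℂ) : triL1 T f g (z • h) = z • triL1 T f g h := by simp [triL1]
lemma triL1_sum₁ {ι : Type*} (s : Finset ι) (f : ι → L1Space d n) :
    triL1 T (∑ i ∈ s, f i) g h = ∑ i ∈ s, triL1 T (f i) g h := by simp [triL1]
lemma triL1_sum₂ {ι : Type*} (s : Finset ι) (g : ι → L1Space d n) :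
    triL1 T f (∑ i ∈ s, g i) h = ∑ i ∈ s, triL1 T f (g i) h := by simp [triL1]
lemma triL1_sum₃ {ι : Type*} (s : Finset ι) (h : ι → L1Space d n) :
    triL1 T f g (∑ i ∈ s, h i) = ∑ i ∈ s, triL1 T f g (h i) := by simp [triL1]

lemma HasDerivWithinAt.triL1 {f g h : ℝ → L1Space d n} {f' g' h' : L1Space d n} {s : Set ℝ}
    {t : ℝ} (hf : HasDerivWithinAt f f' s t) (hg : HasDerivWithinAt g g' s t)
    (hh : HasDerivWithinAt h h' s t) :
    HasDerivWithinAt (fun t => triL1 T (f t) (g t) (h t))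
      (triL1 T f' (g t) (h t) + triL1 T (f t) g' (h t) + triL1 T (f t) (g t) h') s t := by
  have h1 := (((convL1 (d := d) T).bilinearRestrictScalars ℝ).hasFDerivWithinAt_of_bilinear
    hf.hasFDerivWithinAt hg.hasFDerivWithinAt)
  have h2 := ((convL1 (d := d) (ContinuousLinearMap.id ℂ
    (CVec n →L[ℂ] CVec n))).bilinearRestrictScalars ℝ).hasFDerivWithinAt_of_bilinear
    h1 hh.hasFDerivWithinAt
  have h3 := h2.hasDerivWithinAt
  refine (h3.congr_deriv ?_)
  simp [_root_.triL1]
  abel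

variable {f g h}
variable {a b c : ℝ}

/-- Exactly one slot carries the truncated weight. It is the slot of the quantity still to be
estimated by Gronwall's inequality; the other two are already controlled with the full weight. -/
lemma WBd.triL1_left (s : ℕ) (R : ℝ≥0∞) (hf : WBd (wt s R) f a) (hg : WBd (wt s ⊤) g b)
    (hh : WBd (wt s ⊤) h c) : WBd (wt s R) (triL1 T f g h) (triC T * a * b * c) := by
  have h1 := WBd.convL1_mul T (measurable_wt s R) (measurable_wt s R) (measurable_wt s ⊤)
    (wt_add_le_mul s R) hf hg
  have h2 := WBd.convL1_mul (ContinuousLinearMap.id ℂ (CVec n →L[ℂ] CVec n)) (measurable_wt s R)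
    (measurable_wt s R) (measurable_wt s ⊤) (wt_add_le_mul s R) h1 hh
  change WBd _ _ (bilNorm (ContinuousLinearMap.id ℂ (CVec n →L[ℂ] CVec n)) *
    (bilNorm T * a * b) * c) at h2
  exact h2.mono (le_of_eq (by rw [triC]; ring))

lemma WBd.triL1_mid (s : ℕ) (R : ℝ≥0∞) (hf : WBd (wt s ⊤) f a) (hg : WBd (wt s R) g b)
    (hh : WBd (wt s ⊤) h c) : WBd (wt s R) (triL1 T f g h) (triC T * a * b * c) := by
  have h1 := WBd.convL1_mul T (measurable_wt s R) (measurable_wt s ⊤) (measurable_wt s R)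
    (wt_add_le_mul' s R) hf hg
  have h2 := WBd.convL1_mul (ContinuousLinearMap.id ℂ (CVec n →L[ℂ] CVec n)) (measurable_wt s R)
    (measurable_wt s R) (measurable_wt s ⊤) (wt_add_le_mul s R) h1 hh
  change WBd _ _ (bilNorm (ContinuousLinearMap.id ℂ (CVec n →L[ℂ] CVec n)) *
    (bilNorm T * a * b) * c) at h2
  exact h2.mono (le_of_eq (by rw [triC]; ring))

lemma WBd.triL1_right (s : ℕ) (R : ℝ≥0∞) (hf : WBd (wt s ⊤) f a) (hg : WBd (wt s ⊤) g b)
    (hh : WBd (wt s R) h c) : WBd (wt s R) (triL1 T f g h) (triC T * a * b * c) := by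
  have h1 := WBd.convL1_mul T (measurable_wt s ⊤) (measurable_wt s ⊤) (measurable_wt s ⊤)
    (wt_add_le_mul s ⊤) hf hg
  have h2 := WBd.convL1_mul (ContinuousLinearMap.id ℂ (CVec n →L[ℂ] CVec n)) (measurable_wt s R)
    (measurable_wt s ⊤) (measurable_wt s R) (wt_add_le_mul' s R) h1 hh
  change WBd _ _ (bilNorm (ContinuousLinearMap.id ℂ (CVec n →L[ℂ] CVec n)) *
    (bilNorm T * a * b) * c) at h2
  exact h2.mono (le_of_eq (by rw [triC]; ring))

lemma norm_triL1_le {K : ℝ} (hf : ‖f‖ ≤ K) (hg : ‖g‖ ≤ K) (hh : ‖h‖ ≤ K) :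
    ‖triL1 T f g h‖ ≤ triC T * K ^ 3 := by
  have hK := (norm_nonneg _).trans hf
  have e : ∀ f : L1Space d n, ‖f‖ ≤ K → WBd (wt 0 ⊤) f K := by
    intro f hf
    have := WBd.norm_Lp f (w := wt 0 ⊤) (R := 1) (fun k => (wt_zero (by simp) k).le)
    exact this.mono (by simpa using hf)
  have := (WBd.triL1_left T 0 ⊤ (e f hf) (e g hg) (e h hh)).norm_le (one_le_wt 0 (by simp))
  linarith

/-- The weight falls on one factor at a time and the other factors enter through their plain `L¹`
norms. The bound is linear in the weighted norms, so that Gronwall's inequality applies without any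
smallness condition. -/
lemma WBd.triL1_add {s : ℕ} {R : ℝ≥0∞} {K : ℝ} (hf : WBd (wt s R) f a) (hg : WBd (wt s R) g b)
    (hh : WBd (wt s R) h c) (hf' : ‖f‖ ≤ K) (hg' : ‖g‖ ≤ K) (hh' : ‖h‖ ≤ K) :
    WBd (wt s R) (triL1 T f g h) (4 ^ s * triC T * K ^ 2 * (a + b + c)) := by
  have hK := (norm_nonneg _).trans hf'
  have ha := hf.nonneg
  have hb := hg.nonneg
  have hc := hh.nonneg
  have hadd : ∀ x y : RVec d, wt s R (x + y) ≤ ENNReal.ofReal (2 ^ s) * (wt s R x + wt s R y) := by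
    intro x y
    rw [ENNReal.ofReal_pow (by norm_num)]
    simpa using wt_add_le_add s R x y
  have h1 := WBd.convL1_add T (measurable_wt s R) (by positivity) hadd hf hg hf' hg'
  change WBd _ _ (2 ^ s * bilNorm T * (a * K + K * b)) at h1
  have hT : 0 ≤ bilNorm T := bilNorm_nonneg T
  have hn : ‖convL1 T f g‖ ≤ bilNorm T * K * K := by
    have h0 : ‖convL1 T f g‖ ≤ bilNorm T * ‖f‖ * ‖g‖ := norm_convL1Aux_le T f g
    exact h0.trans (by gcongr)
  have h2 := WBd.convL1_add (ContinuousLinearMap.id ℂ (CVec n →L[ℂ] CVec n)) (measurable_wt s R)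
    (by positivity) hadd h1 hh hn hh'
  set I := bilNorm (ContinuousLinearMap.id ℂ (CVec n →L[ℂ] CVec n)) with hIdef
  have hI : 0 ≤ I := bilNorm_nonneg _
  change WBd _ _ (2 ^ s * I * _) at h2
  refine h2.mono ?_
  have h4 : (4 : ℝ) ^ s = 2 ^ s * 2 ^ s := by rw [← mul_pow]; norm_num
  have h2s : (1 : ℝ) ≤ 2 ^ s := one_le_pow₀ (by norm_num)
  rw [h4, triC, ← hIdef]
  -- If the weight falls on `h`, it is split only once, in the outer convolution; the missing factor
  -- `2 ^ s` is added generously.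
  have h5 : I * bilNorm T * K * K * c * 2 ^ s ≤ I * bilNorm T * K * K * c * 2 ^ s * 2 ^ s :=
    le_mul_of_one_le_right (by positivity) h2s
  nlinarith [h5]

/-- Under `𝓕` both convolutions become products. The right-hand side contains three normalization
constants and the transform on the left one, hence the square. -/
lemma invFourier_triL1 (f g h : L1Space d n) (x : RVec d) :
    (fourierConst d * fourierConst d) • invFourier (triL1 T f g h) x
      = T (invFourier f x) (invFourier g x) (invFourier h x) := by
  have h1 : ∀ y : RVec d, 𝓕 (triL1 T f g h : RVec d → CVec n) y
      = T (𝓕 (f : RVec d → CVec n) y) (𝓕 (g : RVec d → CVec n) y)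
        (𝓕 (h : RVec d → CVec n) y) := by
    intro y
    rw [triL1, Real.fourier_congr_ae (coeFn_convL1 _ _ _),
      Real.fourier_bilin_convolution_eq _ (Lp.integrable_one _) (Lp.integrable_one _),
      Real.fourier_congr_ae (coeFn_convL1 T f g),
      Real.fourier_bilin_convolution_eq _ (Lp.integrable_one _) (Lp.integrable_one _)]
    rfl
  simp only [invFourier_eq, h1, map_smul, _root_.smul_apply, smul_smul]
  congr 1
  ring

end Trilinear

/-! ### Conjugation and reflection -/

section Refl
variable {d n : ℕ}

lemma norm_conjVec (v : CVec n) : ‖conjVec v‖ = ‖v‖ := by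
  simp [conjVec, EuclideanSpace.norm_eq]

lemma conjVec_add (v w : CVec n) : conjVec (v + w) = conjVec v + conjVec w := by
  ext i; simp [conjVec]

lemma conjVec_smul (z : ℂ) (v : CVec n) : conjVec (z • v) = (starRingEnd ℂ z) • conjVec v := by
  ext i; simp [conjVec]

lemma conjVec_real_smul (r : ℝ) (v : CVec n) : conjVec (r • v) = r • conjVec v := by
  ext i; simp [conjVec]

/-- Entrywise complex conjugation as a real-linear map. -/
def conjVecL : CVec n →L[ℝ] CVec n :=
  LinearMap.mkContinuous
    { toFun := conjVec, map_add' := conjVec_add, map_smul' := conjVec_real_smul } 1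
    (fun v => by simpa using (norm_conjVec v).le)

lemma conjVecL_apply (v : CVec n) : conjVecL v = conjVec v := rfl

lemma integrable_reflConj {f : RVec d → CVec n} (hf : Integrable f) :
    Integrable fun k => conjVec (f (-k)) :=
  (conjVecL (n := n)).integrable_comp hf.comp_neg

/-- The integrable function `k ↦ conj (f (-k))`. -/
def reflConjAux (f : L1Space d n) : L1Space d n :=
  (integrable_reflConj (Lp.integrable_one f)).toL1 _

lemma coeFn_reflConjAux (f : L1Space d n) :
    reflConjAux f =ᵐ[volume] fun k => conjVec (f (-k)) :=
  Integrable.coeFn_toL1 (integrable_reflConj (Lp.integrable_one f))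

lemma ae_neg {p : RVec d → Prop} (h : ∀ᵐ k, p k) : ∀ᵐ k, p (-k) :=
  (Measure.measurePreserving_neg (volume : Measure (RVec d))).quasiMeasurePreserving.ae h

lemma reflConjAux_add (f g : L1Space d n) :
    reflConjAux (f + g) = reflConjAux f + reflConjAux g := by
  refine Lp.ext ?_
  filter_upwards [coeFn_reflConjAux (f + g), coeFn_reflConjAux f, coeFn_reflConjAux g,
    ae_neg (Lp.coeFn_add f g), Lp.coeFn_add (reflConjAux f) (reflConjAux g)] with k h1 h2 h3 h4 h5
  rw [h1, h5, Pi.add_apply, h2, h3, h4, Pi.add_apply, conjVec_add]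

lemma reflConjAux_smul (z : ℝ) (f : L1Space d n) :
    reflConjAux (z • f) = z • reflConjAux f := by
  refine Lp.ext ?_
  filter_upwards [coeFn_reflConjAux (z • f), coeFn_reflConjAux f,
    ae_neg (Lp.coeFn_smul z f), Lp.coeFn_smul z (reflConjAux f)] with k h1 h2 h4 h5
  rw [h1, h5, Pi.smul_apply, h2, h4, Pi.smul_apply, conjVec_real_smul]

lemma norm_reflConjAux (f : L1Space d n) : ‖reflConjAux f‖ = ‖f‖ := by
  rw [L1.norm_eq_integral_norm, L1.norm_eq_integral_norm,
    ← integral_neg_eq_self (fun k => ‖f k‖)]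
  refine integral_congr_ae ?_
  filter_upwards [coeFn_reflConjAux f] with k hk
  rw [hk, norm_conjVec]

/-- The Fourier transform of the complex conjugate: `k ↦ conj (f (-k))`. -/
def reflConj : L1Space d n →L[ℝ] L1Space d n :=
  LinearMap.mkContinuous
    { toFun := reflConjAux, map_add' := reflConjAux_add, map_smul' := reflConjAux_smul } 1
    (fun f => by simpa using (norm_reflConjAux f).le)

lemma coeFn_reflConj (f : L1Space d n) :
    reflConj f =ᵐ[volume] fun k => conjVec (f (-k)) :=
  coeFn_reflConjAux f

lemma norm_reflConj (f : L1Space d n) : ‖reflConj f‖ = ‖f‖ := norm_reflConjAux f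

lemma wt_neg (s : ℕ) (R : ℝ≥0∞) (k : RVec d) : wt s R (-k) = wt s R k := by
  simp [wt]

lemma enorm_conjVec (v : CVec n) : ‖conjVec v‖ₑ = ‖v‖ₑ := by
  rw [← ofReal_norm, norm_conjVec, ofReal_norm]

lemma WBd.reflConj {s : ℕ} {R : ℝ≥0∞} {f : L1Space d n} {c : ℝ} (h : WBd (wt s R) f c) :
    WBd (wt s R) (reflConj f) c := by
  refine ⟨h.1, le_trans (le_of_eq ?_) h.2⟩
  rw [← lintegral_neg_eq_self (fun k => wt s R k * ‖f k‖ₑ)]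
  refine lintegral_congr_ae ?_
  filter_upwards [coeFn_reflConj f] with k hk
  rw [hk, enorm_conjVec, wt_neg]

lemma invFourier_reflConj (f : L1Space d n) (x : RVec d) :
    invFourier (reflConj f) x = conjVec (invFourier f x) := by
  rw [invFourier, invFourier, conjVec_smul, Complex.conj_ofReal]
  congr 1
  rw [← conjVecL_apply, ← ContinuousLinearMap.integral_comp_comm _
    (integrable_phase_smul (Lp.integrable_one f) x), ← integral_neg_eq_self]
  refine integral_congr_ae ?_
  have h1 := ae_neg (coeFn_reflConj f)
  filter_upwards [h1] with k hk
  rw [hk, neg_neg, conjVecL_apply, conjVec_smul]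
  congr 1
  rw [← Complex.exp_conj]
  congr 1
  simp [Complex.conj_ofReal]

end Refl

end

noncomputable section

set_option linter.unusedSectionVars false

open scoped ENNReal NNReal Topology Convolution FourierTransform

/-! ### The system for the Fourier transforms -/

lemma invFourier_compLp {d n : ℕ} (L : CVec n →L[ℂ] CVec n) (f : L1Space d n) (x : RVec d) :
    invFourier (L.compLp f) x = L (invFourier f x) := by
  rw [invFourier, invFourier, map_smul, ← ContinuousLinearMap.integral_comp_comm _
    (integrable_phase_smul (Lp.integrable_one f) x)]
  congr 1
  refine integral_congr_ae ?_
  filter_upwards [L.coeFn_compLp f] with k hk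
  rw [hk, map_smul]

namespace FriedrichsSystem
variable {d n : ℕ} (S : FriedrichsSystem d n)

/-- `𝓛(α, β)` as an operator. -/
def opD (α : ℝ) (β : RVec d) : CVec n →L[ℂ] CVec n :=
  Matrix.toEuclideanCLM (𝕜 := ℂ) (S.dispersion α β)

/-- `A_l` as an operator. -/
def opA (l : Fin d) : CVec n →L[ℂ] CVec n :=
  Matrix.toEuclideanCLM (𝕜 := ℂ) ((S.A l).map (fun a => (a : ℂ)))

/-- `A(k)` as an operator. -/
def symA (k : RVec d) : CVec n →L[ℂ] CVec n := ∑ l, ((k l : ℝ) : ℂ) • S.opA l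

lemma matVec_eq (M : Matrix (Fin n) (Fin n) ℂ) (v : CVec n) :
    matVec M v = Matrix.toEuclideanCLM (𝕜 := ℂ) M v := rfl

lemma opD_add (α : ℝ) (β θ : RVec d) : S.opD α (β + θ) = S.opD α β + S.symA θ := by
  have : S.dispersion α (β + θ) = S.dispersion α β
      + ∑ l, ((θ l : ℝ) : ℂ) • (S.A l).map (fun a => (a : ℂ)) := by
    simp only [dispersion, PiLp.add_apply, Complex.ofReal_add, add_smul, Finset.sum_add_distrib]
    abel
  rw [opD, opD, this, map_add, symA, map_sum]
  congr 1
  exact Finset.sum_congr rfl fun l _ => by rw [map_smul, opA]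

lemma symA_smul (r : ℝ) (k : RVec d) : S.symA (r • k) = (r : ℂ) • S.symA k := by
  rw [symA, symA, Finset.smul_sum]
  refine Finset.sum_congr rfl fun l _ => ?_
  rw [smul_smul, PiLp.smul_apply, smul_eq_mul, Complex.ofReal_mul]

lemma isHermitian_dispersion (α : ℝ) (β : RVec d) : (S.dispersion α β).IsHermitian := by
  have hA : ∀ l i j, S.A l i j = S.A l j i := fun l i j => congrFun₂ (S.A_symm l) j i
  have hE : ∀ i j, S.E j i = -S.E i j := fun i j => congrFun₂ S.E_skew i j
  ext i j
  simp only [dispersion, Matrix.conjTranspose_apply, Matrix.sub_apply, Matrix.add_apply,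
    Matrix.neg_apply, Matrix.smul_apply, Matrix.sum_apply, Matrix.map_apply, smul_eq_mul,
    star_sub, star_add, star_neg, star_mul', star_sum, Complex.star_def, Complex.conj_ofReal,
    Complex.conj_I, hE i j, Matrix.one_apply, hA _ i j]
  by_cases h : i = j
  · simp [h]
  · simp [h, Ne.symm h]

lemma opD_symm (α : ℝ) (β : RVec d) (a b : CVec n) :
    inner ℂ (S.opD α β a) b = inner ℂ a (S.opD α β b) := by
  have h : star (S.opD α β) = S.opD α β := by
    rw [opD, ← map_star, Matrix.star_eq_conjTranspose, (S.isHermitian_dispersion α β).eq]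
  rw [ContinuousLinearMap.star_eq_adjoint] at h
  conv_lhs => rw [← h]
  rw [ContinuousLinearMap.adjoint_inner_left]

/-- The matrix is Hermitian, so its product with an imaginary number is skew-adjoint. This is the
hypothesis of `slopeLE_wN`. -/
lemma re_inner_opD (α : ℝ) (β : RVec d) (r : ℝ) (a : CVec n) :
    RCLike.re (inner ℂ a (-(Complex.I / (r : ℂ)) • S.opD α β a) : ℂ) = 0 := by
  have h1 : (starRingEnd ℂ) (inner ℂ a (S.opD α β a)) = inner ℂ a (S.opD α β a) := by
    rw [inner_conj_symm, S.opD_symm]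
  obtain ⟨x, hx⟩ := Complex.conj_eq_iff_real.1 h1
  rw [inner_smul_right, hx]
  have : -(Complex.I / (r : ℂ)) * (x : ℂ) = ((-(x / r) : ℝ) : ℂ) * Complex.I := by
    push_cast; ring
  rw [this]
  simp

lemma exists_norm_symA_le : ∃ C, 0 ≤ C ∧ ∀ k, ‖S.symA k‖ ≤ C * ‖k‖ := by
  refine ⟨∑ l, ‖S.opA l‖, by positivity, fun k => ?_⟩
  rw [symA, Finset.sum_mul]
  refine (norm_sum_le _ _).trans (Finset.sum_le_sum fun l _ => ?_)
  rw [norm_smul, mul_comm]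
  gcongr
  rw [Complex.norm_real]
  exact PiLp.norm_apply_le k l

lemma continuous_symA : Continuous S.symA := by
  unfold symA
  fun_prop

/-- The trilinear extension of `T` as a bounded trilinear map. -/
def TcL : Tri n :=
  ∑ i₁, ∑ i₂, ∑ i₃, (EuclideanSpace.proj i₁).smulRight ((EuclideanSpace.proj i₂).smulRight
    ((EuclideanSpace.proj i₃).smulRight (WithLp.toLp 2 fun l =>
      ((S.T (Pi.single i₁ 1) (Pi.single i₂ 1) (Pi.single i₃ 1) l : ℝ) : ℂ))))

lemma TcL_apply (a b c : CVec n) : S.TcL a b c = S.Tc a b c := by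
  ext l
  simp only [TcL, Tc, _root_.sum_apply, ContinuousLinearMap.smulRight_apply,
    PiLp.proj_apply, _root_.smul_apply, WithLp.ofLp_sum, WithLp.ofLp_smul,
    Finset.sum_apply, Pi.smul_apply, smul_eq_mul]
  refine Finset.sum_congr rfl fun i₁ _ => Finset.sum_congr rfl fun i₂ _ =>
    Finset.sum_congr rfl fun i₃ _ => ?_
  ring

/-- The trilinear map that acts on Fourier transforms. -/
def TcF : Tri n := (fourierConst d * fourierConst d) • S.TcL

lemma invFourier_TcF (f g h : L1Space d n) (x : RVec d) :
    invFourier (triL1 S.TcF f g h) x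
      = S.Tc (invFourier f x) (invFourier g x) (invFourier h x) := by
  rw [← TcL_apply, ← invFourier_triL1 S.TcL]
  -- That the scalar can be pulled out of the trilinear map is read off from the transforms, which
  -- agree at every `x`.
  have h1 : triL1 S.TcF f g h = (fourierConst d * fourierConst d) • triL1 S.TcL f g h := by
    have h2 := invFourier_triL1 S.TcF f g h
    have h3 := invFourier_triL1 S.TcL f g h
    have hc := mul_ne_zero (fourierConst_ne_zero d) (fourierConst_ne_zero d)
    refine eq_of_invFourier (.of_forall fun x => ?_)
    have h4 : (fourierConst d * fourierConst d) • invFourier (triL1 S.TcF f g h) x =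
        (fourierConst d * fourierConst d) • invFourier
          ((fourierConst d * fourierConst d) • triL1 S.TcL f g h : L1Space d n) x := by
      rw [h2, ← invFourierL_apply x ((fourierConst d * fourierConst d) • _), map_smul,
        invFourierL_apply, h3]
      simp [TcF]
    exact smul_right_injective _ hc h4
  rw [h1, ← invFourierL_apply, map_smul, invFourierL_apply]

end FriedrichsSystem

section ModeSystem
variable {d n : ℕ}

/-- The coefficient functions with all indices `±1, ±3`. -/
def modeExt (U : ℤ → ℝ → L1Space d n) (j : ℤ) (t : ℝ) : L1Space d n :=
  if 0 < j then U j t else reflConj (U (-j) t)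

/-- The nonlinearity of the system for the Fourier transforms. -/
def nonlin (T : Tri n) (U : ℤ → L1Space d n) (j : ℤ) : L1Space d n :=
  ∑ J ∈ triads j, triL1 T (U J.1) (U J.2.1) (U J.2.2)

/-- The system for the Fourier transforms of the coefficient functions. -/
structure ModeSystem (S : FriedrichsSystem d n) (κ : RVec d) (ω ε τ : ℝ)
    (U V : ℤ → ℝ → L1Space d n) : Prop where
  conj : ∀ j ∈ posModes, ∀ t, U (-j) t = reflConj (U j t)
  deriv : ∀ j ∈ posModes, ∀ t ∈ Set.Icc 0 τ, HasDerivWithinAt (U j) (V j t) (Set.Icc 0 τ) t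
  conj_deriv : ∀ j ∈ posModes, ∀ t, V (-j) t = reflConj (V j t)
  eqn : ∀ j ∈ posModes, ∀ t ∈ Set.Icc 0 τ, V j t =ᵐ[volume] fun k =>
    -(Complex.I / (ε : ℂ)) • S.opD (j * ω) ((j : ℝ) • κ + ε • k) (U j t k)
      + (ε : ℂ) • (nonlin S.TcF (fun i => U i t) j) k

lemma modes_cases {j : ℤ} (hj : j ∈ modes) :
    (j ∈ posModes) ∨ (-j ∈ posModes ∧ ¬ 0 < j) := by
  fin_cases hj <;> simp [posModes]

lemma triads_modes {j : ℤ} {J : ℤ × ℤ × ℤ} (hJ : J ∈ triads j) :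
    J.1 ∈ modes ∧ J.2.1 ∈ modes ∧ J.2.2 ∈ modes := by
  simp only [triads, Finset.mem_filter, Finset.mem_product] at hJ
  exact ⟨hJ.1.1, hJ.1.2.1, hJ.1.2.2⟩

lemma posModes_pos {j : ℤ} (hj : j ∈ posModes) : 0 < j := by
  fin_cases hj <;> norm_num

/-- For fixed time both sides of the differential equation are inverse transforms of integrable
functions, so the equation passes to these functions. There `A(∂)` becomes `i A(k)` and merges with
`(i/ε) 𝓛(jω, jκ)` into `(i/ε) 𝓛(jω, jκ + εk)`. -/
lemma IsClassicalSolution.modeSystem {S : FriedrichsSystem d n} {κ : RVec d} {ω ε τ : ℝ}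
    {p : RVec d → CVec n} {u : ℤ → ℝ → RVec d → CVec n} {uhat : ℤ → ℝ → L1Space d n}
    (hε : 0 < ε) (hτ : 0 < τ) (h : IsClassicalSolution S κ ω ε τ p u uhat) :
    ModeSystem S κ ω ε τ (modeExt uhat)
      (modeExt fun j t => derivWithin (uhat j) (Set.Icc 0 τ) t) := by
  have hpos : ∀ {W : ℤ → ℝ → L1Space d n} {j : ℤ}, j ∈ posModes → modeExt W j = W j := by
    intro W j hj; funext t; simp [modeExt, posModes_pos hj]
  have hneg : ∀ {W : ℤ → ℝ → L1Space d n} {j : ℤ}, j ∈ posModes → ∀ t,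
      modeExt W (-j) t = reflConj (W j t) := by
    intro W j hj t
    have := posModes_pos hj
    simp only [modeExt, neg_neg]
    rw [if_neg (by omega)]
  have hud : UniqueDiffOn ℝ (Set.Icc 0 τ) := uniqueDiffOn_Icc hτ
  have hderiv : ∀ j ∈ posModes, ∀ t ∈ Set.Icc 0 τ,
      HasDerivWithinAt (uhat j) (derivWithin (uhat j) (Set.Icc 0 τ) t) (Set.Icc 0 τ) t :=
    fun j hj t ht =>
      (((h.contDiff_W j hj).differentiableOn (by simp)) t ht).hasDerivWithinAt
  refine ⟨fun j hj t => by rw [hneg hj, hpos hj], fun j hj t ht => ?_,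
    fun j hj t => by rw [hneg hj, hpos hj], fun j hj t ht => ?_⟩
  · rw [hpos hj, hpos hj]; exact hderiv j hj t ht
  have hval : ∀ i ∈ modes, ∀ s ∈ Set.Icc 0 τ, ∀ x,
      u i s x = invFourier (modeExt uhat i s) x := by
    intro i hi s hs x
    rcases modes_cases hi with hp | ⟨hp, -⟩
    · rw [hpos hp]; exact h.transform i hp s hs x
    · have h1 := h.neg_mode (-i) hp s hs x
      have h2 := hneg (W := uhat) hp s
      rw [neg_neg] at h1 h2
      rw [h1, h2, invFourier_reflConj, h.transform (-i) hp s hs x]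
  -- `v l` is the continuous curve `i k_l û_j` in `L¹`. Continuity in `W¹` is used to make the
  -- right-hand side continuous in time.
  choose v hvc hv using h.continuous_W1 j hj
  set N : ℝ → L1Space d n := fun s => nonlin S.TcF (fun i => modeExt uhat i s) j with hN
  set rhs : ℝ → L1Space d n := fun s =>
    -((Complex.I / (ε : ℂ)) • (S.opD (j * ω) ((j : ℝ) • κ)).compLp (uhat j s))
      - ∑ l, (S.opA l).compLp (v l s) + (ε : ℂ) • N s with hrhs
  have hcontU : ∀ i ∈ posModes, ContinuousOn (uhat i) (Set.Icc 0 τ) := fun i hi =>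
    (h.contDiff_W i hi).continuousOn
  have hmodes : ∀ i ∈ modes, ContinuousOn (modeExt uhat i) (Set.Icc 0 τ) := by
    intro i hi
    rcases modes_cases hi with hp | ⟨hp, -⟩
    · rw [hpos hp]; exact hcontU i hp
    · have h2 : modeExt uhat i = fun s => reflConj (uhat (-i) s) := by
        funext s; have := hneg (W := uhat) hp s; rwa [neg_neg] at this
      rw [h2]
      exact reflConj.continuous.comp_continuousOn (hcontU _ hp)
  have hNc : ContinuousOn N (Set.Icc 0 τ) := by
    simp only [hN, nonlin]
    refine continuousOn_finsetSum _ fun J hJ => ?_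
    obtain ⟨h1, h2, h3⟩ := triads_modes hJ
    have c1 := hmodes _ h1
    have c2 := hmodes _ h2
    have c3 := hmodes _ h3
    unfold triL1
    fun_prop
  have hrhsc : ContinuousOn rhs (Set.Icc 0 τ) := by
    have e : ∀ (L : CVec n →L[ℂ] CVec n) (f : L1Space d n),
        L.compLp f = L.compLpL 1 volume f := fun L f => rfl
    have c1 := hcontU j hj
    simp only [hrhs, e]
    refine ContinuousOn.add (ContinuousOn.sub ?_ ?_) (hNc.const_smul (ε : ℂ))
    · exact (((ContinuousLinearMap.continuous _).comp_continuousOn c1).const_smul (Complex.I / (ε : ℂ))).neg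
    · exact continuousOn_finsetSum _ fun l _ =>
        (ContinuousLinearMap.continuous _).comp_continuousOn (hvc l)
  have heq : Set.EqOn (derivWithin (uhat j) (Set.Icc 0 τ)) rhs (Set.Ioc 0 τ) := by
    intro s hs
    have hs' : s ∈ Set.Icc 0 τ := ⟨hs.1.le, hs.2⟩
    refine eq_of_invFourier (.of_forall fun x => ?_)
    have hL : HasDerivWithinAt (fun s => u j s x)
        (invFourier (⇑(derivWithin (uhat j) (Set.Icc 0 τ) s : L1Space d n)) x) (Set.Icc 0 τ) s := by
      have h1 := ((invFourierL x).restrictScalars ℝ).hasFDerivAt.comp_hasDerivWithinAt s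
        (hderiv j hj s hs')
      exact h1.congr (fun r hr => h.transform j hj r hr x) (h.transform j hj s hs' x)
    have hder := (hud s hs').eq_deriv _ hL (h.pde j hj s hs x)
    rw [hder]
    have hfd : ∀ l, fderiv ℝ (u j s) x (EuclideanSpace.single l 1) = invFourier (v l s) x := by
      intro l
      have : u j s = fun x => invFourier (uhat j s) x := funext (h.transform j hj s hs')
      rw [this]
      exact fderiv_invFourier _ l _ (fun l => ⟨v l s, hv l s hs'⟩) (hv l s hs') x
    have hNx : invFourier (N s) x
        = ∑ J ∈ triads j, S.Tc (u J.1 s x) (u J.2.1 s x) (u J.2.2 s x) := by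
      simp only [hN, nonlin]
      rw [← invFourierL_apply, map_sum]
      refine Finset.sum_congr rfl fun J hJ => ?_
      obtain ⟨h1, h2, h3⟩ := triads_modes hJ
      rw [invFourierL_apply, S.invFourier_TcF, hval _ h1 s hs', hval _ h2 s hs', hval _ h3 s hs']
    rw [← invFourierL_apply x (rhs s)]
    simp only [hrhs, map_add, map_sub, map_neg, map_smul, map_sum, invFourierL_apply,
      invFourier_compLp, hNx,
      hfd, ← h.transform j hj s hs' x]
    rfl
  -- The differential equation is given for positive times only. Both sides are continuous on the
  -- closed interval, which yields it at `t = 0`.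
  have heq' : derivWithin (uhat j) (Set.Icc 0 τ) t = rhs t := by
    have hclos : t ∈ closure (Set.Ioc 0 τ) := by rwa [closure_Ioc hτ.ne]
    have c1 : ContinuousWithinAt (derivWithin (uhat j) (Set.Icc 0 τ)) (Set.Ioc 0 τ) t :=
      ((h.contDiff_W j hj).continuousOn_derivWithin hud le_rfl t ht).mono Set.Ioc_subset_Icc_self
    have c2 : ContinuousWithinAt rhs (Set.Ioc 0 τ) t := (hrhsc t ht).mono Set.Ioc_subset_Icc_self
    have : (𝓝[Set.Ioc 0 τ] t).NeBot := mem_closure_iff_nhdsWithin_neBot.1 hclos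
    refine tendsto_nhds_unique c1 (c2.congr' ?_)
    filter_upwards [self_mem_nhdsWithin] with s hs using (heq hs).symm
  rw [hpos hj, hpos hj, heq']
  set w : L1Space d n := ∑ l, (S.opA l).compLp (v l t) with hw
  have hsum : w =ᵐ[volume] fun k => Complex.I • S.symA k (uhat j t k) := by
    have h1 : ∀ᵐ k, ∀ l, (S.opA l).compLp (v l t) k
        = S.opA l ((Complex.I * ((k l : ℝ) : ℂ)) • uhat j t k) := by
      rw [ae_all_iff]
      intro l
      filter_upwards [(S.opA l).coeFn_compLp (v l t), hv l t ht] with k h1 h2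
      rw [h1, h2, fourierD]
    filter_upwards [h1, Lp.coeFn_finsetSum Finset.univ
      (fun l => (S.opA l).compLp (v l t))] with k h2 h3
    rw [hw, h3, Finset.sum_apply, FriedrichsSystem.symA, _root_.sum_apply, Finset.smul_sum]
    refine Finset.sum_congr rfl fun l _ => ?_
    rw [h2, map_smul, _root_.smul_apply, smul_smul]
  set z : L1Space d n := (S.opD (j * ω) ((j : ℝ) • κ)).compLp (uhat j t) with hz
  have hrt : rhs t = -((Complex.I / (ε : ℂ)) • z) - w + (ε : ℂ) • N t := rfl
  rw [hrt]
  filter_upwards [hsum, (S.opD (j * ω) ((j : ℝ) • κ)).coeFn_compLp (uhat j t),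
    Lp.coeFn_add (-((Complex.I / (ε : ℂ)) • z) - w) ((ε : ℂ) • N t),
    Lp.coeFn_sub (-((Complex.I / (ε : ℂ)) • z)) w, Lp.coeFn_neg ((Complex.I / (ε : ℂ)) • z),
    Lp.coeFn_smul (Complex.I / (ε : ℂ)) z, Lp.coeFn_smul (ε : ℂ) (N t)] with k h1 h2 h3 h4 h5 h6 h7
  have hε' : (ε : ℂ) ≠ 0 := by exact_mod_cast hε.ne'
  rw [h3, Pi.add_apply, h4, Pi.sub_apply, h5, Pi.neg_apply, h6, Pi.smul_apply, h7, Pi.smul_apply,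
    h1, h2, S.opD_add, S.symA_smul, _root_.add_apply, _root_.smul_apply, smul_add, smul_smul,
    neg_mul, div_mul_cancel₀ _ hε', neg_smul, neg_smul, ← sub_eq_add_neg]

end ModeSystem

end

noncomputable section

set_option linter.unusedSectionVars false

open scoped ENNReal NNReal Topology

/-! ### Bounds for multipliers and for the nonlinearity -/

section Bounds
variable {d n : ℕ} {T : Tri n} {s : ℕ} {R : ℝ≥0∞} {a b c K : ℝ}

lemma WBd.op {w : RVec d → ℝ≥0∞} {f : L1Space d n} (h : WBd w f a) (m : Mult d n) {C : ℝ}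
    (hC : ∀ k, ‖m.toFun k‖ ≤ C) : WBd w (m.op f) (C * a) := by
  refine h.of_norm_le ((norm_nonneg _).trans (hC 0)) ?_
  filter_upwards [m.coeFn_op f] with k hk
  rw [hk]
  exact (ContinuousLinearMap.le_opNorm _ _).trans (by gcongr; exact hC k)

/-- One factor `‖k‖` is paid with one power of the weight. This is the loss incurred by `λ(εk)/ε`,
by `A(k)` and by `P(εk) - P(0)`. -/
lemma WBd.of_norm_le_norm_mul {f : RVec d → CVec n} {g : RVec d → CVec n} {C : ℝ} (hC : 0 ≤ C)
    (h : WBd (wt (s + 1) ⊤) g a) (hle : ∀ᵐ k, ‖f k‖ ≤ C * ‖k‖ * ‖g k‖) :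
    WBd (wt s R) f (C * a) := by
  refine h.of_le hC ?_
  filter_upwards [hle] with k hk
  have h1 : ‖f k‖ₑ ≤ ENNReal.ofReal C * (‖k‖ₑ * ‖g k‖ₑ) := by
    rw [← ofReal_norm, ← ofReal_norm, ← ofReal_norm, ← ENNReal.ofReal_mul (norm_nonneg _),
      ← ENNReal.ofReal_mul hC, ← mul_assoc]
    exact ENNReal.ofReal_le_ofReal hk
  calc wt s R k * ‖f k‖ₑ ≤ wt s R k * (ENNReal.ofReal C * (‖k‖ₑ * ‖g k‖ₑ)) := by gcongr
    _ = ENNReal.ofReal C * ((‖k‖ₑ * wt s R k) * ‖g k‖ₑ) := by ring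
    _ ≤ _ := by gcongr; exact enorm_mul_wt_le s R k

lemma WBd.weight_le {s' : ℕ} {E : Type*} [NormedAddCommGroup E] {f : RVec d → E}
    (h : WBd (wt s' ⊤) f a) (hs : s ≤ s' := by omega) : WBd (wt s R) f a :=
  h.weight_mono fun k => (wt_le_wt_top s R k).trans (wt_le_wt_of_le hs ⊤ k)

lemma nonlin_bound_add {U : ℤ → L1Space d n} {j : ℤ} (hU : ∀ i ∈ modes, WBd (wt s R) (U i) a)
    (hK : ∀ i ∈ modes, ‖U i‖ ≤ K) :
    WBd (wt s R) (nonlin T U j) ((triads j).card * (4 ^ s * triC T * K ^ 2 * (a + a + a))) := by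
  rw [← nsmul_eq_mul, ← Finset.sum_const]
  refine WBd.sum_Lp (measurable_wt s R) _ fun J hJ => ?_
  obtain ⟨h1, h2, h3⟩ := triads_modes hJ
  exact WBd.triL1_add T (hU _ h1) (hU _ h2) (hU _ h3) (hK _ h1) (hK _ h2) (hK _ h3)

/-- The derivative of the nonlinearity. -/
def nonlinD (T : Tri n) (U V : ℤ → L1Space d n) (j : ℤ) : L1Space d n :=
  ∑ J ∈ triads j, (triL1 T (V J.1) (U J.2.1) (U J.2.2) + triL1 T (U J.1) (V J.2.1) (U J.2.2)
    + triL1 T (U J.1) (U J.2.1) (V J.2.2))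

lemma hasDerivWithinAt_nonlin {U V : ℤ → ℝ → L1Space d n} {I : Set ℝ} {t : ℝ}
    (h : ∀ i ∈ modes, HasDerivWithinAt (U i) (V i t) I t) (j : ℤ) :
    HasDerivWithinAt (fun t => nonlin T (fun i => U i t) j)
      (nonlinD T (fun i => U i t) (fun i => V i t) j) I t := by
  unfold nonlin nonlinD
  refine HasDerivWithinAt.fun_sum fun J hJ => ?_
  obtain ⟨h1, h2, h3⟩ := triads_modes hJ
  exact HasDerivWithinAt.triL1 T (h _ h1) (h _ h2) (h _ h3)

end Bounds

/-! ### Energy estimates for the system -/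

section System
variable {d n : ℕ} {S : FriedrichsSystem d n} {κ : RVec d} {ω ε τ : ℝ}
  {U V : ℤ → ℝ → L1Space d n}

lemma one_mem_posModes : (1 : ℤ) ∈ posModes := by simp [posModes]
lemma three_mem_posModes : (3 : ℤ) ∈ posModes := by simp [posModes]

lemma posModes_forall {p : ℤ → Prop} (h1 : p 1) (h3 : p 3) : ∀ j ∈ posModes, p j := by
  intro j hj; fin_cases hj <;> assumption

lemma ModeSystem.mono (h : ModeSystem S κ ω ε τ U V) {τ' : ℝ} (hτ : τ' ≤ τ) :
    ModeSystem S κ ω ε τ' U V :=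
  have hs : Set.Icc 0 τ' ⊆ Set.Icc 0 τ := Set.Icc_subset_Icc_right hτ
  ⟨h.conj, fun j hj t ht => (h.deriv j hj t (hs ht)).mono hs, h.conj_deriv,
    fun j hj t ht => h.eqn j hj t (hs ht)⟩

lemma modes_bound {W : ℤ → L1Space d n} (hW : ∀ j ∈ posModes, W (-j) = reflConj (W j)) {s : ℕ}
    {R : ℝ≥0∞} {a : ℝ} (h : ∀ j ∈ posModes, WBd (wt s R) (W j) a) :
    ∀ i ∈ modes, WBd (wt s R) (W i) a := by
  intro i hi
  rcases modes_cases hi with hp | ⟨hp, -⟩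
  · exact h i hp
  · have := hW _ hp
    rw [neg_neg] at this
    rw [this]
    exact (h _ hp).reflConj

lemma modes_norm {W : ℤ → L1Space d n} (hW : ∀ j ∈ posModes, W (-j) = reflConj (W j)) {a : ℝ}
    (h : ∀ j ∈ posModes, ‖W j‖ ≤ a) : ∀ i ∈ modes, ‖W i‖ ≤ a := by
  intro i hi
  rcases modes_cases hi with hp | ⟨hp, -⟩
  · exact h i hp
  · have := hW _ hp
    rw [neg_neg] at this
    rw [this, norm_reflConj]
    exact h _ hp

lemma ModeSystem.deriv_modes (h : ModeSystem S κ ω ε τ U V) {t : ℝ} (ht : t ∈ Set.Icc 0 τ) :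
    ∀ i ∈ modes, HasDerivWithinAt (U i) (V i t) (Set.Icc 0 τ) t := by
  intro i hi
  rcases modes_cases hi with hp | ⟨hp, -⟩
  · exact h.deriv i hp t ht
  · have h1 := fun t => h.conj _ hp t
    have h2 := h.conj_deriv _ hp t
    simp only [neg_neg] at h1 h2
    have h3 : U i = fun t => reflConj (U (-i) t) := funext h1
    rw [h3, h2]
    exact (reflConj (d := d) (n := n)).hasFDerivAt.comp_hasDerivWithinAt t (h.deriv _ hp t ht)

lemma ModeSystem.continuousOn (h : ModeSystem S κ ω ε τ U V) {j : ℤ} (hj : j ∈ posModes) :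
    ContinuousOn (U j) (Set.Icc 0 τ) :=
  fun t ht => (h.deriv j hj t ht).continuousWithinAt

/-- The growth of a weighted norm is bounded by the residual of the linear equation. -/
lemma slopeLE_of_residual (S : FriedrichsSystem d n) (α : ℝ) (β : RVec d) (ε : ℝ)
    {w : RVec d → ℝ≥0∞} (hw : Measurable w) (hw1 : ∀ k, 1 ≤ w k) {R : ℝ≥0} (hR : ∀ k, w k ≤ R)
    {q : ℝ → L1Space d n} {q' : L1Space d n} {t c : ℝ}
    (hq : HasDerivWithinAt q q' (Set.Icc 0 τ) t) (ht : t ∈ Set.Ico 0 τ)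
    (hc : WBd w (fun k => q' k + (Complex.I / (ε : ℂ)) • S.opD α (β + ε • k) (q t k)) c) :
    SlopeLE (fun z => wN w (q z)) t c := by
  refine slopeLE_wN hw hw1 hR hq ht
    (D := fun k a => -(Complex.I / (ε : ℂ)) • S.opD α (β + ε • k) a)
    (fun k => by simp) (fun k a => S.re_inner_opD α _ ε a) ?_ (.of_forall fun k => ?_) hc
  · have hcont : Continuous fun k : RVec d => S.opD α (β + ε • k) := by
      simp_rw [S.opD_add]
      exact continuous_const.add (S.continuous_symA.comp (continuous_const_smul ε))
    have h1 : AEStronglyMeasurable (fun k => S.opD α (β + ε • k) (q t k)) volume :=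
      (isBoundedBilinearMap_apply (𝕜 := ℂ)).continuous.comp_aestronglyMeasurable
        (hcont.aestronglyMeasurable.prodMk (Lp.aestronglyMeasurable (q t)))
    have h2 : AEStronglyMeasurable
        (fun k => (Complex.I / (ε : ℂ)) • S.opD α (β + ε • k) (q t k)) volume :=
      h1.const_smul (Complex.I / (ε : ℂ))
    have h0 : AEStronglyMeasurable (fun k => q' k) volume := Lp.aestronglyMeasurable q'
    have h3 : AEStronglyMeasurable
        (fun k => q' k + (Complex.I / (ε : ℂ)) • S.opD α (β + ε • k) (q t k)) volume :=
      h0.add h2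
    exact h3
  · simp only [neg_smul]
    abel

lemma ModeSystem.slopeLE (h : ModeSystem S κ ω ε τ U V) {j : ℤ} (hj : j ∈ posModes) {t c : ℝ}
    (ht : t ∈ Set.Ico 0 τ) (hε : 0 ≤ ε) {w : RVec d → ℝ≥0∞} (hw : Measurable w)
    (hw1 : ∀ k, 1 ≤ w k) {R : ℝ≥0} (hR : ∀ k, w k ≤ R)
    (hc : WBd w (nonlin S.TcF (fun i => U i t) j) c) :
    SlopeLE (fun z => wN w (U j z)) t (ε * c) := by
  refine slopeLE_of_residual S (j * ω) ((j : ℝ) • κ) ε hw hw1 hR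
    (h.deriv j hj t ⟨ht.1, ht.2.le⟩) ht ?_
  refine hc.of_norm_le hε ?_
  filter_upwards [h.eqn j hj t ⟨ht.1, ht.2.le⟩] with k hk
  rw [hk]
  refine le_of_eq ?_
  have : ∀ a b : CVec n, -(Complex.I / (ε : ℂ)) • a + b + (Complex.I / (ε : ℂ)) • a = b := by
    intro a b; rw [neg_smul]; abel
  rw [this, norm_smul, Complex.norm_of_nonneg hε]

lemma wN_one_eq (f : L1Space d n) : wN 1 f = ‖f‖ := by
  rw [wN]
  simp only [Pi.one_apply, one_mul]
  rw [lintegral_enorm_Lp, ENNReal.toReal_ofReal (norm_nonneg _)]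

/-- The number of all triads times the bound of the trilinear convolution. -/
def nlC (S : FriedrichsSystem d n) : ℝ := ((triads 1).card + (triads 3).card) * triC S.TcF

lemma nlC_nonneg (S : FriedrichsSystem d n) : 0 ≤ nlC S := by
  have := triC_nonneg S.TcF
  unfold nlC; positivity

lemma card_mul_le (S : FriedrichsSystem d n) {j : ℤ} (hj : j ∈ posModes) :
    (triads j).card * triC S.TcF ≤ nlC S := by
  have hT := triC_nonneg S.TcF
  have key : ∀ j ∈ posModes, ((triads j).card : ℝ) ≤ (triads 1).card + (triads 3).card :=
    posModes_forall (by simp) (by simp)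
  exact mul_le_mul_of_nonneg_right (key j hj) hT

/-- On a time interval of length `O(1/ε)` the solution stays bounded in `L¹`. -/
lemma exists_local_bound (S : FriedrichsSystem d n) (κ : RVec d) (ω : ℝ) {M : ℝ} (hM : 0 ≤ M) :
    ∃ t₁ > 0, ∀ ε τ : ℝ, 0 < ε → ε * τ ≤ t₁ → ∀ U V : ℤ → ℝ → L1Space d n,
      ModeSystem S κ ω ε τ U V → ‖U 1 0‖ ≤ M → U 3 0 = 0 →
      ∀ t ∈ Set.Icc 0 τ, ‖U 1 t‖ + ‖U 3 t‖ ≤ M + 2 := by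
  -- As long as the sum of the norms is at most `M + 2`, its growth rate is strictly less than `ε
  -- D`; the summand `1` makes the inequality strict. For `ε τ ≤ 1 / D` the total growth is then at
  -- most `1`.
  set D : ℝ := 2 * nlC S * (M + 2) ^ 3 + 1 with hD
  have hC := nlC_nonneg S
  have hD0 : 0 < D := by positivity
  refine ⟨1 / D, by positivity, fun ε τ hε hετ U V h h1 h3 t ht => ?_⟩
  set f : ℝ → ℝ := fun t => ‖U 1 t‖ + ‖U 3 t‖ with hf
  have hfc : ContinuousOn f (Set.Icc 0 τ) :=
    (h.continuousOn one_mem_posModes).norm.add (h.continuousOn three_mem_posModes).norm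
  have hslope : ∀ x ∈ Set.Ico 0 τ, SlopeLE f x (ε * (2 * nlC S * f x ^ 3)) := by
    intro x hx
    have hnn : 0 ≤ f x := by positivity
    have hj : ∀ j ∈ posModes, SlopeLE (fun z => ‖U j z‖) x (ε * (nlC S * f x ^ 3)) := by
      intro j hj
      have hb : ∀ i ∈ modes, ‖U i x‖ ≤ f x :=
        modes_norm (W := fun i => U i x) (fun j hj => h.conj j hj x)
          (posModes_forall (by simp [hf]) (by simp [hf]))
      have hN : WBd 1 (nonlin S.TcF (fun i => U i x) j)
          ((triads j).card * (triC S.TcF * f x ^ 3)) := by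
        have h0 := WBd.norm_Lp (nonlin S.TcF (fun i => U i x) j) (w := 1) (R := 1) (by simp)
        refine h0.mono ?_
        rw [NNReal.coe_one, one_mul, nonlin, ← nsmul_eq_mul, ← Finset.sum_const]
        refine (norm_sum_le _ _).trans (Finset.sum_le_sum fun J hJ => ?_)
        obtain ⟨h1, h2, h3⟩ := triads_modes hJ
        exact norm_triL1_le _ (hb _ h1) (hb _ h2) (hb _ h3)
      have := h.slopeLE hj hx hε.le measurable_one (by simp) (R := 1) (by simp) hN
      simp only [wN_one_eq] at this
      refine this.mono ?_
      have hcard := card_mul_le S hj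
      calc ε * ((triads j).card * (triC S.TcF * f x ^ 3))
          = ε * (((triads j).card * triC S.TcF) * f x ^ 3) := by ring
        _ ≤ _ := by gcongr
    exact ((hj 1 one_mem_posModes).add (hj 3 three_mem_posModes)).mono (le_of_eq (by ring))
  -- The barrier `M + 1 + ε D x` stays below `M + 2`. Slopes have to be compared only at contact
  -- points, and there this bound for the barrier is a bound for `f x`.
  have hbd : ∀ ⦃x⦄, x ∈ Set.Icc 0 τ → f x ≤ M + 1 + ε * D * x := by
    refine image_le_of_liminf_slope_right_lt_deriv_boundary
      (f' := fun x => ε * (2 * nlC S * f x ^ 3)) (B' := fun _ => ε * D) hfc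
      (fun x hx r hr => (hslope x hx r hr).frequently) ?_ ?_ ?_
    · simp only [hf, h3, norm_zero]; linarith
    · intro x
      simpa using ((hasDerivAt_id x).const_mul (ε * D)).const_add (M + 1)
    · intro x hx hfx
      have hx2 : ε * D * x ≤ 1 := by
        have : ε * x ≤ 1 / D := (by gcongr; exact hx.2.le : ε * x ≤ ε * τ).trans hετ
        calc ε * D * x = D * (ε * x) := by ring
          _ ≤ D * (1 / D) := by gcongr
          _ = 1 := by field_simp
      have hle : f x ≤ M + 2 := by rw [hfx]; linarith
      have hnn : 0 ≤ f x := by positivity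
      have : 2 * nlC S * f x ^ 3 < D := by
        rw [hD]
        have : 2 * nlC S * f x ^ 3 ≤ 2 * nlC S * (M + 2) ^ 3 := by gcongr
        linarith
      exact mul_lt_mul_of_pos_left this hε
  have hx2 : ε * D * t ≤ 1 := by
    have : ε * t ≤ 1 / D := (by gcongr; exact ht.2 : ε * t ≤ ε * τ).trans hετ
    calc ε * D * t = D * (ε * t) := by ring
      _ ≤ D * (1 / D) := by gcongr
      _ = 1 := by field_simp
  have := hbd ht
  simp only [hf] at this
  linarith

/-- Persistence of weighted bounds as long as the solution is bounded in `L¹`. -/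
lemma ModeSystem.persistence (h : ModeSystem S κ ω ε τ U V) (hε : 0 < ε) {θ K P : ℝ}
    (hτ : ε * τ ≤ θ) (hK : ∀ t ∈ Set.Icc 0 τ, ∀ j ∈ posModes, ‖U j t‖ ≤ K) (s : ℕ)
    (h1 : WBd (wt s ⊤) (U 1 0) P) (h3 : U 3 0 = 0) :
    ∀ t ∈ Set.Icc 0 τ, ∀ j ∈ posModes, WBd (wt s ⊤) (U j t)
      (P * Real.exp (6 * nlC S * 4 ^ s * K ^ 2 * θ)) := by
  intro t ht
  have hC := nlC_nonneg S
  have hP := h1.nonneg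
  have key : ∀ R : ℝ≥0, 1 ≤ R → wN (wt s R) (U 1 t) + wN (wt s R) (U 3 t)
      ≤ P * Real.exp (6 * nlC S * 4 ^ s * K ^ 2 * θ) := by
    intro R hR
    have hR' : (1 : ℝ≥0∞) ≤ R := by exact_mod_cast hR
    set w := wt (d := d) s R with hw
    have hwm : Measurable w := measurable_wt s R
    have hw1 : ∀ k, 1 ≤ w k := one_le_wt s hR'
    have hwR : ∀ k, w k ≤ R := wt_le s R
    set f : ℝ → ℝ := fun t => wN w (U 1 t) + wN w (U 3 t) with hf
    have hnn : ∀ g : L1Space d n, 0 ≤ wN w g := fun g => ENNReal.toReal_nonneg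
    have hfc : ContinuousOn f (Set.Icc 0 τ) :=
      ((continuous_wN hwm hwR).comp_continuousOn (h.continuousOn one_mem_posModes)).add
        ((continuous_wN hwm hwR).comp_continuousOn (h.continuousOn three_mem_posModes))
    -- The factor `6` stems from two equations and three slots of the trilinear term.
    have hslope : ∀ x ∈ Set.Ico 0 τ,
        SlopeLE f x (ε * (6 * nlC S * 4 ^ s * K ^ 2) * f x + 0) := by
      intro x hx
      have hx' : x ∈ Set.Icc 0 τ := ⟨hx.1, hx.2.le⟩
      have hfx : 0 ≤ f x := add_nonneg (hnn _) (hnn _)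
      have hj : ∀ j ∈ posModes, SlopeLE (fun z => wN w (U j z)) x
          (ε * (nlC S * (4 ^ s * K ^ 2 * (f x + f x + f x)))) := by
        intro j hj
        have hb : ∀ i ∈ modes, ‖U i x‖ ≤ K :=
          modes_norm (W := fun i => U i x) (fun j hj => h.conj j hj x) (hK x hx')
        have hb' : ∀ i ∈ modes, WBd w (U i x) (f x) :=
          modes_bound (W := fun i => U i x) (fun j hj => h.conj j hj x)
            (posModes_forall ((WBd.wN_Lp hwR _).mono (by simp [hf, hnn]))
              ((WBd.wN_Lp hwR _).mono (by simp [hf, hnn])))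
        refine (h.slopeLE hj hx hε.le hwm hw1 hwR (nonlin_bound_add hb' hb)).mono ?_
        have := card_mul_le S hj
        calc ε * ((triads j).card * (4 ^ s * triC S.TcF * K ^ 2 * (f x + f x + f x)))
            = ε * (((triads j).card * triC S.TcF) * (4 ^ s * K ^ 2 * (f x + f x + f x))) := by ring
          _ ≤ _ := by gcongr
      exact ((hj 1 one_mem_posModes).add (hj 3 three_mem_posModes)).mono (le_of_eq (by ring))
    have h0 : f 0 ≤ P := by
      have e1 : wN w (U 1 0) ≤ P := (h1.weight_mono (wt_le_wt_top s R)).toReal_le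
      have e3 : wN w (U 3 0) ≤ 0 := by rw [h3]; exact WBd.zero_Lp.toReal_le
      simp only [hf]; linarith
    have := gronwall_of_slopeLE hfc (by positivity) le_rfl h0 hslope t ht
    refine this.trans ?_
    have e : P + 0 * t = P := by ring
    rw [e]
    refine mul_le_mul_of_nonneg_left (Real.exp_le_exp.2 ?_) hP
    calc ε * (6 * nlC S * 4 ^ s * K ^ 2) * t = 6 * nlC S * 4 ^ s * K ^ 2 * (ε * t) := by ring
      _ ≤ 6 * nlC S * 4 ^ s * K ^ 2 * (ε * τ) := by gcongr; exact ht.2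
      _ ≤ _ := by gcongr
  have hnn : ∀ (w : RVec d → ℝ≥0∞) (g : L1Space d n), 0 ≤ wN w g :=
    fun w g => ENNReal.toReal_nonneg
  refine posModes_forall ?_ ?_
  · refine WBd.of_truncated (Lp.aestronglyMeasurable _) fun R hR => ?_
    refine (WBd.wN_Lp (wt_le s R) _).mono ?_
    linarith [key R hR, hnn (wt s R) (U 3 t)]
  · refine WBd.of_truncated (Lp.aestronglyMeasurable _) fun R hR => ?_
    refine (WBd.wN_Lp (wt_le s R) _).mono ?_
    linarith [key R hR, hnn (wt s R) (U 1 t)]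

end System

end

noncomputable section

set_option linter.unusedSectionVars false

open scoped ENNReal NNReal Topology

/-! ### Uniform bounds for families -/

section Uniform
variable {d n : ℕ} {ι : Type*} {s s' : ℕ} {R : ι → ℝ≥0∞} {b b' b₁ b₂ b₃ : ι → ℝ}

/-- The family `f` is bounded by a constant multiple of `b` in the weighted norms. -/
def UBd (s : ℕ) (R : ι → ℝ≥0∞) (f : ι → RVec d → CVec n) (b : ι → ℝ) : Prop :=
  ∃ C, 0 ≤ C ∧ ∀ i, WBd (wt s (R i)) (f i) (C * b i)

/-- `UBd` for families in `L¹`. -/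
def UBdL (s : ℕ) (R : ι → ℝ≥0∞) (f : ι → L1Space d n) (b : ι → ℝ) : Prop :=
  UBd s R (fun i k => f i k) b

lemma UBd.mono {f : ι → RVec d → CVec n} (h : UBd s R f b) {c : ℝ} (hc : 0 ≤ c)
    (hb : ∀ i, b i ≤ c * b' i) : UBd s R f b' := by
  obtain ⟨C, hC, h⟩ := h
  refine ⟨C * c, by positivity, fun i => (h i).mono ?_⟩
  rw [mul_assoc]
  exact mul_le_mul_of_nonneg_left (hb i) hC

lemma UBd.mono_one {f : ι → RVec d → CVec n} (h : UBd s R f b)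
    (hb : ∀ i, b i ≤ b' i) : UBd s R f b' :=
  h.mono zero_le_one (by simpa using hb)

lemma UBd.add {f g : ι → RVec d → CVec n} (hf : UBd s R f b) (hg : UBd s R g b)
    (hm : ∀ i, AEStronglyMeasurable (f i) volume) : UBd s R (fun i k => f i k + g i k) b := by
  obtain ⟨C, hC, h⟩ := hf
  obtain ⟨C', hC', h'⟩ := hg
  exact ⟨C + C', by positivity, fun i => ((h i).add (measurable_wt s _) (hm i) (h' i)).mono
    (le_of_eq (by ring))⟩

lemma UBd.congr {f g : ι → RVec d → CVec n} (hf : UBd s R f b)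
    (hfg : ∀ i, f i =ᵐ[volume] g i) : UBd s R g b := by
  obtain ⟨C, hC, h⟩ := hf
  exact ⟨C, hC, fun i => (h i).congr (hfg i)⟩

lemma UBd.of_norm_le {f g : ι → RVec d → CVec n} (hf : UBd s R f b) {c : ι → ℝ}
    (hc : ∀ i, 0 ≤ c i) (hfg : ∀ i, ∀ᵐ k, ‖g i k‖ ≤ c i * ‖f i k‖) :
    UBd s R g (fun i => c i * b i) := by
  obtain ⟨C, hC, h⟩ := hf
  exact ⟨C, hC, fun i => ((h i).of_norm_le (hc i) (hfg i)).mono (le_of_eq (by ring))⟩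

lemma UBd.of_norm_le_norm_mul {f g : ι → RVec d → CVec n} (hf : UBd (s + 1) (fun _ => ⊤) f b)
    {c : ι → ℝ} (hc : ∀ i, 0 ≤ c i) (hfg : ∀ i, ∀ᵐ k, ‖g i k‖ ≤ c i * ‖k‖ * ‖f i k‖) :
    UBd s R g (fun i => c i * b i) := by
  obtain ⟨C, hC, h⟩ := hf
  exact ⟨C, hC, fun i => ((h i).of_norm_le_norm_mul (hc i) (hfg i)).mono (le_of_eq (by ring))⟩

lemma UBd.weight_le {f : ι → RVec d → CVec n} (hf : UBd s' (fun _ => ⊤) f b) (hs : s ≤ s') :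
    UBd s R f b := by
  obtain ⟨C, hC, h⟩ := hf
  exact ⟨C, hC, fun _ => (h _).weight_le hs⟩

variable {f g h : ι → L1Space d n}

lemma UBdL.add (hf : UBdL s R f b) (hg : UBdL s R g b) : UBdL s R (fun i => f i + g i) b :=
  (UBd.add hf hg fun i => Lp.aestronglyMeasurable (f i)).congr fun _ => (Lp.coeFn_add _ _).symm

lemma UBdL.smul (hf : UBdL s R f b) {z : ι → ℂ} {c : ι → ℝ} (hz : ∀ i, ‖z i‖ = c i) :
    UBdL s R (fun i => z i • f i) (fun i => c i * b i) := by
  obtain ⟨C, hC, h⟩ := hf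
  exact ⟨C, hC, fun i => ((h i).smul_Lp (z i)).mono (le_of_eq (by rw [hz]; ring))⟩

lemma UBdL.neg (hf : UBdL s R f b) : UBdL s R (fun i => -f i) b := by
  obtain ⟨C, hC, h⟩ := hf
  exact ⟨C, hC, fun i => (h i).neg_Lp⟩

lemma UBdL.sub (hf : UBdL s R f b) (hg : UBdL s R g b) : UBdL s R (fun i => f i - g i) b := by
  simp only [sub_eq_add_neg]
  exact hf.add hg.neg

lemma UBdL.zero : UBdL s R (fun _ => (0 : L1Space d n)) b :=
  ⟨0, le_rfl, fun _ => WBd.zero_Lp.mono (by simp)⟩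

lemma UBdL.sum {J : Type*} (t : Finset J) {f : J → ι → L1Space d n}
    (hf : ∀ j ∈ t, UBdL s R (f j) b) : UBdL s R (fun i => ∑ j ∈ t, f j i) b := by
  classical
  induction t using Finset.induction_on with
  | empty => simpa using UBdL.zero
  | insert j t hj ih =>
    simp only [Finset.sum_insert hj]
    exact (hf j (by simp)).add (ih fun i hi => hf i (by simp [hi]))

lemma UBdL.clm (hf : UBdL s R f b) (L : CVec n →L[ℂ] CVec n) :
    UBdL s R (fun i => L.compLp (f i)) b := by
  obtain ⟨C, hC, h⟩ := hf
  exact ⟨‖L‖ * C, by positivity, fun i => ((h i).clm_Lp L).mono (le_of_eq (by ring))⟩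

lemma UBdL.op (hf : UBdL s R f b) {m : ι → Mult d n} {c : ℝ} (hm : ∀ i k, ‖(m i).toFun k‖ ≤ c) :
    UBdL s R (fun i => (m i).op (f i)) b := by
  obtain ⟨C, hC, h⟩ := hf
  refine ⟨|c| * C, by positivity, fun i => ((h i).op (m i) (C := |c|) ?_).mono
    (le_of_eq (by ring))⟩
  exact fun k => (hm i k).trans (le_abs_self c)

lemma UBdL.reflConj (hf : UBdL s R f b) : UBdL s R (fun i => reflConj (f i)) b := by
  obtain ⟨C, hC, h⟩ := hf
  exact ⟨C, hC, fun i => (h i).reflConj⟩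

lemma UBdL.tri (T : Tri n) (hf : UBdL s R f b₁) (hg : UBdL s (fun _ => ⊤) g b₂)
    (hh : UBdL s (fun _ => ⊤) h b₃) :
    UBdL s R (fun i => triL1 T (f i) (g i) (h i)) (fun i => b₁ i * b₂ i * b₃ i) := by
  obtain ⟨C₁, h₁, hf⟩ := hf
  obtain ⟨C₂, h₂, hg⟩ := hg
  obtain ⟨C₃, h₃, hh⟩ := hh
  have := triC_nonneg T
  exact ⟨triC T * C₁ * C₂ * C₃, by positivity,
    fun i => ((hf i).triL1_left T s _ (hg i) (hh i)).mono (le_of_eq (by ring))⟩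

lemma UBdL.tri_mid (T : Tri n) (hf : UBdL s (fun _ => ⊤) f b₁) (hg : UBdL s R g b₂)
    (hh : UBdL s (fun _ => ⊤) h b₃) :
    UBdL s R (fun i => triL1 T (f i) (g i) (h i)) (fun i => b₁ i * b₂ i * b₃ i) := by
  obtain ⟨C₁, h₁, hf⟩ := hf
  obtain ⟨C₂, h₂, hg⟩ := hg
  obtain ⟨C₃, h₃, hh⟩ := hh
  have := triC_nonneg T
  exact ⟨triC T * C₁ * C₂ * C₃, by positivity,
    fun i => ((hf i).triL1_mid T s _ (hg i) (hh i)).mono (le_of_eq (by ring))⟩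

lemma UBdL.tri_right (T : Tri n) (hf : UBdL s (fun _ => ⊤) f b₁) (hg : UBdL s (fun _ => ⊤) g b₂)
    (hh : UBdL s R h b₃) :
    UBdL s R (fun i => triL1 T (f i) (g i) (h i)) (fun i => b₁ i * b₂ i * b₃ i) := by
  obtain ⟨C₁, h₁, hf⟩ := hf
  obtain ⟨C₂, h₂, hg⟩ := hg
  obtain ⟨C₃, h₃, hh⟩ := hh
  have := triC_nonneg T
  exact ⟨triC T * C₁ * C₂ * C₃, by positivity,
    fun i => ((hf i).triL1_right T s _ (hg i) (hh i)).mono (le_of_eq (by ring))⟩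

end Uniform

/-! ### A uniform Gronwall estimate -/

section Gronwall
variable {d n : ℕ}

lemma SlopeLE.sum {ι : Type*} (J : Finset ι) {f : ι → ℝ → ℝ} {c : ι → ℝ} {t : ℝ}
    (h : ∀ j ∈ J, SlopeLE (f j) t (c j)) :
    SlopeLE (fun z => ∑ j ∈ J, f j z) t (∑ j ∈ J, c j) := by
  classical
  induction J using Finset.induction_on with
  | empty => intro r hr; simpa using hr
  | insert j J hj ih =>
    simp only [Finset.sum_insert hj]
    exact (h j (by simp)).add (ih fun i hi => h i (by simp [hi]))

lemma wN_nonneg (w : RVec d → ℝ≥0∞) (f : RVec d → CVec n) : 0 ≤ wN w f := ENNReal.toReal_nonneg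

lemma WBd.wN_le {w : RVec d → ℝ≥0∞} {f : RVec d → CVec n} {c : ℝ} (h : WBd w f c) :
    wN w f ≤ c := h.toReal_le

/-- A point of a time interval and a truncation height. -/
structure TimePt (ι : Type*) (τ : ι → ℝ) where
  idx : ι
  t : ℝ
  mem : t ∈ Set.Icc 0 (τ idx)
  R : ℝ≥0
  one_le : 1 ≤ R

/-- A residual `ε (y + δ)`, with `y` the sum of the norms to be estimated, adds a multiple of `δ`
over times up to `θ/ε`: the factor `ε` cancels the length of the interval. The residual is needed in
truncated norms only, uniformly in the level, so that `y` is finite and continuous. -/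
lemma uniform_gronwall (S : FriedrichsSystem d n) (κ : RVec d) (ω θ : ℝ) {ι : Type*}
    (J : Finset ℤ) (s : ℕ) {ε τ δ : ι → ℝ} (hε : ∀ a, 0 < ε a) (hτ : ∀ a, ε a * τ a ≤ θ)
    (hδ : ∀ a, 0 ≤ δ a) (q q' : ℤ → ι → ℝ → L1Space d n)
    (hq : ∀ j ∈ J, ∀ a, ∀ t ∈ Set.Icc 0 (τ a),
      HasDerivWithinAt (q j a) (q' j a t) (Set.Icc 0 (τ a)) t)
    (h0 : ∀ j ∈ J, UBdL s (fun _ => ⊤) (fun a => q j a 0) δ)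
    (hres : ∀ j ∈ J, UBd s (fun i : TimePt ι τ => i.R)
      (fun i k => q' j i.idx i.t k + (Complex.I / (ε i.idx : ℂ)) •
        S.opD (j * ω) ((j : ℝ) • κ + ε i.idx • k) (q j i.idx i.t k))
      (fun i => ε i.idx * (∑ l ∈ J, wN (wt s i.R) (q l i.idx i.t) + δ i.idx))) :
    ∀ j ∈ J, UBdL s (fun _ : TimePt ι τ => ⊤) (fun i => q j i.idx i.t) (fun i => δ i.idx) := by
  choose! C₀ hC₀ h0 using h0
  choose! C₁ hC₁ hres using hres
  set D₀ := ∑ j ∈ J, C₀ j with hD₀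
  set D₁ := ∑ j ∈ J, C₁ j with hD₁
  have hD₀' : 0 ≤ D₀ := Finset.sum_nonneg hC₀
  have hD₁' : 0 ≤ D₁ := Finset.sum_nonneg hC₁
  have key : ∀ a, ∀ R : ℝ≥0, 1 ≤ R → ∀ t ∈ Set.Icc 0 (τ a),
      ∑ l ∈ J, wN (wt s R) (q l a t) ≤ (D₀ + D₁ * |θ|) * Real.exp (D₁ * |θ|) * δ a := by
    intro a R hR t ht
    have hR' : (1 : ℝ≥0∞) ≤ R := by exact_mod_cast hR
    set f : ℝ → ℝ := fun t => ∑ l ∈ J, wN (wt s R) (q l a t) with hf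
    have hfc : ContinuousOn f (Set.Icc 0 (τ a)) := by
      refine continuousOn_finsetSum _ fun l hl => ?_
      exact (continuous_wN (measurable_wt s R) (wt_le s R)).comp_continuousOn
        fun t ht => (hq l hl a t ht).continuousWithinAt
    have hf0 : f 0 ≤ D₀ * δ a := by
      rw [hD₀, Finset.sum_mul]
      exact Finset.sum_le_sum fun l hl =>
        ((h0 l hl a).weight_mono (wt_le_wt_top s R)).wN_le
    have hslope : ∀ x ∈ Set.Ico 0 (τ a),
        SlopeLE f x ((ε a * D₁) * f x + ε a * D₁ * δ a) := by
      intro x hx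
      refine (SlopeLE.sum J (c := fun j => C₁ j * (ε a * (f x + δ a))) fun j hj => ?_).mono ?_
      · exact slopeLE_of_residual S (j * ω) ((j : ℝ) • κ) (ε a) (measurable_wt s R)
          (one_le_wt s hR') (wt_le s R) (hq j hj a x ⟨hx.1, hx.2.le⟩) hx
          (hres j hj ⟨a, x, ⟨hx.1, hx.2.le⟩, R, hR⟩)
      · rw [← Finset.sum_mul, ← hD₁]
        exact le_of_eq (by ring)
    have hεt : ε a * t ≤ |θ| :=
      ((mul_le_mul_of_nonneg_left ht.2 (hε a).le).trans (hτ a)).trans (le_abs_self θ)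
    have he := (hε a).le
    have hd := hδ a
    refine (gronwall_of_slopeLE hfc (by positivity) (by positivity) hf0 hslope t ht).trans ?_
    calc (D₀ * δ a + ε a * D₁ * δ a * t) * Real.exp (ε a * D₁ * t)
        = (D₀ + D₁ * (ε a * t)) * Real.exp (D₁ * (ε a * t)) * δ a := by
          rw [show ε a * D₁ * t = D₁ * (ε a * t) by ring]; ring
      _ ≤ _ := by
          have : 0 ≤ D₁ * (ε a * t) := mul_nonneg hD₁' (mul_nonneg he ht.1)
          gcongr
  intro j hj
  refine ⟨(D₀ + D₁ * |θ|) * Real.exp (D₁ * |θ|), by positivity, fun i => ?_⟩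
  refine WBd.of_truncated (Lp.aestronglyMeasurable _) fun R hR => ?_
  refine (WBd.wN_Lp (wt_le s R) _).mono (le_trans ?_ (key i.idx R hR i.t i.mem))
  exact Finset.single_le_sum (f := fun l => wN (wt s R) (q l i.idx i.t))
    (fun l _ => wN_nonneg _ _) hj

end Gronwall

end

noncomputable section

set_option linter.unusedSectionVars false

open scoped ENNReal NNReal Topology

/-! ### Spectral data and admissible solutions -/

/-- The spectral information that enters the estimates: the spectral projections `P θ` onto the
critical eigenspace of `𝓛(ω, κ + θ)`, its eigenvalue, the spectral decomposition of `𝓛(ω, κ)`, and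
solution operators. -/
structure WaveData {d n : ℕ} (S : FriedrichsSystem d n) (κ : RVec d) (ω : ℝ) where
  P : RVec d → CVec n →L[ℂ] CVec n
  lam : RVec d → ℝ
  C : ℝ
  C_nonneg : 0 ≤ C
  meas_P : StronglyMeasurable P
  meas_lam : Measurable lam
  norm_P_le : ∀ θ, ‖P θ‖ ≤ 1
  opD_P : ∀ θ v, S.opD ((1 : ℤ) * ω) (((1 : ℤ) : ℝ) • κ + θ) (P θ v) = (lam θ : ℂ) • P θ v
  P_opD : ∀ θ v, P θ (S.opD ((1 : ℤ) * ω) (((1 : ℤ) : ℝ) • κ + θ) v) = (lam θ : ℂ) • P θ v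
  abs_lam_le : ∀ θ, |lam θ| ≤ C * ‖θ‖
  norm_P_sub_le : ∀ θ, ‖P θ - P 0‖ ≤ C * ‖θ‖
  inv₁ : CVec n →L[ℂ] CVec n
  opD_inv₁ : ∀ v, S.opD ((1 : ℤ) * ω) (((1 : ℤ) : ℝ) • κ) (inv₁ v) = v - P 0 v
  inv₃ : CVec n →L[ℂ] CVec n
  opD_inv₃ : ∀ v, S.opD ((3 : ℤ) * ω) (((3 : ℤ) : ℝ) • κ) (inv₃ v) = v
  proj : Fin n → CVec n →L[ℂ] CVec n
  ev : Fin n → ℝ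
  sum_proj : ∀ v, ∑ l, proj l v = v
  proj_opD : ∀ l v, proj l (S.opD ((1 : ℤ) * ω) (((1 : ℤ) : ℝ) • κ) v) = (ev l : ℂ) • proj l v
  inv : Fin n → CVec n →L[ℂ] CVec n
  opD_inv : ∀ l v, S.opD ((3 : ℤ) * ω) (((3 : ℤ) : ℝ) • κ) (inv l v) = v + (ev l : ℂ) • inv l v

/-- The identity as a multiplier. -/
def Mult.one (d n : ℕ) : Mult d n where
  toFun _ := ContinuousLinearMap.id ℂ (CVec n)
  meas := stronglyMeasurable_const
  bound := ⟨_, fun _ => le_rfl⟩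

lemma Mult.one_op {d n : ℕ} (f : L1Space d n) : (Mult.one d n).op f = f :=
  Lp.ext ((Mult.one d n).coeFn_op f)

section Wave
variable {d n : ℕ} {S : FriedrichsSystem d n} {κ : RVec d} {ω : ℝ}

/-- The multiplier `𝒫_ε`. -/
def WaveData.projE (D : WaveData S κ ω) (ε : ℝ) : Mult d n where
  toFun k := D.P (ε • k)
  meas := D.meas_P.comp_measurable (measurable_const_smul ε)
  bound := ⟨1, fun _ => D.norm_P_le _⟩

/-- The multiplier `𝒫_ε^⊥`. -/
def WaveData.perpE (D : WaveData S κ ω) (ε : ℝ) : Mult d n where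
  toFun k := ContinuousLinearMap.id ℂ (CVec n) - D.P (ε • k)
  meas := stronglyMeasurable_const.sub (D.meas_P.comp_measurable (measurable_const_smul ε))
  bound := ⟨‖ContinuousLinearMap.id ℂ (CVec n)‖ + 1, fun _ => (norm_sub_le _ _).trans (by
    gcongr; exact D.norm_P_le _)⟩

lemma WaveData.norm_perpE_le (D : WaveData S κ ω) (ε : ℝ) (k : RVec d) :
    ‖(D.perpE ε).toFun k‖ ≤ 2 :=
  (norm_sub_le _ _).trans (by
    have h1 := ContinuousLinearMap.norm_id_le (𝕜 := ℂ) (E := CVec n)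
    have h2 := D.norm_P_le (ε • k)
    linarith)

lemma WaveData.sub_projE (D : WaveData S κ ω) (ε : ℝ) (f : L1Space d n) :
    f - (D.projE ε).op f = (D.perpE ε).op f := by
  refine Lp.ext ?_
  filter_upwards [Lp.coeFn_sub f ((D.projE ε).op f), (D.projE ε).coeFn_op f,
    (D.perpE ε).coeFn_op f] with k h1 h2 h3
  rw [h1, h3, Pi.sub_apply, h2]
  rfl

lemma WaveData.perpE_opD (D : WaveData S κ ω) (ε : ℝ) (k : RVec d) (v : CVec n) :
    (D.perpE ε).toFun k (S.opD ((1 : ℤ) * ω) (((1 : ℤ) : ℝ) • κ + ε • k) v)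
      = S.opD ((1 : ℤ) * ω) (((1 : ℤ) : ℝ) • κ + ε • k) ((D.perpE ε).toFun k v) := by
  simp only [perpE, _root_.sub_apply, ContinuousLinearMap.id_apply, map_sub, D.opD_P, D.P_opD]

/-- A solution of the system whose coefficient functions are bounded by `K` in the strongest
weighted norm, with polarized initial data. -/
structure Admissible (D : WaveData S κ ω) (K θ : ℝ) where
  ε : ℝ
  τ : ℝ
  U : ℤ → ℝ → L1Space d n
  V : ℤ → ℝ → L1Space d n
  pos : 0 < ε
  nonneg : 0 ≤ τ
  le_one : ε ≤ 1
  le_theta : ε * τ ≤ θ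
  sys : ModeSystem S κ ω ε τ U V
  bd : ∀ t ∈ Set.Icc 0 τ, ∀ j ∈ posModes, WBd (wt 3 ⊤) (U j t) K
  init_one : WBd (wt 2 ⊤) ((D.perpE ε).op (U 1 0)) (K * ε)
  init_three : U 3 0 = 0

/-- This is the normal form computation. As `(i/ε)(i ε²) = -ε` and `𝓛(α, β) B = m₀`, the correction
`i ε² B F` produces `-ε m₀ F`, which cancels `ε m F` up to the change of the multiplier between `εk`
and `0`. The remaining terms are the time derivative of the correction and the part `ε A(k)` of
`𝓛(α, β + εk)`. -/
lemma residual_eq {ε α : ℝ} (hε : ε ≠ 0) {β : RVec d} {U V N F F' : L1Space d n} {m : Mult d n}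
    {m₀ B : CVec n →L[ℂ] CVec n}
    (hV : V =ᵐ[volume] fun k => -(Complex.I / (ε : ℂ)) • S.opD α (β + ε • k) (U k)
      + (ε : ℂ) • N k)
    (hm : ∀ k v, m.toFun k (S.opD α (β + ε • k) v) = S.opD α (β + ε • k) (m.toFun k v))
    (hB : ∀ v, S.opD α β (B v) = m₀ v) :
    (fun k => ((ε : ℂ) • m.op (N - F) : L1Space d n) k
      + ((((Complex.I * (ε : ℂ) ^ 2) • B.compLp F' : L1Space d n) k
        + (ε : ℂ) • (m.toFun k (F k) - m₀ (F k))) + -((ε : ℂ) ^ 2 • S.symA k (B (F k)))))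
    =ᵐ[volume] fun k => (m.op V + (Complex.I * (ε : ℂ) ^ 2) • B.compLp F' : L1Space d n) k
      + (Complex.I / (ε : ℂ)) • S.opD α (β + ε • k)
        ((m.op U + (Complex.I * (ε : ℂ) ^ 2) • B.compLp F : L1Space d n) k) := by
  filter_upwards [hV, m.coeFn_op V, m.coeFn_op U, m.coeFn_op (N - F), Lp.coeFn_sub N F,
    B.coeFn_compLp F, Lp.coeFn_smul (ε : ℂ) (m.op (N - F)),
    Lp.coeFn_smul (Complex.I * (ε : ℂ) ^ 2) (B.compLp F),
    Lp.coeFn_add (m.op V) ((Complex.I * (ε : ℂ) ^ 2) • B.compLp F'),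
    Lp.coeFn_add (m.op U) ((Complex.I * (ε : ℂ) ^ 2) • B.compLp F)]
    with k h1 h2 h3 h4 h5 h6 h7 h8 h9 h10
  have hε' : (ε : ℂ) ≠ 0 := by exact_mod_cast hε
  have hH : S.opD α (β + ε • k) (B (F k)) = m₀ (F k) + (ε : ℂ) • S.symA k (B (F k)) := by
    rw [S.opD_add, S.symA_smul, _root_.add_apply, hB, _root_.smul_apply]
  rw [h7, h9, h10, Pi.smul_apply, Pi.add_apply, Pi.add_apply, h2, h3, h4, h5, h8, Pi.smul_apply, h6,
    h1, Pi.sub_apply]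
  simp only [map_add, map_smul, map_sub, hm, hH]
  have e1 : (Complex.I / (ε : ℂ)) * (Complex.I * (ε : ℂ) ^ 2) = -(ε : ℂ) := by
    field_simp
    linear_combination Complex.I_sq
  have e2 : ∀ a b : CVec n, (Complex.I / (ε : ℂ)) • (a + (Complex.I * (ε : ℂ) ^ 2) • b)
      = (Complex.I / (ε : ℂ)) • a - (ε : ℂ) • b := by
    intro a b
    rw [smul_add, smul_smul, e1, neg_smul, sub_eq_add_neg]
  rw [e2]
  module

end Wave

/-! ### Uniform bounds for the nonlinearity, its derivative and its differences. -/

section UniformNonlin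
variable {d n : ℕ} {ι : Type*} {s : ℕ} {R : ι → ℝ≥0∞} {b : ι → ℝ} {T : Tri n}
  {W W' : ι → ℤ → L1Space d n}

lemma UBdL.of_eq {f g : ι → L1Space d n} {b b' : ι → ℝ} (h : UBdL s R f b)
    (hfg : ∀ i, f i = g i) (hb : ∀ i, b i = b' i) : UBdL s R g b' := by
  rwa [← funext hfg, ← funext hb]

lemma UBdL.comp {ι' : Type*} {f : ι → L1Space d n} (h : UBdL s R f b) (φ : ι' → ι) :
    UBdL s (fun i => R (φ i)) (fun i => f (φ i)) (fun i => b (φ i)) := by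
  obtain ⟨C, hC, h⟩ := h
  exact ⟨C, hC, fun i => h (φ i)⟩

lemma UBdL.weight_le {s' : ℕ} {f : ι → L1Space d n} (hf : UBdL s' (fun _ => ⊤) f b)
    (hs : s ≤ s') : UBdL s R f b :=
  UBd.weight_le hf hs

lemma UBdL.mono_one {b' : ι → ℝ} {f : ι → L1Space d n} (h : UBdL s R f b)
    (hb : ∀ i, b i ≤ b' i) : UBdL s R f b' :=
  UBd.mono_one h hb

lemma UBdL.of_posModes (hW : ∀ i, ∀ j ∈ posModes, W i (-j) = _root_.reflConj (W i j))
    (h : ∀ j ∈ posModes, UBdL s R (fun i => W i j) b) :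
    ∀ j ∈ modes, UBdL s R (fun i => W i j) b := by
  intro j hj
  rcases modes_cases hj with hp | ⟨hp, -⟩
  · exact h j hp
  · refine (h _ hp).reflConj.of_eq (fun i => ?_) fun i => rfl
    rw [← hW i _ hp, neg_neg]

lemma UBdL.of_nonlin (h : ∀ j ∈ modes, UBdL s (fun _ => ⊤) (fun i => W i j) (fun _ => 1)) (j : ℤ) :
    UBdL s (fun _ => ⊤) (fun i => nonlin T (W i) j) (fun _ => 1) := by
  refine UBdL.sum _ fun J hJ => ?_
  obtain ⟨h1, h2, h3⟩ := triads_modes hJ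
  exact ((h _ h1).tri T (h _ h2) (h _ h3)).of_eq (fun _ => rfl) (by simp)

lemma UBdL.of_nonlinD (h : ∀ j ∈ modes, UBdL s (fun _ => ⊤) (fun i => W i j) (fun _ => 1))
    (h' : ∀ j ∈ modes, UBdL s (fun _ => ⊤) (fun i => W' i j) b) (j : ℤ) :
    UBdL s (fun _ => ⊤) (fun i => nonlinD T (W i) (W' i) j) b := by
  refine UBdL.sum _ fun J hJ => ?_
  obtain ⟨h1, h2, h3⟩ := triads_modes hJ
  exact ((((h' _ h1).tri T (h _ h2) (h _ h3)).of_eq (fun _ => rfl) (by simp)).add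
    (((h _ h1).tri T (h' _ h2) (h _ h3)).of_eq (fun _ => rfl) (by simp))).add
    (((h _ h1).tri T (h _ h2) (h' _ h3)).of_eq (fun _ => rfl) (by simp))

/-- Telescoping, one slot at a time; only the differences carry the truncated weight. -/
lemma UBdL.tri_sub {f f' g g' h h' : ι → L1Space d n}
    (hg : UBdL s (fun _ => ⊤) g (fun _ => 1)) (hh : UBdL s (fun _ => ⊤) h (fun _ => 1))
    (hf' : UBdL s (fun _ => ⊤) f' (fun _ => 1)) (hg' : UBdL s (fun _ => ⊤) g' (fun _ => 1))
    (h1 : UBdL s R (fun i => f i - f' i) b) (h2 : UBdL s R (fun i => g i - g' i) b)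
    (h3 : UBdL s R (fun i => h i - h' i) b) :
    UBdL s R (fun i => triL1 T (f i) (g i) (h i) - triL1 T (f' i) (g' i) (h' i)) b := by
  refine UBdL.of_eq ((((h1.tri T hg hh).of_eq (fun _ => rfl) (by simp)).add
    ((hf'.tri_mid T h2 hh).of_eq (fun _ => rfl) (by simp))).add
    ((hf'.tri_right T hg' h3).of_eq (fun _ => rfl) (by simp))) (fun i => ?_) fun i => rfl
  rw [triL1_sub₁, triL1_sub₂, triL1_sub₃]
  abel

lemma UBdL.sub_nonlin (h : ∀ j ∈ modes, UBdL s (fun _ => ⊤) (fun i => W i j) (fun _ => 1))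
    (h' : ∀ j ∈ modes, UBdL s (fun _ => ⊤) (fun i => W' i j) (fun _ => 1))
    (hs : ∀ j ∈ modes, UBdL s R (fun i => W i j - W' i j) b) (j : ℤ) :
    UBdL s R (fun i => _root_.nonlin T (W i) j - _root_.nonlin T (W' i) j) b := by
  simp only [_root_.nonlin, ← Finset.sum_sub_distrib]
  refine UBdL.sum _ fun J hJ => ?_
  obtain ⟨h1, h2, h3⟩ := triads_modes hJ
  exact UBdL.tri_sub (h _ h2) (h _ h3) (h' _ h1) (h' _ h2) (hs _ h1) (hs _ h2) (hs _ h3)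

end UniformNonlin

/-! ### The polarized part -/

section Polarized
variable {d n : ℕ} {S : FriedrichsSystem d n} {κ : RVec d} {ω K θ : ℝ} {D : WaveData S κ ω}

/-- The coefficient functions obtained by applying `m` to the first one and discarding the
third one. -/
def firstOnly (m : Mult d n) (W : ℤ → ℝ → L1Space d n) (j : ℤ) (t : ℝ) : L1Space d n :=
  if j = 1 then m.op (W 1 t) else if j = -1 then reflConj (m.op (W 1 t)) else 0

lemma firstOnly_one (m : Mult d n) (W : ℤ → ℝ → L1Space d n) (t : ℝ) :
    firstOnly m W 1 t = m.op (W 1 t) := by simp [firstOnly]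

lemma firstOnly_three (m : Mult d n) (W : ℤ → ℝ → L1Space d n) (t : ℝ) :
    firstOnly m W 3 t = 0 := by simp [firstOnly]

lemma firstOnly_neg (m : Mult d n) (W : ℤ → ℝ → L1Space d n) (t : ℝ) :
    ∀ j ∈ posModes, firstOnly m W (-j) t = reflConj (firstOnly m W j t) :=
  posModes_forall (by simp [firstOnly]) (by simp [firstOnly])

lemma hasDerivWithinAt_firstOnly (m : Mult d n) {W W' : ℤ → ℝ → L1Space d n} {I : Set ℝ} {t : ℝ}
    (h : HasDerivWithinAt (W 1) (W' 1 t) I t) (j : ℤ) :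
    HasDerivWithinAt (firstOnly m W j) (firstOnly m W' j t) I t := by
  have h1 : HasDerivWithinAt (fun t => m.op (W 1 t)) (m.op (W' 1 t)) I t :=
    (m.op.restrictScalars ℝ).hasFDerivAt.comp_hasDerivWithinAt t h
  by_cases e1 : j = 1
  · subst e1
    have e : firstOnly m W 1 = fun t => m.op (W 1 t) := funext (firstOnly_one m W)
    rw [e, firstOnly_one]
    exact h1
  by_cases e2 : j = -1
  · subst e2
    have e : ∀ W : ℤ → ℝ → L1Space d n, firstOnly m W (-1) = fun t => reflConj (m.op (W 1 t)) := by
      intro W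
      funext t
      simp [firstOnly]
    rw [e, e]
    exact (reflConj (d := d) (n := n)).hasFDerivAt.comp_hasDerivWithinAt t h1
  · have : firstOnly m W j = fun _ => 0 := by funext t; simp [firstOnly, e1, e2]
    rw [this]
    simpa [firstOnly, e1, e2] using hasDerivWithinAt_const t I (0 : L1Space d n)

namespace Admissible

/-- The points at which a uniform estimate of admissible solutions has to hold. -/
abbrev Pt (D : WaveData S κ ω) (K θ : ℝ) := TimePt (Admissible D K θ) (fun a => a.τ)

/-- The polarized part `p`. -/
def p (a : Admissible D K θ) : ℤ → ℝ → L1Space d n := firstOnly (D.projE a.ε) a.U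

/-- The derivative of the polarized part. -/
def p' (a : Admissible D K θ) : ℤ → ℝ → L1Space d n := firstOnly (D.projE a.ε) a.V

/-- The nonlinearity. -/
def N (a : Admissible D K θ) (j : ℤ) (t : ℝ) : L1Space d n := nonlin S.TcF (fun i => a.U i t) j

/-- The nonlinearity evaluated at the polarized part. -/
def F (a : Admissible D K θ) (j : ℤ) (t : ℝ) : L1Space d n := nonlin S.TcF (fun i => a.p i t) j

/-- The derivative of `F`. -/
def F' (a : Admissible D K θ) (j : ℤ) (t : ℝ) : L1Space d n :=
  nonlinD S.TcF (fun i => a.p i t) (fun i => a.p' i t) j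

/-- The unpolarized part of the first coefficient function. -/
def perp (a : Admissible D K θ) (t : ℝ) : L1Space d n := (D.perpE a.ε).op (a.U 1 t)

lemma ubd_U (hK : 0 ≤ K) : ∀ j ∈ modes,
    UBdL 3 (fun _ => ⊤) (fun i : Pt D K θ => i.idx.U j i.t) (fun _ => 1) := by
  have h : ∀ j ∈ posModes,
      UBdL 3 (fun _ => ⊤) (fun i : Pt D K θ => i.idx.U j i.t) (fun _ => 1) := by
    intro j hj
    refine ⟨K, hK, fun i => ?_⟩
    rw [mul_one]
    exact i.idx.bd i.t i.mem j hj
  have h' : ∀ i : Pt D K θ, ∀ j ∈ posModes, i.idx.U (-j) i.t = reflConj (i.idx.U j i.t) :=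
    fun i j hj => i.idx.sys.conj j hj i.t
  exact UBdL.of_posModes (W := fun (i : Pt D K θ) j => i.idx.U j i.t) h' h

lemma ubd_N (hK : 0 ≤ K) (j : ℤ) :
    UBdL 3 (fun _ => ⊤) (fun i : Pt D K θ => i.idx.N j i.t) (fun _ => 1) :=
  UBdL.of_nonlin (W := fun (i : Pt D K θ) j => i.idx.U j i.t) (ubd_U hK) j

lemma one_mem_modes : (1 : ℤ) ∈ modes := by simp [modes]
lemma three_mem_modes : (3 : ℤ) ∈ modes := by simp [modes]

lemma ubd_p (hK : 0 ≤ K) : ∀ j ∈ modes,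
    UBdL 3 (fun _ => ⊤) (fun i : Pt D K θ => i.idx.p j i.t) (fun _ => 1) := by
  have h : ∀ j ∈ posModes,
      UBdL 3 (fun _ => ⊤) (fun i : Pt D K θ => i.idx.p j i.t) (fun _ => 1) := by
    refine posModes_forall ?_ ?_
    · simp only [p, firstOnly_one]
      exact (ubd_U hK 1 one_mem_modes).op (m := fun i => D.projE i.idx.ε) (c := 1)
        fun i k => D.norm_P_le _
    · simp only [p, firstOnly_three]
      exact UBdL.zero
  have h' : ∀ i : Pt D K θ, ∀ j ∈ posModes, i.idx.p (-j) i.t = reflConj (i.idx.p j i.t) :=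
    fun i j hj => firstOnly_neg _ _ _ j hj
  exact UBdL.of_posModes (W := fun (i : Pt D K θ) j => i.idx.p j i.t) h' h

lemma ubd_F (hK : 0 ≤ K) (j : ℤ) :
    UBdL 3 (fun _ => ⊤) (fun i : Pt D K θ => i.idx.F j i.t) (fun _ => 1) :=
  UBdL.of_nonlin (W := fun (i : Pt D K θ) j => i.idx.p j i.t) (ubd_p hK) j

/-- `𝒫_ε` projects onto an eigenspace, so it turns the matrix into the scalar `λ(εk)`, whose
vanishing at `0` compensates the factor `1/ε`. -/
lemma projE_V (a : Admissible D K θ) {t : ℝ} (ht : t ∈ Set.Icc 0 a.τ) :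
    (D.projE a.ε).op (a.V 1 t) =ᵐ[volume] fun k =>
      ((-(Complex.I / (a.ε : ℂ)) * (D.lam (a.ε • k) : ℂ)) • D.P (a.ε • k) (a.U 1 t k))
        + (a.ε : ℂ) • D.P (a.ε • k) (a.N 1 t k) := by
  filter_upwards [(D.projE a.ε).coeFn_op (a.V 1 t), a.sys.eqn 1 one_mem_posModes t ht]
    with k h1 h2
  rw [h1, h2]
  simp only [WaveData.projE, map_add, map_smul, D.P_opD, smul_smul, N]

lemma norm_projE_V_le (a : Admissible D K θ) (k : RVec d) :
    ‖-(Complex.I / (a.ε : ℂ)) * (D.lam (a.ε • k) : ℂ)‖ ≤ D.C * ‖k‖ := by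
  have h := D.abs_lam_le (a.ε • k)
  have hε := a.pos
  rw [norm_smul, Real.norm_of_nonneg hε.le] at h
  rw [norm_mul, norm_neg, norm_div, Complex.norm_I, Complex.norm_of_nonneg hε.le,
    Complex.norm_real, Real.norm_eq_abs, one_div, inv_mul_le_iff₀ hε]
  linarith

/-- The polarized part is slow: its time derivative is bounded uniformly in `ε`, at the price of one
power of the weight, while the derivative of a full mode is only bounded by a multiple of `1/ε`
(`ubd_V`). -/
lemma ubd_p' (hK : 0 ≤ K) : ∀ j ∈ modes,
    UBdL 2 (fun _ => ⊤) (fun i : Pt D K θ => i.idx.p' j i.t) (fun _ => 1) := by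
  have h' : ∀ i : Pt D K θ, ∀ j ∈ posModes, i.idx.p' (-j) i.t = reflConj (i.idx.p' j i.t) :=
    fun i j hj => firstOnly_neg _ _ _ j hj
  refine UBdL.of_posModes (W := fun (i : Pt D K θ) j => i.idx.p' j i.t) h' (posModes_forall ?_ ?_)
  swap
  · simp only [p', firstOnly_three]
    exact UBdL.zero
  simp only [p', firstOnly_one]
  refine UBd.congr ?_ fun i => (i.idx.projE_V i.mem).symm
  have h1 : UBd 2 (fun _ => ⊤) (fun (i : Pt D K θ) k =>
      ((-(Complex.I / (i.idx.ε : ℂ)) * (D.lam (i.idx.ε • k) : ℂ)) •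
        D.P (i.idx.ε • k) (i.idx.U 1 i.t k))) (fun _ => 1) := by
    refine (UBd.of_norm_le_norm_mul (ubd_U hK 1 one_mem_modes) (c := fun _ => D.C)
      (fun _ => D.C_nonneg) fun i => .of_forall fun k => ?_).mono D.C_nonneg fun i => le_rfl
    rw [norm_smul]
    have h2 := (D.P (i.idx.ε • k)).le_of_opNorm_le (D.norm_P_le _) (i.idx.U 1 i.t k)
    rw [one_mul] at h2
    have hC := D.C_nonneg
    exact mul_le_mul (i.idx.norm_projE_V_le k) h2 (norm_nonneg _) (by positivity)
  have h3 : UBd 2 (fun _ => ⊤) (fun (i : Pt D K θ) k =>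
      (i.idx.ε : ℂ) • D.P (i.idx.ε • k) (i.idx.N 1 i.t k)) (fun _ => 1) := by
    refine (UBd.of_norm_le ((ubd_N hK 1).weight_le (by norm_num : 2 ≤ 3)) (c := fun _ => 1)
      (fun _ => zero_le_one) fun i => .of_forall fun k => ?_).mono zero_le_one fun i => le_rfl
    rw [norm_smul, Complex.norm_of_nonneg i.idx.pos.le]
    have h2 := (D.P (i.idx.ε • k)).le_of_opNorm_le (D.norm_P_le _) (i.idx.N 1 i.t k)
    rw [one_mul] at h2
    exact mul_le_mul i.idx.le_one h2 (norm_nonneg _) zero_le_one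
  refine h1.add h3 fun i => ?_
  have hl : StronglyMeasurable fun k : RVec d =>
      -(Complex.I / (i.idx.ε : ℂ)) * (D.lam (i.idx.ε • k) : ℂ) := by
    have := D.meas_lam
    exact Measurable.stronglyMeasurable (by fun_prop)
  have hP : AEStronglyMeasurable (fun k => D.P (i.idx.ε • k) (i.idx.U 1 i.t k)) volume :=
    (isBoundedBilinearMap_apply (𝕜 := ℂ)).continuous.comp_aestronglyMeasurable
      ((D.projE i.idx.ε).meas.aestronglyMeasurable.prodMk (Lp.aestronglyMeasurable (i.idx.U 1 i.t)))
  exact hl.aestronglyMeasurable.smul hP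

lemma ubd_F' (hK : 0 ≤ K) (j : ℤ) :
    UBdL 2 (fun _ => ⊤) (fun i : Pt D K θ => i.idx.F' j i.t) (fun _ => 1) :=
  UBdL.of_nonlinD (W := fun (i : Pt D K θ) j => i.idx.p j i.t) (W' := fun (i : Pt D K θ) j => i.idx.p' j i.t)
    (fun j hj => (ubd_p hK j hj).weight_le (by norm_num)) (ubd_p' hK) j

lemma hasDerivWithinAt_p (a : Admissible D K θ) {t : ℝ} (ht : t ∈ Set.Icc 0 a.τ) (j : ℤ) :
    HasDerivWithinAt (a.p j) (a.p' j t) (Set.Icc 0 a.τ) t :=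
  hasDerivWithinAt_firstOnly _ (a.sys.deriv 1 one_mem_posModes t ht) j

lemma hasDerivWithinAt_F (a : Admissible D K θ) {t : ℝ} (ht : t ∈ Set.Icc 0 a.τ) (j : ℤ) :
    HasDerivWithinAt (a.F j) (a.F' j t) (Set.Icc 0 a.τ) t :=
  hasDerivWithinAt_nonlin (fun i _ => a.hasDerivWithinAt_p ht i) j

end Admissible
end Polarized
end

noncomputable section

set_option linter.unusedSectionVars false

open scoped ENNReal NNReal Topology

/-! ### The unpolarized part and the third coefficient function are small -/

section FirstOrder
variable {d n : ℕ} {S : FriedrichsSystem d n} {κ : RVec d} {ω K θ : ℝ} {D : WaveData S κ ω}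

/-- The multiplier that removes the polarized part of the `j`-th coefficient function. -/
def WaveData.mult (D : WaveData S κ ω) (ε : ℝ) (j : ℤ) : Mult d n :=
  if j = 1 then D.perpE ε else Mult.one d n

/-- The multiplier `WaveData.mult` at `ε = 0`. -/
def WaveData.mult₀ (D : WaveData S κ ω) (j : ℤ) : CVec n →L[ℂ] CVec n :=
  if j = 1 then ContinuousLinearMap.id ℂ _ - D.P 0 else ContinuousLinearMap.id ℂ _

/-- The solution operator for `𝓛(jω, jκ)`. -/
def WaveData.solve (D : WaveData S κ ω) (j : ℤ) : CVec n →L[ℂ] CVec n :=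
  if j = 1 then D.inv₁ else D.inv₃

lemma WaveData.opD_solve (D : WaveData S κ ω) : ∀ j ∈ posModes, ∀ v,
    S.opD (j * ω) ((j : ℝ) • κ) (D.solve j v) = D.mult₀ j v :=
  posModes_forall (fun v => by simpa [solve, mult₀] using D.opD_inv₁ v)
    (fun v => by simpa [solve, mult₀] using D.opD_inv₃ v)

lemma WaveData.mult_opD (D : WaveData S κ ω) (ε : ℝ) : ∀ j ∈ posModes, ∀ k v,
    (D.mult ε j).toFun k (S.opD (j * ω) ((j : ℝ) • κ + ε • k) v)
      = S.opD (j * ω) ((j : ℝ) • κ + ε • k) ((D.mult ε j).toFun k v) :=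
  posModes_forall (fun k v => D.perpE_opD ε k v) (fun _ _ => rfl)

lemma WaveData.norm_mult_le (D : WaveData S κ ω) (ε : ℝ) : ∀ j ∈ posModes, ∀ k,
    ‖(D.mult ε j).toFun k‖ ≤ 2 :=
  posModes_forall (fun k => D.norm_perpE_le ε k)
    (fun _ => ContinuousLinearMap.norm_id_le.trans one_le_two)

lemma WaveData.norm_mult_sub_le (D : WaveData S κ ω) {ε : ℝ} (hε : 0 ≤ ε) : ∀ j ∈ posModes, ∀ k v,
    ‖(D.mult ε j).toFun k v - D.mult₀ j v‖ ≤ D.C * ε * ‖k‖ * ‖v‖ := by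
  refine posModes_forall (fun k v => ?_) (fun k v => ?_)
  · have e : (D.mult ε 1).toFun k v - D.mult₀ 1 v = -((D.P (ε • k) - D.P 0) v) := by
      change (v - D.P (ε • k) v) - (v - D.P 0 v) = -(D.P (ε • k) v - D.P 0 v)
      abel
    have h := D.norm_P_sub_le (ε • k)
    rw [norm_smul, Real.norm_of_nonneg hε, ← mul_assoc] at h
    rw [e, norm_neg]
    exact ContinuousLinearMap.le_of_opNorm_le _ h v
  · have e : (D.mult ε 3).toFun k v - D.mult₀ 3 v = 0 := by
      change v - v = 0
      exact sub_self v
    have hC := D.C_nonneg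
    rw [e, norm_zero]
    positivity

namespace Admissible

lemma mult_op_U (a : Admissible D K θ) (t : ℝ) : ∀ j ∈ posModes,
    (D.mult a.ε j).op (a.U j t) = a.U j t - a.p j t := by
  refine posModes_forall ?_ ?_
  · rw [p, firstOnly_one, D.sub_projE]
    rfl
  · rw [p, firstOnly_three, sub_zero]
    exact Mult.one_op _

/-- The correction by normal form terms of order `ε²`. -/
def corr (a : Admissible D K θ) (B : CVec n →L[ℂ] CVec n) (G : L1Space d n) : L1Space d n :=
  (Complex.I * (a.ε : ℂ) ^ 2) • B.compLp G

lemma hasDerivWithinAt_corr (a : Admissible D K θ) (B : CVec n →L[ℂ] CVec n)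
    {G : ℝ → L1Space d n} {G' : L1Space d n} {I : Set ℝ} {t : ℝ}
    (h : HasDerivWithinAt G G' I t) :
    HasDerivWithinAt (fun t => a.corr B (G t)) (a.corr B G') I t :=
  (((Complex.I * (a.ε : ℂ) ^ 2) • B.compLpL 1 (volume : Measure (RVec d))).restrictScalars
    ℝ).hasFDerivAt.comp_hasDerivWithinAt t h

/-- The transformed variables of the first normal form transformation. -/
def q (j : ℤ) (a : Admissible D K θ) (t : ℝ) : L1Space d n :=
  (D.mult a.ε j).op (a.U j t) + a.corr (D.solve j) (a.F j t)

/-- The derivative of `q`. -/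
def q' (j : ℤ) (a : Admissible D K θ) (t : ℝ) : L1Space d n :=
  (D.mult a.ε j).op (a.V j t) + a.corr (D.solve j) (a.F' j t)

lemma hasDerivWithinAt_q {j : ℤ} (hj : j ∈ posModes) (a : Admissible D K θ) {t : ℝ}
    (ht : t ∈ Set.Icc 0 a.τ) : HasDerivWithinAt (q j a) (q' j a t) (Set.Icc 0 a.τ) t := by
  have h1 : HasDerivWithinAt (fun t => (D.mult a.ε j).op (a.U j t))
      ((D.mult a.ε j).op (a.V j t)) (Set.Icc 0 a.τ) t :=
    ((D.mult a.ε j).op.restrictScalars ℝ).hasFDerivAt.comp_hasDerivWithinAt t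
      (a.sys.deriv j hj t ht)
  exact h1.add (a.hasDerivWithinAt_corr _ (a.hasDerivWithinAt_F ht j))

lemma norm_corr_factor (a : Admissible D K θ) : ‖Complex.I * (a.ε : ℂ) ^ 2‖ = a.ε ^ 2 := by
  rw [norm_mul, Complex.norm_I, one_mul, norm_pow, Complex.norm_of_nonneg a.pos.le]

lemma ubd_corr {ι : Type*} {s : ℕ} {R : ι → ℝ≥0∞} {φ : ι → Admissible D K θ} {G : ι → L1Space d n}
    {b : ι → ℝ} (hG : UBdL s R G b) (B : CVec n →L[ℂ] CVec n) :
    UBdL s R (fun i => (φ i).corr B (G i)) (fun i => (φ i).ε ^ 2 * b i) :=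
  (hG.clm B).smul fun i => (φ i).norm_corr_factor

lemma ubd_symA {ι : Type*} {s : ℕ} {R : ι → ℝ≥0∞} {f : ι → L1Space d n} {b : ι → ℝ}
    {c : ι → ℂ} {c' : ι → ℝ} (hc : ∀ i, ‖c i‖ = c' i)
    (hf : UBdL (s + 1) (fun _ => ⊤) f b) (B : CVec n →L[ℂ] CVec n) :
    UBd s R (fun i k => -(c i • S.symA k (B (f i k)))) (fun i => c' i * b i) := by
  obtain ⟨C, hC, hA⟩ := S.exists_norm_symA_le
  have h1 : UBd s R (fun i k => S.symA k (B (f i k))) b := by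
    refine (UBd.of_norm_le_norm_mul hf (c := fun _ => C * ‖B‖) (fun _ => by positivity)
      fun i => .of_forall fun k => ?_).mono (c := C * ‖B‖) (by positivity) fun i => le_rfl
    calc ‖S.symA k (B (f i k))‖ ≤ (C * ‖k‖) * ‖B (f i k)‖ :=
          ContinuousLinearMap.le_of_opNorm_le _ (hA k) _
      _ ≤ (C * ‖k‖) * (‖B‖ * ‖f i k‖) := by gcongr; exact B.le_opNorm _
      _ = _ := by ring
  refine UBd.of_norm_le h1 (fun i => by rw [← hc]; positivity) fun i => .of_forall fun k => ?_
  rw [norm_neg, norm_smul, hc]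

/-- In `residual_eq` the term with `N - F` is `ε` times a quantity linear in `U - p`, hence bounded
through `q`. The other three terms are of order `ε²`, and passing from weight 3 to weight 2 pays for
the factor `‖k‖` or for the time derivative of `F`. -/
lemma ubd_residual {j : ℤ} (hj : j ∈ posModes) (hK : 0 ≤ K) :
    UBd 2 (fun i : Pt D K θ => i.R)
      (fun i k => q' j i.idx i.t k + (Complex.I / (i.idx.ε : ℂ)) •
        S.opD (j * ω) ((j : ℝ) • κ + i.idx.ε • k) (q j i.idx i.t k))
      (fun i => i.idx.ε * (∑ l ∈ posModes, wN (wt 2 i.R) (q l i.idx i.t) + i.idx.ε)) := by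
  set y : Pt D K θ → ℝ := fun i => ∑ l ∈ posModes, wN (wt 2 i.R) (q l i.idx i.t) with hy
  have hy0 : ∀ i, 0 ≤ y i := fun i => Finset.sum_nonneg fun l _ => wN_nonneg _ _
  have hε : ∀ i : Pt D K θ, 0 ≤ i.idx.ε := fun i => i.idx.pos.le
  have hε2 : ∀ i : Pt D K θ, i.idx.ε ^ 2 ≤ i.idx.ε := fun i => by
    nlinarith [i.idx.pos, i.idx.le_one]
  -- The multiplier maps `U` to `U - p`, so `U - p` is `q` minus a correction of order `ε²`.
  have hdiff : ∀ j ∈ posModes, UBdL 2 (fun i : Pt D K θ => i.R)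
      (fun i => i.idx.U j i.t - i.idx.p j i.t) (fun i => y i + i.idx.ε) := by
    intro j hj
    have h1 : UBdL 2 (fun i : Pt D K θ => i.R) (fun i => q j i.idx i.t)
        (fun i => y i + i.idx.ε) := by
      refine ⟨1, zero_le_one, fun i => (WBd.wN_Lp (wt_le 2 i.R) _).mono ?_⟩
      have : wN (wt 2 i.R) (q j i.idx i.t) ≤ y i :=
        Finset.single_le_sum (f := fun l => wN (wt 2 i.R) (q l i.idx i.t))
          (fun l _ => wN_nonneg _ _) hj
      linarith [hε i]
    have h2 : UBdL 2 (fun i : Pt D K θ => i.R) (fun i => i.idx.corr (D.solve j) (i.idx.F j i.t))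
        (fun i => y i + i.idx.ε) :=
      (ubd_corr (φ := fun i : Pt D K θ => i.idx)
        ((ubd_F hK j).weight_le (R := fun i : Pt D K θ => i.R) (by norm_num : 2 ≤ 3))
        (D.solve j)).mono_one fun i => by linarith [hy0 i, hε2 i]
    refine (h1.sub h2).of_eq (fun i => ?_) fun i => rfl
    rw [q, add_sub_cancel_right, i.idx.mult_op_U _ j hj]
  have hdiff' : ∀ j ∈ modes, UBdL 2 (fun i : Pt D K θ => i.R)
      (fun i => i.idx.U j i.t - i.idx.p j i.t) (fun i => y i + i.idx.ε) := by
    have h : ∀ i : Pt D K θ, ∀ j ∈ posModes, i.idx.U (-j) i.t - i.idx.p (-j) i.t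
        = reflConj (i.idx.U j i.t - i.idx.p j i.t) := by
      intro i j hj
      rw [map_sub, i.idx.sys.conj j hj, p, firstOnly_neg _ _ _ j hj]
    exact UBdL.of_posModes (W := fun (i : Pt D K θ) j => i.idx.U j i.t - i.idx.p j i.t) h hdiff
  have hNF : UBdL 2 (fun i : Pt D K θ => i.R) (fun i => i.idx.N j i.t - i.idx.F j i.t)
      (fun i => y i + i.idx.ε) :=
    UBdL.sub_nonlin (W := fun (i : Pt D K θ) j => i.idx.U j i.t)
      (W' := fun (i : Pt D K θ) j => i.idx.p j i.t)
      (fun j hj => (ubd_U hK j hj).weight_le (by norm_num))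
      (fun j hj => (ubd_p hK j hj).weight_le (by norm_num)) hdiff' j
  have t1 : UBdL 2 (fun i : Pt D K θ => i.R)
      (fun i => (i.idx.ε : ℂ) • (D.mult i.idx.ε j).op (i.idx.N j i.t - i.idx.F j i.t))
      (fun i => i.idx.ε * (y i + i.idx.ε)) :=
    (hNF.op (m := fun i => D.mult i.idx.ε j) fun i k => D.norm_mult_le _ j hj k).smul
      fun i => Complex.norm_of_nonneg (hε i)
  have t2 : UBdL 2 (fun i : Pt D K θ => i.R) (fun i => i.idx.corr (D.solve j) (i.idx.F' j i.t))
      (fun i => i.idx.ε * (y i + i.idx.ε)) :=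
    (ubd_corr (φ := fun i : Pt D K θ => i.idx) ((ubd_F' hK j).weight_le
      (R := fun i : Pt D K θ => i.R) (le_refl 2)) (D.solve j)).mono_one fun i => by
        nlinarith [mul_nonneg (hε i) (hy0 i)]
  have t3 : UBd 2 (fun i : Pt D K θ => i.R)
      (fun i k => (i.idx.ε : ℂ) •
        ((D.mult i.idx.ε j).toFun k (i.idx.F j i.t k) - D.mult₀ j (i.idx.F j i.t k)))
      (fun i => i.idx.ε * (y i + i.idx.ε)) := by
    refine (UBd.of_norm_le_norm_mul (ubd_F hK j) (c := fun i => i.idx.ε * (D.C * i.idx.ε))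
      (fun i => mul_nonneg (hε i) (mul_nonneg D.C_nonneg (hε i)))
      fun i => .of_forall fun k => ?_).mono D.C_nonneg fun i => ?_
    · rw [norm_smul, Complex.norm_of_nonneg (hε i), mul_assoc, mul_assoc]
      refine mul_le_mul_of_nonneg_left ?_ (hε i)
      refine (D.norm_mult_sub_le (hε i) j hj k _).trans (le_of_eq (by ring))
    · nlinarith [mul_nonneg D.C_nonneg (mul_nonneg (hε i) (hy0 i))]
  have t4 : UBd 2 (fun i : Pt D K θ => i.R)
      (fun i k => -((i.idx.ε : ℂ) ^ 2 • S.symA k (D.solve j (i.idx.F j i.t k))))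
      (fun i => i.idx.ε * (y i + i.idx.ε)) := by
    refine (ubd_symA (c' := fun i => i.idx.ε ^ 2) (fun i => ?_) (ubd_F hK j)
      (D.solve j)).mono_one fun i => by nlinarith [mul_nonneg (hε i) (hy0 i)]
    rw [norm_pow, Complex.norm_of_nonneg (hε i)]
  have m2 : ∀ i : Pt D K θ,
      AEStronglyMeasurable (fun k => i.idx.corr (D.solve j) (i.idx.F' j i.t) k) volume :=
    fun i => Lp.aestronglyMeasurable _
  have m3 : ∀ i : Pt D K θ, AEStronglyMeasurable (fun k => (i.idx.ε : ℂ) •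
      ((D.mult i.idx.ε j).toFun k (i.idx.F j i.t k) - D.mult₀ j (i.idx.F j i.t k))) volume := by
    intro i
    have hF : AEStronglyMeasurable (fun k => i.idx.F j i.t k) volume := Lp.aestronglyMeasurable _
    have h1 : AEStronglyMeasurable (fun k => (D.mult i.idx.ε j).toFun k (i.idx.F j i.t k))
        volume :=
      (isBoundedBilinearMap_apply (𝕜 := ℂ)).continuous.comp_aestronglyMeasurable
        ((D.mult i.idx.ε j).meas.aestronglyMeasurable.prodMk hF)
    have h2 : AEStronglyMeasurable (fun k => D.mult₀ j (i.idx.F j i.t k)) volume :=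
      (D.mult₀ j).continuous.comp_aestronglyMeasurable hF
    have h3 : AEStronglyMeasurable (fun k => (D.mult i.idx.ε j).toFun k (i.idx.F j i.t k)
        - D.mult₀ j (i.idx.F j i.t k)) volume := h1.sub h2
    exact h3.const_smul (i.idx.ε : ℂ)
  have total := UBd.add t1 (UBd.add (UBd.add t2 t3 m2) t4 fun i => (m2 i).add (m3 i))
    fun i => Lp.aestronglyMeasurable _
  exact total.congr fun i => residual_eq i.idx.pos.ne' (i.idx.sys.eqn j hj i.t i.mem)
    (D.mult_opD _ j hj) (D.opD_solve j hj)

/-- The initial time as a point. -/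
def start (a : Admissible D K θ) : Pt D K θ := ⟨a, 0, ⟨le_rfl, a.nonneg⟩, 1, le_rfl⟩

/-- The unpolarized part and the third coefficient function are of order `ε`. -/
lemma ubd_diff (hK : 0 ≤ K) : ∀ j ∈ posModes, UBdL 2 (fun _ => ⊤)
    (fun i : Pt D K θ => i.idx.U j i.t - i.idx.p j i.t) (fun i => i.idx.ε) := by
  have hε2 : ∀ a : Admissible D K θ, a.ε ^ 2 * 1 ≤ a.ε := fun a => by
    nlinarith [a.pos, a.le_one]
  have hcorr : ∀ j, UBdL 2 (fun _ => ⊤)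
      (fun i : Pt D K θ => i.idx.corr (D.solve j) (i.idx.F j i.t)) (fun i => i.idx.ε) := fun j =>
    (ubd_corr (φ := fun i : Pt D K θ => i.idx) ((ubd_F hK j).weight_le
      (by norm_num : 2 ≤ 3)) (D.solve j)).mono_one fun i => hε2 i.idx
  have h0 : ∀ j ∈ posModes, UBdL 2 (fun _ => ⊤) (fun a : Admissible D K θ => q j a 0)
      (fun a => a.ε) := by
    intro j hj
    have h1 : UBdL 2 (fun _ => ⊤) (fun a : Admissible D K θ => (D.mult a.ε j).op (a.U j 0))
        (fun a => a.ε) := by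
      revert j
      refine posModes_forall ?_ ?_
      · exact ⟨K, hK, fun a => a.init_one⟩
      · refine UBdL.zero.of_eq (fun a => ?_) fun a => rfl
        rw [a.init_three, map_zero]
    exact h1.add ((hcorr j).comp start)
  have := uniform_gronwall S κ ω θ posModes 2 (ε := fun a : Admissible D K θ => a.ε)
    (τ := fun a => a.τ) (δ := fun a => a.ε) (fun a => a.pos) (fun a => a.le_theta)
    (fun a => a.pos.le) q q' (fun j hj a t ht => hasDerivWithinAt_q hj a ht) h0
    (fun j hj => ubd_residual hj hK)
  intro j hj
  refine ((this j hj).sub (hcorr j)).of_eq (fun i => ?_) fun i => rfl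
  rw [q, add_sub_cancel_right, i.idx.mult_op_U _ j hj]

end Admissible
end FirstOrder
end

noncomputable section

set_option linter.unusedSectionVars false

open scoped ENNReal NNReal Topology

/-! ### Frequency cutoff -/

section Cutoff
variable {d n : ℕ} {S : FriedrichsSystem d n} {κ : RVec d} {ω K θ : ℝ} {D : WaveData S κ ω}

open Classical in
/-- The cutoff `1_{|k| ≤ 1/ε}`. -/
def cutoff (ε : ℝ) (k : RVec d) : ℂ := if ‖k‖ ≤ 1 / ε then 1 else 0

lemma measurable_cutoff (ε : ℝ) : Measurable (cutoff ε : RVec d → ℂ) :=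
  Measurable.ite (measurableSet_le measurable_norm measurable_const) measurable_const
    measurable_const

lemma norm_cutoff_le (ε : ℝ) (k : RVec d) : ‖cutoff ε k‖ ≤ 1 := by
  unfold cutoff; split_ifs <;> simp

lemma norm_cutoff_smul_le {E : Type*} [NormedAddCommGroup E] [NormedSpace ℂ E] (ε : ℝ)
    (k : RVec d) (v : E) : ‖cutoff ε k • v‖ ≤ ‖v‖ := by
  rw [norm_smul]
  exact mul_le_of_le_one_left (norm_nonneg _) (norm_cutoff_le ε k)

lemma norm_cutoff_smul_le_of_le {E : Type*} [NormedAddCommGroup E] [NormedSpace ℂ E] {ε C : ℝ}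
    (hε : 0 < ε) (hC : 0 ≤ C) (k : RVec d) (v : E) (hv : ‖v‖ ≤ C * ‖k‖) :
    ‖cutoff ε k • v‖ ≤ C * (1 / ε) := by
  unfold cutoff
  split_ifs with h
  · rw [one_smul]
    exact hv.trans (by gcongr)
  · rw [zero_smul, norm_zero]
    positivity

/-- Where the cutoff vanishes one has `ε ‖k‖ > 1`, so powers of `ε` are bought with equal powers of
`‖k‖`. -/
lemma norm_sub_cutoff_smul_le {E : Type*} [NormedAddCommGroup E] [NormedSpace ℂ E] {ε : ℝ}
    (hε : 0 < ε) (k : RVec d) (v : E) : ‖v - cutoff ε k • v‖ ≤ ε * ‖k‖ * ‖v‖ := by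
  unfold cutoff
  split_ifs with h
  · rw [one_smul, sub_self, norm_zero]
    positivity
  · rw [zero_smul, sub_zero]
    refine le_mul_of_one_le_left (norm_nonneg _) ?_
    rw [not_le, div_lt_iff₀ hε] at h
    linarith

lemma norm_sub_cutoff_smul_le_sq {E : Type*} [NormedAddCommGroup E] [NormedSpace ℂ E] {ε : ℝ}
    (hε : 0 < ε) (k : RVec d) (v : E) : ‖v - cutoff ε k • v‖ ≤ ε ^ 2 * ‖k‖ ^ 2 * ‖v‖ := by
  unfold cutoff
  split_ifs with h
  · rw [one_smul, sub_self, norm_zero]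
    positivity
  · rw [zero_smul, sub_zero]
    refine le_mul_of_one_le_left (norm_nonneg _) ?_
    rw [not_le, div_lt_iff₀ hε] at h
    rw [← mul_pow]
    exact one_le_pow₀ (by linarith)

lemma UBd.of_norm_le_norm_sq_mul {ι : Type*} {s : ℕ} {R : ι → ℝ≥0∞} {b : ι → ℝ}
    {f g : ι → RVec d → CVec n} (hf : UBd (s + 2) (fun _ => ⊤) f b)
    {c : ι → ℝ} (hc : ∀ i, 0 ≤ c i) (hfg : ∀ i, ∀ᵐ k, ‖g i k‖ ≤ c i * ‖k‖ ^ 2 * ‖f i k‖) :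
    UBd s R g (fun i => c i * b i) := by
  have h1 : UBd (s + 1) (fun _ => ⊤) (fun i k => ((‖k‖ : ℝ) : ℂ) • f i k) b := by
    refine (UBd.of_norm_le_norm_mul hf (c := fun _ => 1) (fun _ => zero_le_one)
      fun i => .of_forall fun k => ?_).mono_one fun i => by rw [one_mul]
    rw [norm_smul, Complex.norm_real, norm_norm, one_mul]
  refine UBd.of_norm_le_norm_mul h1 hc fun i => ?_
  filter_upwards [hfg i] with k hk
  refine hk.trans (le_of_eq ?_)
  rw [norm_smul, Complex.norm_real, norm_norm]
  ring

/-- The factor `-(i/ε) λ(ε k)`. -/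
def WaveData.phase (D : WaveData S κ ω) (ε : ℝ) (k : RVec d) : ℂ :=
  -(Complex.I / (ε : ℂ)) * (D.lam (ε • k) : ℂ)

lemma WaveData.measurable_phase (D : WaveData S κ ω) (ε : ℝ) : Measurable (D.phase ε) := by
  have := D.meas_lam
  unfold phase
  fun_prop

lemma WaveData.norm_phase_le (D : WaveData S κ ω) {ε : ℝ} (hε : 0 < ε) (k : RVec d) :
    ‖D.phase ε k‖ ≤ D.C * ‖k‖ := by
  have h := D.abs_lam_le (ε • k)
  rw [norm_smul, Real.norm_of_nonneg hε.le] at h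
  rw [phase, norm_mul, norm_neg, norm_div, Complex.norm_I, Complex.norm_of_nonneg hε.le,
    Complex.norm_real, Real.norm_eq_abs, one_div, inv_mul_le_iff₀ hε]
  linarith

lemma WaveData.norm_phase_smul_P_le (D : WaveData S κ ω) {ε : ℝ} (hε : 0 < ε) (k : RVec d) :
    ‖D.phase ε k • D.P (ε • k)‖ ≤ D.C * ‖k‖ := by
  rw [norm_smul]
  have hC := D.C_nonneg
  calc _ ≤ (D.C * ‖k‖) * 1 :=
        mul_le_mul (D.norm_phase_le hε k) (D.norm_P_le _) (norm_nonneg _) (by positivity)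
    _ = _ := mul_one _

/-- The multiplier `𝒫_ε` with a cutoff. -/
def WaveData.projC (D : WaveData S κ ω) (ε : ℝ) : Mult d n where
  toFun k := cutoff ε k • D.P (ε • k)
  meas := (measurable_cutoff ε).stronglyMeasurable.smul (D.projE ε).meas
  bound := ⟨1, fun _ => (norm_cutoff_smul_le _ _ _).trans (D.norm_P_le _)⟩

/-- The multiplier `-(i/ε) λ(ε k) 𝒫_ε` with a cutoff. -/
def WaveData.phaseC (D : WaveData S κ ω) {ε : ℝ} (hε : 0 < ε) : Mult d n where
  toFun k := cutoff ε k • D.phase ε k • D.P (ε • k)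
  meas := (measurable_cutoff ε).stronglyMeasurable.smul
    ((D.measurable_phase ε).stronglyMeasurable.smul (D.projE ε).meas)
  bound := ⟨_, fun k => norm_cutoff_smul_le_of_le hε D.C_nonneg k _ (D.norm_phase_smul_P_le hε k)⟩

/-- The multiplier `A(k)` with a cutoff. -/
def FriedrichsSystem.symC (S : FriedrichsSystem d n) {ε : ℝ} (hε : 0 < ε) : Mult d n where
  toFun k := cutoff ε k • S.symA k
  meas := (measurable_cutoff ε).stronglyMeasurable.smul S.continuous_symA.stronglyMeasurable
  bound := by
    obtain ⟨C, hC, h⟩ := S.exists_norm_symA_le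
    exact ⟨_, fun k => norm_cutoff_smul_le_of_le hε hC k _ (h k)⟩

/-- The first derivative of a trilinear convolution along a curve. -/
def cubicD (T : Tri n) (f f' : L1Space d n) : L1Space d n :=
  triL1 T f' f f + triL1 T f f' f + triL1 T f f f'

/-- The second derivative of a trilinear convolution along a curve. -/
def cubicD₂ (T : Tri n) (f f' f'' : L1Space d n) : L1Space d n :=
  (triL1 T f'' f f + triL1 T f' f' f + triL1 T f' f f')
    + (triL1 T f' f' f + triL1 T f f'' f + triL1 T f f' f')
    + (triL1 T f' f f' + triL1 T f f' f' + triL1 T f f f'')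

/-- The sum of the trilinear convolutions with `g` in one slot and `f` in the others. -/
def oneSlot (T : Tri n) (f g : L1Space d n) : L1Space d n :=
  triL1 T g f f + triL1 T f g f + triL1 T f f g

lemma UBdL.cubic {ι : Type*} {s : ℕ} {T : Tri n} {b : ι → ℝ} {f g h : ι → L1Space d n}
    (hf : UBdL s (fun _ => ⊤) f b) (hg : UBdL s (fun _ => ⊤) g (fun _ => 1))
    (hh : UBdL s (fun _ => ⊤) h (fun _ => 1)) :
    UBdL s (fun _ => ⊤) (fun i => triL1 T (f i) (g i) (h i)) b ∧
    UBdL s (fun _ => ⊤) (fun i => triL1 T (g i) (f i) (h i)) b ∧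
    UBdL s (fun _ => ⊤) (fun i => triL1 T (g i) (h i) (f i)) b :=
  ⟨(hf.tri T hg hh).of_eq (fun _ => rfl) (by simp),
    (hg.tri T hf hh).of_eq (fun _ => rfl) (by simp),
    (hg.tri T hh hf).of_eq (fun _ => rfl) (by simp)⟩

lemma UBdL.oneSlot {ι : Type*} {s : ℕ} {T : Tri n} {b : ι → ℝ} {f g : ι → L1Space d n}
    (hf : UBdL s (fun _ => ⊤) f (fun _ => 1)) (hg : UBdL s (fun _ => ⊤) g b) :
    UBdL s (fun _ => ⊤) (fun i => oneSlot T (f i) (g i)) b :=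
  ((UBdL.cubic hg hf hf).1.add (UBdL.cubic hg hf hf).2.1).add (UBdL.cubic hg hf hf).2.2

namespace Admissible

/-- The polarized part with cutoff. -/
def pc (a : Admissible D K θ) (t : ℝ) : L1Space d n := (D.projC a.ε).op (a.U 1 t)

/-- The derivative of `pc`. -/
def pc' (a : Admissible D K θ) (t : ℝ) : L1Space d n :=
  (D.phaseC a.pos).op (a.U 1 t) + (a.ε : ℂ) • (D.projC a.ε).op (a.N 1 t)

/-- The derivative of the nonlinearity. -/
def N' (a : Admissible D K θ) (j : ℤ) (t : ℝ) : L1Space d n :=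
  nonlinD S.TcF (fun i => a.U i t) (fun i => a.V i t) j

/-- The second derivative of `pc`. -/
def pc'' (a : Admissible D K θ) (t : ℝ) : L1Space d n :=
  (D.phaseC a.pos).op (a.V 1 t) + (a.ε : ℂ) • (D.projC a.ε).op (a.N' 1 t)

lemma projC_V (a : Admissible D K θ) {t : ℝ} (ht : t ∈ Set.Icc 0 a.τ) :
    (D.projC a.ε).op (a.V 1 t) = a.pc' t := by
  refine Lp.ext ?_
  filter_upwards [(D.projC a.ε).coeFn_op (a.V 1 t), (D.projE a.ε).coeFn_op (a.V 1 t),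
    a.projE_V ht, (D.phaseC a.pos).coeFn_op (a.U 1 t), (D.projC a.ε).coeFn_op (a.N 1 t),
    Lp.coeFn_add ((D.phaseC a.pos).op (a.U 1 t)) ((a.ε : ℂ) • (D.projC a.ε).op (a.N 1 t)),
    Lp.coeFn_smul (a.ε : ℂ) ((D.projC a.ε).op (a.N 1 t))] with k h1 h2 h3 h4 h5 h6 h7
  rw [pc', h6, Pi.add_apply, h7, Pi.smul_apply, h4, h5, h1]
  have h8 : D.P (a.ε • k) (a.V 1 t k) = D.phase a.ε k • D.P (a.ε • k) (a.U 1 t k)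
      + (a.ε : ℂ) • D.P (a.ε • k) (a.N 1 t k) := by
    exact h2.symm.trans h3
  change cutoff a.ε k • D.P (a.ε • k) (a.V 1 t k) = cutoff a.ε k • D.phase a.ε k •
    D.P (a.ε • k) (a.U 1 t k) + (a.ε : ℂ) • cutoff a.ε k • D.P (a.ε • k) (a.N 1 t k)
  rw [h8, smul_add, smul_comm (a.ε : ℂ)]

lemma hasDerivWithinAt_op (m : Mult d n) {G : ℝ → L1Space d n} {G' : L1Space d n} {I : Set ℝ}
    {t : ℝ} (h : HasDerivWithinAt G G' I t) :
    HasDerivWithinAt (fun t => m.op (G t)) (m.op G') I t :=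
  (m.op.restrictScalars ℝ).hasFDerivAt.comp_hasDerivWithinAt t h

lemma hasDerivWithinAt_smul_clm (c : ℂ) (B : CVec n →L[ℂ] CVec n)
    {G : ℝ → L1Space d n} {G' : L1Space d n} {I : Set ℝ} {t : ℝ}
    (h : HasDerivWithinAt G G' I t) :
    HasDerivWithinAt (fun t => c • B.compLp (G t)) (c • B.compLp G') I t :=
  ((c • B.compLpL 1 (volume : Measure (RVec d))).restrictScalars
    ℝ).hasFDerivAt.comp_hasDerivWithinAt t h

lemma hasDerivWithinAt_smul_L1 (c : ℂ)
    {G : ℝ → L1Space d n} {G' : L1Space d n} {I : Set ℝ} {t : ℝ}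
    (h : HasDerivWithinAt G G' I t) :
    HasDerivWithinAt (fun t => c • G t) (c • G') I t :=
  ((c • ContinuousLinearMap.id ℂ (L1Space d n)).restrictScalars
    ℝ).hasFDerivAt.comp_hasDerivWithinAt t h

lemma hasDerivWithinAt_pc (a : Admissible D K θ) {t : ℝ} (ht : t ∈ Set.Icc 0 a.τ) :
    HasDerivWithinAt a.pc (a.pc' t) (Set.Icc 0 a.τ) t := by
  rw [← a.projC_V ht]
  exact hasDerivWithinAt_op _ (a.sys.deriv 1 one_mem_posModes t ht)

/-- The derivative of the full polarized part contains the multiplier `λ(εk)/ε`, which need not be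
bounded in `k` and so need not act on `L¹`. The cutoff makes it bounded for each `ε`, and hence `pc`
can be differentiated twice. -/
lemma hasDerivWithinAt_pc' (a : Admissible D K θ) {t : ℝ} (ht : t ∈ Set.Icc 0 a.τ) :
    HasDerivWithinAt a.pc' (a.pc'' t) (Set.Icc 0 a.τ) t :=
  (hasDerivWithinAt_op _ (a.sys.deriv 1 one_mem_posModes t ht)).add
    (hasDerivWithinAt_smul_L1 _ (hasDerivWithinAt_op _
      (hasDerivWithinAt_nonlin (a.sys.deriv_modes ht) 1)))

lemma ubd_pc (hK : 0 ≤ K) :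
    UBdL 3 (fun _ => ⊤) (fun i : Pt D K θ => i.idx.pc i.t) (fun _ => 1) :=
  (ubd_U hK 1 one_mem_modes).op (m := fun i => D.projC i.idx.ε) (c := 1)
    fun _ _ => (norm_cutoff_smul_le _ _ _).trans (D.norm_P_le _)

/-- Two powers of the weight, from 3 to 1, buy the factor `ε²`. -/
lemma ubd_p_sub_pc (hK : 0 ≤ K) : UBdL 1 (fun _ => ⊤)
    (fun i : Pt D K θ => i.idx.p 1 i.t - i.idx.pc i.t) (fun i => i.idx.ε ^ 2) := by
  refine (UBd.of_norm_le_norm_sq_mul (s := 1) (ubd_U hK 1 one_mem_modes)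
    (c := fun i => i.idx.ε ^ 2) (fun i => by positivity) fun i => ?_).mono_one
    fun i => by rw [mul_one]
  have e : i.idx.p 1 i.t = (D.projE i.idx.ε).op (i.idx.U 1 i.t) := firstOnly_one _ _ _
  simp only [e]
  filter_upwards [Lp.coeFn_sub ((D.projE i.idx.ε).op (i.idx.U 1 i.t)) (i.idx.pc i.t),
    (D.projE i.idx.ε).coeFn_op (i.idx.U 1 i.t), (D.projC i.idx.ε).coeFn_op (i.idx.U 1 i.t)]
    with k h1 h2 h3
  rw [h1, Pi.sub_apply, h2, pc, h3]
  have h4 := (D.P (i.idx.ε • k)).le_of_opNorm_le (D.norm_P_le _) (i.idx.U 1 i.t k)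
  rw [one_mul] at h4
  refine (norm_sub_cutoff_smul_le_sq i.idx.pos k (D.P (i.idx.ε • k) (i.idx.U 1 i.t k))).trans ?_
  gcongr

/-- The bound on the multiplier provided by the cutoff is of order `1/ε`. A bound uniform in `ε`
uses one power of the weight instead, and it involves only the polarized part of `f`; this matters
for `f = V`, whose polarized part is bounded. -/
lemma ubd_phaseC {s : ℕ} {f : Pt D K θ → L1Space d n}
    (hf : UBdL (s + 1) (fun _ => ⊤) (fun i => (D.projE i.idx.ε).op (f i)) (fun _ => 1)) :
    UBdL s (fun _ => ⊤) (fun i => (D.phaseC i.idx.pos).op (f i)) (fun _ => 1) := by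
  refine (UBd.of_norm_le_norm_mul hf (c := fun _ => D.C) (fun _ => D.C_nonneg)
    fun i => ?_).mono D.C_nonneg fun i => le_rfl
  filter_upwards [(D.phaseC i.idx.pos).coeFn_op (f i), (D.projE i.idx.ε).coeFn_op (f i)]
    with k h1 h2
  rw [h1, h2]
  refine (norm_cutoff_smul_le i.idx.ε k
    (D.phase i.idx.ε k • D.P (i.idx.ε • k) (f i k))).trans ?_
  rw [norm_smul]
  exact mul_le_mul_of_nonneg_right (D.norm_phase_le i.idx.pos k) (norm_nonneg _)

lemma ubd_smul_projC {s : ℕ} {f : Pt D K θ → L1Space d n}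
    (hf : UBdL s (fun _ => ⊤) f (fun i => i.idx.ε⁻¹)) :
    UBdL s (fun _ => ⊤) (fun i => (i.idx.ε : ℂ) • (D.projC i.idx.ε).op (f i)) (fun _ => 1) := by
  refine ((hf.op (m := fun i => D.projC i.idx.ε) (c := 1)
    fun _ _ => (norm_cutoff_smul_le _ _ _).trans (D.norm_P_le _)).smul
    fun i => Complex.norm_of_nonneg i.idx.pos.le).of_eq (fun _ => rfl) fun i => ?_
  exact mul_inv_cancel₀ i.idx.pos.ne'

lemma one_le_inv_eps (a : Admissible D K θ) : 1 ≤ a.ε⁻¹ := (one_le_inv₀ a.pos).2 a.le_one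

lemma ubd_pc' (hK : 0 ≤ K) :
    UBdL 2 (fun _ => ⊤) (fun i : Pt D K θ => i.idx.pc' i.t) (fun _ => 1) := by
  refine (ubd_phaseC (s := 2) ?_).add (ubd_smul_projC
    (((ubd_N hK 1).weight_le (by norm_num)).mono_one fun i => i.idx.one_le_inv_eps))
  exact (ubd_U hK 1 one_mem_modes).op (m := fun i => D.projE i.idx.ε) (c := 1)
    fun i k => D.norm_P_le _

lemma ubd_V (hK : 0 ≤ K) : ∀ j ∈ modes,
    UBdL 2 (fun _ => ⊤) (fun i : Pt D K θ => i.idx.V j i.t) (fun i => i.idx.ε⁻¹) := by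
  have h' : ∀ i : Pt D K θ, ∀ j ∈ posModes, i.idx.V (-j) i.t = reflConj (i.idx.V j i.t) :=
    fun i j hj => i.idx.sys.conj_deriv j hj i.t
  refine UBdL.of_posModes (W := fun (i : Pt D K θ) j => i.idx.V j i.t) h' fun j hj => ?_
  have hjm : j ∈ modes := by
    revert j; exact posModes_forall one_mem_modes three_mem_modes
  set L := S.opD (j * ω) ((j : ℝ) • κ) with hL
  have hi : ∀ i : Pt D K θ, ‖-(Complex.I / (i.idx.ε : ℂ))‖ = i.idx.ε⁻¹ := fun i => by
    rw [norm_neg, norm_div, Complex.norm_I, Complex.norm_of_nonneg i.idx.pos.le, one_div]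
  have t1 : UBdL 2 (fun _ => ⊤)
      (fun i : Pt D K θ => (-(Complex.I / (i.idx.ε : ℂ))) • L.compLp (i.idx.U j i.t))
      (fun i => i.idx.ε⁻¹) :=
    ((((ubd_U hK j hjm).weight_le (by norm_num : 2 ≤ 3)).clm L).smul hi).of_eq (fun _ => rfl)
      fun i => mul_one _
  have t2 : UBdL 2 (fun _ => ⊤) (fun i : Pt D K θ => (i.idx.ε : ℂ) • i.idx.N j i.t)
      (fun i => i.idx.ε⁻¹) :=
    (((ubd_N hK j).weight_le (by norm_num : 2 ≤ 3)).smul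
      fun i => Complex.norm_of_nonneg i.idx.pos.le).mono_one fun i => by
        rw [mul_one]; exact i.idx.le_one.trans i.idx.one_le_inv_eps
  have t3 : UBd 2 (fun _ => ⊤) (fun (i : Pt D K θ) k =>
      -(Complex.I • S.symA k (ContinuousLinearMap.id ℂ _ (i.idx.U j i.t k))))
      (fun i => i.idx.ε⁻¹) :=
    (ubd_symA (c' := fun _ => 1) (fun _ => Complex.norm_I) (ubd_U hK j hjm)
      (ContinuousLinearMap.id ℂ _)).mono_one fun i => by
        rw [one_mul]; exact i.idx.one_le_inv_eps
  refine (UBd.add (UBdL.add t1 t2) t3 fun i => Lp.aestronglyMeasurable _).congr fun i => ?_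
  filter_upwards [i.idx.sys.eqn j hj i.t i.mem, L.coeFn_compLp (i.idx.U j i.t),
    Lp.coeFn_add ((-(Complex.I / (i.idx.ε : ℂ))) • L.compLp (i.idx.U j i.t))
      ((i.idx.ε : ℂ) • i.idx.N j i.t),
    Lp.coeFn_smul (-(Complex.I / (i.idx.ε : ℂ))) (L.compLp (i.idx.U j i.t)),
    Lp.coeFn_smul (i.idx.ε : ℂ) (i.idx.N j i.t)] with k h1 h2 h3 h4 h5
  have hε' : (i.idx.ε : ℂ) ≠ 0 := by exact_mod_cast i.idx.pos.ne'
  rw [h3, Pi.add_apply, h4, h5, Pi.smul_apply, Pi.smul_apply, h2, h1, S.opD_add, S.symA_smul,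
    _root_.add_apply, _root_.smul_apply, smul_add, smul_smul, neg_mul, div_mul_cancel₀ _ hε']
  simp only [N, hL, ContinuousLinearMap.id_apply, neg_smul]
  abel

/-- In the first term `V` enters only through `𝒫_ε V`, which is bounded. In the second one the
prefactor `ε` absorbs the size `1/ε` of the derivative of the nonlinearity. -/
lemma ubd_pc'' (hK : 0 ≤ K) :
    UBdL 1 (fun _ => ⊤) (fun i : Pt D K θ => i.idx.pc'' i.t) (fun _ => 1) := by
  refine (ubd_phaseC (s := 1) ?_).add (ubd_smul_projC ?_)
  · have := ubd_p' (D := D) (θ := θ) hK 1 one_mem_modes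
    simpa only [p', firstOnly_one] using this
  · exact UBdL.of_nonlinD (W := fun (i : Pt D K θ) j => i.idx.U j i.t)
      (W' := fun (i : Pt D K θ) j => i.idx.V j i.t)
      (fun j hj => (ubd_U hK j hj).weight_le (by norm_num))
      (fun j hj => (ubd_V hK j hj).weight_le (by norm_num)) 1

end Admissible
end Cutoff
end

noncomputable section

set_option linter.unusedSectionVars false

open scoped ENNReal NNReal Topology

/-! ### The third coefficient function is of order `ε²` -/

section SecondOrder
variable {d n : ℕ} {S : FriedrichsSystem d n} {κ : RVec d} {ω K θ : ℝ} {D : WaveData S κ ω}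

namespace Admissible

/-- The leading part of the cubic nonlinearity in the third equation. -/
def cub (a : Admissible D K θ) (t : ℝ) : L1Space d n := triL1 S.TcF (a.pc t) (a.pc t) (a.pc t)

/-- The derivative of `cub`. -/
def cub' (a : Admissible D K θ) (t : ℝ) : L1Space d n := cubicD S.TcF (a.pc t) (a.pc' t)

/-- The second derivative of `cub`. -/
def cub'' (a : Admissible D K θ) (t : ℝ) : L1Space d n :=
  cubicD₂ S.TcF (a.pc t) (a.pc' t) (a.pc'' t)

/-- The second term in the expansion of the solution of the third equation. -/
def cor (a : Admissible D K θ) (t : ℝ) : L1Space d n :=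
  Complex.I • D.inv₃.compLp (a.cub' t) - (S.symC a.pos).op (D.inv₃.compLp (a.cub t))

/-- The derivative of `cor`. -/
def cor' (a : Admissible D K θ) (t : ℝ) : L1Space d n :=
  Complex.I • D.inv₃.compLp (a.cub'' t) - (S.symC a.pos).op (D.inv₃.compLp (a.cub' t))

lemma hasDerivWithinAt_cub (a : Admissible D K θ) {t : ℝ} (ht : t ∈ Set.Icc 0 a.τ) :
    HasDerivWithinAt a.cub (a.cub' t) (Set.Icc 0 a.τ) t :=
  have h := a.hasDerivWithinAt_pc ht
  HasDerivWithinAt.triL1 S.TcF h h h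

lemma hasDerivWithinAt_cub' (a : Admissible D K θ) {t : ℝ} (ht : t ∈ Set.Icc 0 a.τ) :
    HasDerivWithinAt a.cub' (a.cub'' t) (Set.Icc 0 a.τ) t := by
  have h := a.hasDerivWithinAt_pc ht
  have h' := a.hasDerivWithinAt_pc' ht
  exact ((HasDerivWithinAt.triL1 S.TcF h' h h).add (HasDerivWithinAt.triL1 S.TcF h h' h)).add
    (HasDerivWithinAt.triL1 S.TcF h h h')

lemma hasDerivWithinAt_clm (B : CVec n →L[ℂ] CVec n)
    {G : ℝ → L1Space d n} {G' : L1Space d n} {I : Set ℝ} {t : ℝ}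
    (h : HasDerivWithinAt G G' I t) :
    HasDerivWithinAt (fun t => B.compLp (G t)) (B.compLp G') I t :=
  ((B.compLpL 1 (volume : Measure (RVec d))).restrictScalars
    ℝ).hasFDerivAt.comp_hasDerivWithinAt t h

lemma hasDerivWithinAt_cor (a : Admissible D K θ) {t : ℝ} (ht : t ∈ Set.Icc 0 a.τ) :
    HasDerivWithinAt a.cor (a.cor' t) (Set.Icc 0 a.τ) t :=
  (hasDerivWithinAt_smul_clm _ _ (a.hasDerivWithinAt_cub' ht)).sub
    (hasDerivWithinAt_op _ (hasDerivWithinAt_clm _ (a.hasDerivWithinAt_cub ht)))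

lemma ubd_cub (hK : 0 ≤ K) :
    UBdL 3 (fun _ => ⊤) (fun i : Pt D K θ => i.idx.cub i.t) (fun _ => 1) :=
  (UBdL.cubic (ubd_pc hK) (ubd_pc hK) (ubd_pc hK)).1

lemma ubd_cub' (hK : 0 ≤ K) :
    UBdL 2 (fun _ => ⊤) (fun i : Pt D K θ => i.idx.cub' i.t) (fun _ => 1) := by
  have h : UBdL 2 (fun _ => ⊤) (fun i : Pt D K θ => i.idx.pc i.t) (fun _ => 1) :=
    (ubd_pc hK).weight_le (by norm_num)
  exact UBdL.oneSlot h (ubd_pc' hK)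

lemma ubd_cub'' (hK : 0 ≤ K) :
    UBdL 1 (fun _ => ⊤) (fun i : Pt D K θ => i.idx.cub'' i.t) (fun _ => 1) := by
  have h0 : UBdL 1 (fun _ => ⊤) (fun i : Pt D K θ => i.idx.pc i.t) (fun _ => 1) :=
    (ubd_pc hK).weight_le (by norm_num)
  have h1 : UBdL 1 (fun _ => ⊤) (fun i : Pt D K θ => i.idx.pc' i.t) (fun _ => 1) :=
    (ubd_pc' hK).weight_le (by norm_num)
  have h2 := ubd_pc'' (D := D) (θ := θ) hK
  have t {f g h : Pt D K θ → L1Space d n} (hf : UBdL 1 (fun _ => ⊤) f (fun _ => 1))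
      (hg : UBdL 1 (fun _ => ⊤) g (fun _ => 1)) (hh : UBdL 1 (fun _ => ⊤) h (fun _ => 1)) :=
    (UBdL.cubic (T := S.TcF) hf hg hh).1
  exact ((((t h2 h0 h0).add (t h1 h1 h0)).add (t h1 h0 h1)).add
    (((t h1 h1 h0).add (t h0 h2 h0)).add (t h0 h1 h1))).add
    (((t h1 h0 h1).add (t h0 h1 h1)).add (t h0 h0 h2))

lemma ubd_symC {s : ℕ} {f : Pt D K θ → L1Space d n} (hf : UBdL (s + 1) (fun _ => ⊤) f (fun _ => 1)) :
    UBdL s (fun _ => ⊤) (fun i => (S.symC i.idx.pos).op (f i)) (fun _ => 1) := by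
  obtain ⟨C, hC, hA⟩ := S.exists_norm_symA_le
  refine (UBd.of_norm_le_norm_mul hf (c := fun _ => C) (fun _ => hC)
    fun i => ?_).mono hC fun i => le_rfl
  filter_upwards [(S.symC i.idx.pos).coeFn_op (f i)] with k h1
  rw [h1]
  exact (norm_cutoff_smul_le i.idx.ε k (S.symA k (f i k))).trans
    (ContinuousLinearMap.le_of_opNorm_le _ (hA k) _)

lemma ubd_cor (hK : 0 ≤ K) :
    UBdL 2 (fun _ => ⊤) (fun i : Pt D K θ => i.idx.cor i.t) (fun _ => 1) :=
  ((((ubd_cub' hK).clm D.inv₃).smul (c := fun _ => 1) fun _ => Complex.norm_I).of_eq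
    (fun _ => rfl) (by simp)).sub (ubd_symC ((ubd_cub hK).clm D.inv₃))

lemma ubd_cor' (hK : 0 ≤ K) :
    UBdL 1 (fun _ => ⊤) (fun i : Pt D K θ => i.idx.cor' i.t) (fun _ => 1) :=
  ((((ubd_cub'' hK).clm D.inv₃).smul (c := fun _ => 1) fun _ => Complex.norm_I).of_eq
    (fun _ => rfl) (by simp)).sub (ubd_symC ((ubd_cub' hK).clm D.inv₃))

/-- The remainder in the equation for the unpolarized part. -/
def rem (a : Admissible D K θ) (t : ℝ) : L1Space d n :=
  (D.perpE a.ε).op (a.V 1 t) + (Complex.I / (a.ε : ℂ)) •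
    (S.opD ((1 : ℤ) * ω) (((1 : ℤ) : ℝ) • κ)).compLp (a.perp t)

lemma ubd_perp (hK : 0 ≤ K) :
    UBdL 2 (fun _ => ⊤) (fun i : Pt D K θ => i.idx.perp i.t) (fun i => i.idx.ε) :=
  (ubd_diff hK 1 one_mem_posModes).of_eq
    (fun i => (i.idx.mult_op_U i.t 1 one_mem_posModes).symm) fun _ => rfl

/-- After the rotation `-(i/ε) 𝓛(ω, κ)` has been taken out of the derivative of the unpolarized
part, only `ε 𝒫_ε^⊥ N` and `-i A(k)` applied to the unpolarized part are left. Both are of order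
`ε`, the second one because `ubd_perp` holds with one more power of the weight. -/
lemma ubd_rem (hK : 0 ≤ K) :
    UBdL 1 (fun _ => ⊤) (fun i : Pt D K θ => i.idx.rem i.t) (fun i => i.idx.ε) := by
  have t1 : UBdL 1 (fun _ => ⊤)
      (fun i : Pt D K θ => (i.idx.ε : ℂ) • (D.perpE i.idx.ε).op (i.idx.N 1 i.t))
      (fun i => i.idx.ε) :=
    ((((ubd_N hK 1).weight_le (by norm_num : 1 ≤ 3)).op (m := fun i => D.perpE i.idx.ε)
      fun i k => D.norm_perpE_le _ k).smul fun i => Complex.norm_of_nonneg i.idx.pos.le).of_eq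
      (fun _ => rfl) fun i => mul_one _
  have t2 : UBd 1 (fun _ => ⊤) (fun (i : Pt D K θ) k =>
      -(Complex.I • S.symA k (ContinuousLinearMap.id ℂ _ (i.idx.perp i.t k))))
      (fun i => i.idx.ε) :=
    (ubd_symA (c' := fun _ => 1) (fun _ => Complex.norm_I) (ubd_perp hK)
      (ContinuousLinearMap.id ℂ _)).mono_one fun i => by rw [one_mul]
  refine (UBd.add t1 t2 fun i => Lp.aestronglyMeasurable _).congr fun i => ?_
  have hε' : (i.idx.ε : ℂ) ≠ 0 := by exact_mod_cast i.idx.pos.ne'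
  set L := S.opD ((1 : ℤ) * ω) (((1 : ℤ) : ℝ) • κ) with hL
  filter_upwards [i.idx.sys.eqn 1 one_mem_posModes i.t i.mem,
    (D.perpE i.idx.ε).coeFn_op (i.idx.V 1 i.t), (D.perpE i.idx.ε).coeFn_op (i.idx.U 1 i.t),
    (D.perpE i.idx.ε).coeFn_op (i.idx.N 1 i.t), L.coeFn_compLp (i.idx.perp i.t),
    Lp.coeFn_add ((D.perpE i.idx.ε).op (i.idx.V 1 i.t))
      ((Complex.I / (i.idx.ε : ℂ)) • L.compLp (i.idx.perp i.t)),
    Lp.coeFn_smul (Complex.I / (i.idx.ε : ℂ)) (L.compLp (i.idx.perp i.t)),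
    Lp.coeFn_smul (i.idx.ε : ℂ) ((D.perpE i.idx.ε).op (i.idx.N 1 i.t))]
    with k h1 h2 h3 h4 h5 h6 h7 h8
  rw [rem, h6, Pi.add_apply, h7, h8, Pi.smul_apply, Pi.smul_apply, h2, h4, h5, h1, map_add, map_smul,
    map_smul, D.perpE_opD, perp, h3, S.opD_add, S.symA_smul, _root_.add_apply, _root_.smul_apply,
    smul_add, smul_smul, neg_mul, div_mul_cancel₀ _ hε', ContinuousLinearMap.id_apply]
  simp only [N, hL, neg_smul]
  abel

/-- The parts of the cubic nonlinearity that are linear in a spectral component of the unpolarized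
part. -/
def lin (a : Admissible D K θ) (l : Fin n) (t : ℝ) : L1Space d n :=
  oneSlot S.TcF (a.p 1 t) ((D.proj l).compLp (a.perp t))

/-- The remainder in the equation for `lin`. -/
def linRem (a : Admissible D K θ) (l : Fin n) (t : ℝ) : L1Space d n :=
  oneSlot S.TcF (a.p 1 t) ((D.proj l).compLp (a.rem t))
    + ((triL1 S.TcF ((D.proj l).compLp (a.perp t)) (a.p' 1 t) (a.p 1 t)
        + triL1 S.TcF ((D.proj l).compLp (a.perp t)) (a.p 1 t) (a.p' 1 t))
      + (triL1 S.TcF (a.p' 1 t) ((D.proj l).compLp (a.perp t)) (a.p 1 t)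
        + triL1 S.TcF (a.p 1 t) ((D.proj l).compLp (a.perp t)) (a.p' 1 t))
      + (triL1 S.TcF (a.p' 1 t) (a.p 1 t) ((D.proj l).compLp (a.perp t))
        + triL1 S.TcF (a.p 1 t) (a.p' 1 t) ((D.proj l).compLp (a.perp t))))

/-- The spectral projections diagonalize `𝓛(ω, κ)`, so each component of the unpolarized part
rotates with the fixed frequency `ev l / ε`. -/
lemma proj_perp' (a : Admissible D K θ) (l : Fin n) (t : ℝ) :
    (D.proj l).compLp ((D.perpE a.ε).op (a.V 1 t))
      = -((Complex.I / (a.ε : ℂ)) * (D.ev l : ℂ)) • (D.proj l).compLp (a.perp t)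
        + (D.proj l).compLp (a.rem t) := by
  set L := S.opD ((1 : ℤ) * ω) (((1 : ℤ) : ℝ) • κ) with hL
  set W := (D.perpE a.ε).op (a.V 1 t) with hW
  refine Lp.ext ?_
  filter_upwards [(D.proj l).coeFn_compLp W, (D.proj l).coeFn_compLp (a.perp t),
    (D.proj l).coeFn_compLp (a.rem t), L.coeFn_compLp (a.perp t),
    Lp.coeFn_add W ((Complex.I / (a.ε : ℂ)) • L.compLp (a.perp t)),
    Lp.coeFn_smul (Complex.I / (a.ε : ℂ)) (L.compLp (a.perp t)),
    Lp.coeFn_add (-((Complex.I / (a.ε : ℂ)) * (D.ev l : ℂ)) • (D.proj l).compLp (a.perp t))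
      ((D.proj l).compLp (a.rem t)),
    Lp.coeFn_smul (-((Complex.I / (a.ε : ℂ)) * (D.ev l : ℂ))) ((D.proj l).compLp (a.perp t))]
    with k h1 h2 h3 h4 h5 h6 h7 h8
  rw [h7, Pi.add_apply, h8, Pi.smul_apply, h1, h2, h3, rem, h5, Pi.add_apply, h6, Pi.smul_apply, h4,
    map_add, map_smul, D.proj_opD, smul_smul, neg_smul]
  abel

/-- Since `p` is slow, `lin l` inherits the oscillation of the one spectral component in it.
Everything else goes into `linRem`, which is of order `ε`. -/
lemma hasDerivWithinAt_lin (a : Admissible D K θ) (l : Fin n) {t : ℝ} (ht : t ∈ Set.Icc 0 a.τ) :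
    HasDerivWithinAt (a.lin l)
      (-((Complex.I / (a.ε : ℂ)) * (D.ev l : ℂ)) • a.lin l t + a.linRem l t)
      (Set.Icc 0 a.τ) t := by
  have hp := a.hasDerivWithinAt_p ht 1
  have h1 : HasDerivWithinAt (fun t => (D.proj l).compLp (a.perp t))
      (-((Complex.I / (a.ε : ℂ)) * (D.ev l : ℂ)) • (D.proj l).compLp (a.perp t)
        + (D.proj l).compLp (a.rem t)) (Set.Icc 0 a.τ) t := by
    rw [← a.proj_perp']
    exact hasDerivWithinAt_clm _
      (hasDerivWithinAt_op _ (a.sys.deriv 1 one_mem_posModes t ht))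
  have := ((HasDerivWithinAt.triL1 S.TcF h1 hp hp).add
    (HasDerivWithinAt.triL1 S.TcF hp h1 hp)).add (HasDerivWithinAt.triL1 S.TcF hp hp h1)
  refine HasDerivWithinAt.congr_deriv this ?_
  simp only [lin, linRem, oneSlot, triL1_add₁, triL1_add₂, triL1_add₃, triL1_smul₁, triL1_smul₂,
    triL1_smul₃, smul_add]
  abel

lemma ubd_lin (hK : 0 ≤ K) (l : Fin n) :
    UBdL 2 (fun _ => ⊤) (fun i : Pt D K θ => i.idx.lin l i.t) (fun i => i.idx.ε) :=
  UBdL.oneSlot ((ubd_p hK 1 one_mem_modes).weight_le (by norm_num)) ((ubd_perp hK).clm _)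

lemma ubd_linRem (hK : 0 ≤ K) (l : Fin n) :
    UBdL 1 (fun _ => ⊤) (fun i : Pt D K θ => i.idx.linRem l i.t) (fun i => i.idx.ε) := by
  have hp : UBdL 1 (fun _ => ⊤) (fun i : Pt D K θ => i.idx.p 1 i.t) (fun _ => 1) :=
    (ubd_p hK 1 one_mem_modes).weight_le (by norm_num)
  have hp' : UBdL 1 (fun _ => ⊤) (fun i : Pt D K θ => i.idx.p' 1 i.t) (fun _ => 1) :=
    (ubd_p' hK 1 one_mem_modes).weight_le (by norm_num)
  have hu : UBdL 1 (fun _ => ⊤) (fun i : Pt D K θ => (D.proj l).compLp (i.idx.perp i.t))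
      (fun i => i.idx.ε) := ((ubd_perp hK).weight_le (by norm_num)).clm _
  have c1 := UBdL.cubic (T := S.TcF) hu hp' hp
  have c2 := UBdL.cubic (T := S.TcF) hu hp hp'
  exact (UBdL.oneSlot hp ((ubd_rem hK).clm _)).add
    (((c1.1.add c2.1).add (c1.2.1.add c2.2.1)).add (c1.2.2.add c2.2.2))

end Admissible
end SecondOrder
end

noncomputable section

set_option linter.unusedSectionVars false

open scoped ENNReal NNReal Topology

/-! ### Normal form transformation of the third mode. -/

section ThirdMode
variable {d n : ℕ} {S : FriedrichsSystem d n} {κ : RVec d} {ω K θ : ℝ} {D : WaveData S κ ω}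

namespace Admissible

/-- The defect of `f`, with derivative `f'`, in the third linear equation with right-hand side
`g`. -/
def defect (a : Admissible D K θ) (f f' g : L1Space d n) (k : RVec d) : CVec n :=
  f' k + (Complex.I / (a.ε : ℂ)) • S.opD ((3 : ℤ) * ω) (((3 : ℤ) : ℝ) • κ + a.ε • k) (f k) - g k

lemma aestronglyMeasurable_defect (a : Admissible D K θ) (f f' g : L1Space d n) :
    AEStronglyMeasurable (a.defect f f' g) volume := by
  have hcont : Continuous fun k : RVec d =>
      S.opD ((3 : ℤ) * ω) (((3 : ℤ) : ℝ) • κ + a.ε • k) := by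
    simp_rw [S.opD_add]
    exact continuous_const.add (S.continuous_symA.comp (continuous_const_smul a.ε))
  have h1 : AEStronglyMeasurable
      (fun k => S.opD ((3 : ℤ) * ω) (((3 : ℤ) : ℝ) • κ + a.ε • k) (f k)) volume :=
    (isBoundedBilinearMap_apply (𝕜 := ℂ)).continuous.comp_aestronglyMeasurable
      (hcont.aestronglyMeasurable.prodMk (Lp.aestronglyMeasurable f))
  have h2 : AEStronglyMeasurable (fun k => (Complex.I / (a.ε : ℂ)) •
      S.opD ((3 : ℤ) * ω) (((3 : ℤ) : ℝ) • κ + a.ε • k) (f k)) volume :=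
    h1.const_smul (Complex.I / (a.ε : ℂ))
  have h0 : AEStronglyMeasurable (fun k => f' k) volume := Lp.aestronglyMeasurable f'
  have h3 : AEStronglyMeasurable (fun k => f' k + (Complex.I / (a.ε : ℂ)) •
      S.opD ((3 : ℤ) * ω) (((3 : ℤ) : ℝ) • κ + a.ε • k) (f k)) volume := h0.add h2
  have h4 : AEStronglyMeasurable (fun k => g k) volume := Lp.aestronglyMeasurable g
  exact h3.sub h4

variable {f f' g f₂ f₂' g₂ : Pt D K θ → L1Space d n} {b : Pt D K θ → ℝ}

/-- The defects in the third linear equation are bounded by `b`. -/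
def UBdR (f f' g : Pt D K θ → L1Space d n) (b : Pt D K θ → ℝ) : Prop :=
  UBd 1 (fun i => i.R) (fun i => i.idx.defect (f i) (f' i) (g i)) b

lemma UBdR.add (h : UBdR f f' g b) (h₂ : UBdR f₂ f₂' g₂ b) :
    UBdR (fun i => f i + f₂ i) (fun i => f' i + f₂' i) (fun i => g i + g₂ i) b := by
  refine (UBd.add h h₂ fun i => i.idx.aestronglyMeasurable_defect _ _ _).congr fun i => ?_
  filter_upwards [Lp.coeFn_add (f i) (f₂ i), Lp.coeFn_add (f' i) (f₂' i),
    Lp.coeFn_add (g i) (g₂ i)] with k h1 h2 h3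
  simp only [defect, h1, h2, h3, Pi.add_apply, map_add, smul_add]
  abel

lemma UBdR.zero : UBdR (fun _ : Pt D K θ => (0 : L1Space d n)) (fun _ => 0) (fun _ => 0) b := by
  refine UBd.congr (f := fun _ _ => 0) ⟨0, le_rfl, fun i => WBd.zero.mono (by simp)⟩ fun i => ?_
  filter_upwards with k
  simp [defect]

lemma UBdR.sum {J : Type*} (t : Finset J) {f f' g : J → Pt D K θ → L1Space d n}
    (h : ∀ l ∈ t, UBdR (f l) (f' l) (g l) b) :
    UBdR (fun i => ∑ l ∈ t, f l i) (fun i => ∑ l ∈ t, f' l i) (fun i => ∑ l ∈ t, g l i) b := by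
  classical
  induction t using Finset.induction_on with
  | empty => simpa using UBdR.zero
  | insert j t hj ih =>
    simp only [Finset.sum_insert hj]
    exact (h j (by simp)).add (ih fun i hi => h i (by simp [hi]))

lemma UBdR.residual (h : UBdR f f' g b) (hg : UBdL 1 (fun i : Pt D K θ => i.R) g b) :
    UBd 1 (fun i : Pt D K θ => i.R) (fun i k => f' i k + (Complex.I / (i.idx.ε : ℂ)) •
      S.opD ((3 : ℤ) * ω) (((3 : ℤ) : ℝ) • κ + i.idx.ε • k) (f i k)) b := by
  refine (UBd.add h hg fun i => i.idx.aestronglyMeasurable_defect _ _ _).congr fun i => ?_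
  exact .of_forall fun k => sub_add_cancel _ _

/-- If `G` oscillates with frequency `ν/ε` and `(𝓛(3ω, 3κ) - ν) B = I`, the two terms with `ν`, from
the derivative of `G` and from `𝓛 B`, cancel. Thus `c B G` answers to the forcing `(i/ε) c G`, and
its defect consists of the slow remainder `Q` and of the part `ε A(k)` of the matrix. -/
lemma defect_smul_clm (a : Admissible D K θ) {c : ℂ} {ν : ℂ} {B : CVec n →L[ℂ] CVec n}
    (hB : ∀ v, S.opD ((3 : ℤ) * ω) (((3 : ℤ) : ℝ) • κ) (B v) = v + ν • B v)
    {G G' Q : L1Space d n} (hG : G' = -((Complex.I / (a.ε : ℂ)) * ν) • G + Q) :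
    (fun k => (c • B.compLp Q : L1Space d n) k + -((-(Complex.I * c)) • S.symA k (B (G k))))
      =ᵐ[volume] a.defect (c • B.compLp G) (c • B.compLp G')
        ((Complex.I / (a.ε : ℂ) * c) • G) := by
  have hε' : (a.ε : ℂ) ≠ 0 := by exact_mod_cast a.pos.ne'
  subst hG
  set z := -((Complex.I / (a.ε : ℂ)) * ν) with hz
  filter_upwards [Lp.coeFn_smul c (B.compLp Q), B.coeFn_compLp Q, Lp.coeFn_smul c (B.compLp G),
    B.coeFn_compLp G, Lp.coeFn_smul c (B.compLp (z • G + Q)), B.coeFn_compLp (z • G + Q),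
    Lp.coeFn_add (z • G) Q, Lp.coeFn_smul z G, Lp.coeFn_smul (Complex.I / (a.ε : ℂ) * c) G]
    with k h1 h2 h3 h4 h5 h6 h7 h8 h9
  have hH : S.opD ((3 : ℤ) * ω) (((3 : ℤ) : ℝ) • κ + a.ε • k) (B (G k))
      = (G k + ν • B (G k)) + (a.ε : ℂ) • S.symA k (B (G k)) := by
    rw [S.opD_add, S.symA_smul, _root_.add_apply, hB, _root_.smul_apply]
  rw [defect, h1, h3, h5, h9, Pi.smul_apply, Pi.smul_apply, Pi.smul_apply, Pi.smul_apply, h2, h4,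
    h6, h7, Pi.add_apply, h8, Pi.smul_apply, map_add, map_smul, map_smul, hH]
  have e : ∀ x y w q : CVec n, c • q + -((-(Complex.I * c)) • w)
      = c • (z • y + q) + (Complex.I / (a.ε : ℂ)) • c • ((x + ν • y) + (a.ε : ℂ) • w)
        - (Complex.I / (a.ε : ℂ) * c) • x := by
    intro x y w q
    have h1 : (Complex.I / (a.ε : ℂ)) * c * (a.ε : ℂ) = Complex.I * c := by field_simp
    simp only [smul_add, smul_smul, h1, hz, ← mul_assoc, neg_smul, neg_neg]
    module
  exact e _ _ _ _

lemma UBdR.smul_clm {c : Pt D K θ → ℂ} {c' : Pt D K θ → ℝ} (hc : ∀ i, ‖c i‖ = c' i) {ν : ℂ}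
    {B : CVec n →L[ℂ] CVec n} {b' : Pt D K θ → ℝ}
    (hB : ∀ v, S.opD ((3 : ℤ) * ω) (((3 : ℤ) : ℝ) • κ) (B v) = v + ν • B v)
    {G G' Q : Pt D K θ → L1Space d n}
    (hG : ∀ i, G' i = -((Complex.I / (i.idx.ε : ℂ)) * ν) • G i + Q i)
    (hGb : UBdL 2 (fun _ => ⊤) G b') (hQ : UBdL 1 (fun _ => ⊤) Q b') :
    UBdR (fun i => c i • B.compLp (G i)) (fun i => c i • B.compLp (G' i))
      (fun i => (Complex.I / (i.idx.ε : ℂ) * c i) • G i) (fun i => c' i * b' i) := by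
  have t1 : UBdL 1 (fun i : Pt D K θ => i.R) (fun i => c i • B.compLp (Q i))
      (fun i => c' i * b' i) := ((hQ.weight_le le_rfl).clm B).smul hc
  have t2 : UBd 1 (fun i : Pt D K θ => i.R)
      (fun i k => -((-(Complex.I * c i)) • S.symA k (B (G i k)))) (fun i => c' i * b' i) :=
    ubd_symA (fun i => by rw [norm_neg, norm_mul, Complex.norm_I, one_mul, hc]) hGb B
  exact (UBd.add t1 t2 fun i => Lp.aestronglyMeasurable _).congr
    fun i => i.idx.defect_smul_clm hB (hG i)

/-- The case `ν = 0`. The defect is still of order `ε²` and too large, so it is treated as an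
additional forcing `ε² cor`, to be removed by the next correction. As `cor` contains `A(k)` with the
cutoff, a term of size `ε³ ‖k‖²` remains, which costs two powers of the weight. -/
lemma ubdR_corr_cub (hK : 0 ≤ K) :
    UBdR (fun i : Pt D K θ => i.idx.corr D.inv₃ (i.idx.cub i.t))
      (fun i => i.idx.corr D.inv₃ (i.idx.cub' i.t))
      (fun i => (-(i.idx.ε : ℂ)) • i.idx.cub i.t + ((i.idx.ε : ℂ) ^ 2) • i.idx.cor i.t)
      (fun i => i.idx.ε ^ 3) := by
  obtain ⟨C, hC, hA⟩ := S.exists_norm_symA_le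
  refine UBd.congr (f := fun (i : Pt D K θ) k => -(((i.idx.ε : ℂ) ^ 2) •
    (S.symA k (D.inv₃ (i.idx.cub i.t k)) - cutoff i.idx.ε k • S.symA k
      (D.inv₃ (i.idx.cub i.t k))))) ?_ fun i => ?_
  · refine (UBd.of_norm_le_norm_sq_mul (s := 1) ((ubd_cub hK).clm D.inv₃)
      (c := fun i => i.idx.ε ^ 3 * C) (fun i => by have := i.idx.pos; positivity)
      fun i => ?_).mono hC fun i => by rw [mul_one, mul_comm]
    have hε := i.idx.pos
    filter_upwards [D.inv₃.coeFn_compLp (i.idx.cub i.t)] with k h1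
    rw [norm_neg, norm_smul, norm_pow, Complex.norm_of_nonneg hε.le, h1]
    calc _ ≤ i.idx.ε ^ 2 * (i.idx.ε * ‖k‖ * (C * ‖k‖ * ‖D.inv₃ (i.idx.cub i.t k)‖)) := by
          gcongr
          refine (norm_sub_cutoff_smul_le hε _ _).trans ?_
          gcongr
          exact ContinuousLinearMap.le_of_opNorm_le _ (hA k) _
      _ = _ := by ring
  · have hε' : (i.idx.ε : ℂ) ≠ 0 := by exact_mod_cast i.idx.pos.ne'
    have hB : ∀ v, S.opD ((3 : ℤ) * ω) (((3 : ℤ) : ℝ) • κ) (D.inv₃ v) = v + (0 : ℂ) • D.inv₃ v :=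
      fun v => by rw [D.opD_inv₃, zero_smul, add_zero]
    have h := i.idx.defect_smul_clm (c := Complex.I * (i.idx.ε : ℂ) ^ 2) hB
      (G := i.idx.cub i.t) (G' := i.idx.cub' i.t) (Q := i.idx.cub' i.t) (by simp)
    set x := i.idx.cub i.t with hx
    set y := i.idx.cub' i.t with hy
    set m := S.symC i.idx.pos with hm
    set e : ℂ := (i.idx.ε : ℂ) with he
    filter_upwards [h, Lp.coeFn_smul (Complex.I / e * (Complex.I * e ^ 2)) x,
      Lp.coeFn_smul (Complex.I * e ^ 2) (D.inv₃.compLp y), D.inv₃.coeFn_compLp y,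
      Lp.coeFn_add ((-e) • x) ((e ^ 2) • i.idx.cor i.t), Lp.coeFn_smul (-e) x,
      Lp.coeFn_smul (e ^ 2) (i.idx.cor i.t),
      Lp.coeFn_sub (Complex.I • D.inv₃.compLp y) (m.op (D.inv₃.compLp x)),
      Lp.coeFn_smul Complex.I (D.inv₃.compLp y), m.coeFn_op (D.inv₃.compLp x),
      D.inv₃.coeFn_compLp x]
      with k h1 h2 h3 h4 h5 h6 h7 h8 h9 h10 h11
    have hcor : i.idx.cor i.t k = Complex.I • D.inv₃ (y k) - cutoff i.idx.ε k • S.symA k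
        (D.inv₃ (x k)) := by
      rw [cor, ← hx, ← hy, ← hm, h8, Pi.sub_apply, h9, Pi.smul_apply, h4, h10, h11]
      rfl
    simp only [defect] at h1 ⊢
    rw [h2, h3, Pi.smul_apply, Pi.smul_apply, h4] at h1
    rw [h5, Pi.add_apply, h6, h7, Pi.smul_apply, Pi.smul_apply, hcor]
    have h1' := eq_add_of_sub_eq h1.symm
    rw [← he] at h1'
    rw [corr, corr, ← he, ← hx, ← hy, h3, Pi.smul_apply, h4, h1']
    have e1 : Complex.I / e * (Complex.I * e ^ 2) = -e := by
      field_simp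
      linear_combination Complex.I_sq
    have e2 : Complex.I * (Complex.I * e ^ 2) = -e ^ 2 := by
      linear_combination e ^ 2 * Complex.I_sq
    rw [e1, e2]
    module

/-- The transformed third coefficient function. -/
def q₃ (a : Admissible D K θ) (t : ℝ) : L1Space d n :=
  ((a.U 3 t + a.corr D.inv₃ (a.cub t))
    + (Complex.I * (a.ε : ℂ) ^ 3) • D.inv₃.compLp (a.cor t))
    + ∑ l, (Complex.I * (a.ε : ℂ) ^ 2) • (D.inv l).compLp (a.lin l t)

/-- The derivative of `lin`. -/
def lin' (a : Admissible D K θ) (l : Fin n) (t : ℝ) : L1Space d n :=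
  -((Complex.I / (a.ε : ℂ)) * (D.ev l : ℂ)) • a.lin l t + a.linRem l t

/-- The derivative of `q₃`. -/
def q₃' (a : Admissible D K θ) (t : ℝ) : L1Space d n :=
  ((a.V 3 t + a.corr D.inv₃ (a.cub' t))
    + (Complex.I * (a.ε : ℂ) ^ 3) • D.inv₃.compLp (a.cor' t))
    + ∑ l, (Complex.I * (a.ε : ℂ) ^ 2) • (D.inv l).compLp (a.lin' l t)

lemma hasDerivWithinAt_q₃ (a : Admissible D K θ) {t : ℝ} (ht : t ∈ Set.Icc 0 a.τ) :
    HasDerivWithinAt a.q₃ (a.q₃' t) (Set.Icc 0 a.τ) t := by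
  refine (((a.sys.deriv 3 three_mem_posModes t ht).add
    (a.hasDerivWithinAt_corr _ (a.hasDerivWithinAt_cub ht))).add
    (hasDerivWithinAt_smul_clm _ _ (a.hasDerivWithinAt_cor ht))).add ?_
  exact HasDerivWithinAt.fun_sum fun l _ =>
    hasDerivWithinAt_smul_clm _ _ (a.hasDerivWithinAt_lin l ht)

/-- The part of the third nonlinearity that the transformation does not remove. -/
def N₃ (a : Admissible D K θ) (t : ℝ) : L1Space d n := a.N 3 t - a.cub t - ∑ l, a.lin l t

lemma norm_corr_factor₃ (a : Admissible D K θ) : ‖Complex.I * (a.ε : ℂ) ^ 3‖ = a.ε ^ 3 := by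
  rw [norm_mul, Complex.norm_I, one_mul, norm_pow, Complex.norm_of_nonneg a.pos.le]

/-- The three corrections produce the forcings `-ε cub + ε² cor`, `-ε² cor` and `-ε lin l`. The
terms with `cor` cancel, and what remains of `ε N` is `ε N₃`. -/
lemma ubdR_q₃ (hK : 0 ≤ K) : UBdR (fun i : Pt D K θ => i.idx.q₃ i.t) (fun i => i.idx.q₃' i.t)
    (fun i => (i.idx.ε : ℂ) • i.idx.N₃ i.t) (fun i => i.idx.ε ^ 3) := by
  have hB₃ : ∀ v, S.opD ((3 : ℤ) * ω) (((3 : ℤ) : ℝ) • κ) (D.inv₃ v) = v + (0 : ℂ) • D.inv₃ v :=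
    fun v => by rw [D.opD_inv₃, zero_smul, add_zero]
  have h1 : UBdR (fun i : Pt D K θ => i.idx.U 3 i.t) (fun i => i.idx.V 3 i.t)
      (fun i => (i.idx.ε : ℂ) • i.idx.N 3 i.t) (fun i => i.idx.ε ^ 3) := by
    refine UBd.congr (f := fun _ _ => 0) ⟨0, le_rfl, fun i => WBd.zero.mono (by simp)⟩ fun i => ?_
    filter_upwards [i.idx.sys.eqn 3 three_mem_posModes i.t i.mem,
      Lp.coeFn_smul (i.idx.ε : ℂ) (i.idx.N 3 i.t)] with k h1 h2
    rw [defect, h2, Pi.smul_apply, h1, N, neg_smul]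
    abel
  have h3 := UBdR.smul_clm (D := D) (K := K) (θ := θ)
    (c := fun i => Complex.I * (i.idx.ε : ℂ) ^ 3)
    (c' := fun i => i.idx.ε ^ 3) (fun i => i.idx.norm_corr_factor₃) hB₃
    (G := fun i => i.idx.cor i.t) (G' := fun i => i.idx.cor' i.t) (Q := fun i => i.idx.cor' i.t)
    (fun i => by simp) (ubd_cor hK) (ubd_cor' hK)
  have h4 := fun l => UBdR.smul_clm (D := D) (K := K) (θ := θ)
    (c := fun i => Complex.I * (i.idx.ε : ℂ) ^ 2)
    (c' := fun i => i.idx.ε ^ 2) (fun i => i.idx.norm_corr_factor) (D.opD_inv l)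
    (G := fun i => i.idx.lin l i.t) (G' := fun i => i.idx.lin' l i.t)
    (Q := fun i => i.idx.linRem l i.t) (fun i => rfl) (ubd_lin hK l) (ubd_linRem hK l)
  have e3 : (fun i : Pt D K θ => i.idx.ε ^ 3 * 1) = fun i => i.idx.ε ^ 3 := by
    funext i; ring
  have e4 : (fun i : Pt D K θ => i.idx.ε ^ 2 * i.idx.ε) = fun i => i.idx.ε ^ 3 := by
    funext i; ring
  rw [e3] at h3
  rw [e4] at h4
  have total := ((h1.add (ubdR_corr_cub hK)).add h3).add (UBdR.sum Finset.univ fun l _ => h4 l)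
  have eg : (fun i : Pt D K θ => (i.idx.ε : ℂ) • i.idx.N₃ i.t) = fun i =>
      (((i.idx.ε : ℂ) • i.idx.N 3 i.t
        + (-(i.idx.ε : ℂ) • i.idx.cub i.t + (i.idx.ε : ℂ) ^ 2 • i.idx.cor i.t))
        + (Complex.I / (i.idx.ε : ℂ) * (Complex.I * (i.idx.ε : ℂ) ^ 3)) • i.idx.cor i.t)
        + ∑ l, (Complex.I / (i.idx.ε : ℂ) * (Complex.I * (i.idx.ε : ℂ) ^ 2)) • i.idx.lin l i.t := by
    funext i
    have hε' : (i.idx.ε : ℂ) ≠ 0 := by exact_mod_cast i.idx.pos.ne'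
    have e1 : Complex.I / (i.idx.ε : ℂ) * (Complex.I * (i.idx.ε : ℂ) ^ 2) = -(i.idx.ε : ℂ) := by
      field_simp
      linear_combination Complex.I_sq
    have e2 : Complex.I / (i.idx.ε : ℂ) * (Complex.I * (i.idx.ε : ℂ) ^ 3)
        = -(i.idx.ε : ℂ) ^ 2 := by
      field_simp
      linear_combination Complex.I_sq
    rw [e1, e2, ← Finset.smul_sum, N₃]
    module
  rw [eg]
  exact total

lemma sum_lin (a : Admissible D K θ) (t : ℝ) :
    ∑ l, a.lin l t = oneSlot S.TcF (a.p 1 t) (a.perp t) := by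
  have h : ∑ l, (D.proj l).compLp (a.perp t) = a.perp t := by
    refine Lp.ext ?_
    have h1 : ∀ᵐ k, ∀ l, (D.proj l).compLp (a.perp t) k = D.proj l (a.perp t k) :=
      ae_all_iff.2 fun l => (D.proj l).coeFn_compLp _
    filter_upwards [h1, Lp.coeFn_finsetSum Finset.univ
      (fun l => (D.proj l).compLp (a.perp t))] with k h2 h3
    rw [h3, Finset.sum_apply, Finset.sum_congr rfl fun l _ => h2 l, D.sum_proj]
  simp only [lin, oneSlot, Finset.sum_add_distrib, ← triL1_sum₁, ← triL1_sum₂, ← triL1_sum₃, h]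

/-- Three numbers `±1` add up to `3` only if all are `1`. Each other triad has an entry `±3`, and
its contribution is linear in a quantity controlled by the third mode. -/
lemma triads_three_cases : ∀ J ∈ (triads 3).erase (1, 1, 1),
    (J.1 = 3 ∨ J.1 = -3) ∨ (J.2.1 = 3 ∨ J.2.1 = -3) ∨ (J.2.2 = 3 ∨ J.2.2 = -3) := by
  decide

lemma mem_triads_three : ((1, 1, 1) : ℤ × ℤ × ℤ) ∈ triads 3 := by decide

/-- Expand `T(U₁, U₁, U₁)` with `U₁ = p + perp`. The part without `perp` is cancelled by `cub` up to
the cutoff error `ε²`, the parts linear in `perp` by the `lin l`, and the others contain `perp` at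
least twice, hence are of order `ε²`. The remaining triads contain `U_{±3}`. -/
lemma ubd_N₃ (hK : 0 ≤ K) {b : Pt D K θ → ℝ} (hb : ∀ i, i.idx.ε ^ 2 ≤ b i)
    (h3 : UBdL 1 (fun i : Pt D K θ => i.R) (fun i => i.idx.U 3 i.t) b) :
    UBdL 1 (fun i : Pt D K θ => i.R) (fun i => i.idx.N₃ i.t) b := by
  have hU : ∀ j ∈ modes, UBdL 1 (fun _ => ⊤) (fun i : Pt D K θ => i.idx.U j i.t) (fun _ => 1) :=
    fun j hj => (ubd_U hK j hj).weight_le (by norm_num)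
  have h3' : UBdL 1 (fun i : Pt D K θ => i.R) (fun i => i.idx.U (-3) i.t) b :=
    h3.reflConj.of_eq (fun i => (i.idx.sys.conj 3 three_mem_posModes i.t).symm) fun _ => rfl
  have hc : ∀ j : ℤ, j = 3 ∨ j = -3 →
      UBdL 1 (fun i : Pt D K θ => i.R) (fun i => i.idx.U j i.t) b := by
    rintro j (rfl | rfl)
    exacts [h3, h3']
  have t1 : UBdL 1 (fun i : Pt D K θ => i.R) (fun i => ∑ J ∈ (triads 3).erase (1, 1, 1),
      triL1 S.TcF (i.idx.U J.1 i.t) (i.idx.U J.2.1 i.t) (i.idx.U J.2.2 i.t)) b := by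
    refine UBdL.sum _ fun J hJ => ?_
    obtain ⟨m1, m2, m3⟩ := triads_modes (Finset.mem_of_mem_erase hJ)
    rcases triads_three_cases J hJ with h | h | h
    · exact ((hc _ h).tri S.TcF (hU _ m2) (hU _ m3)).of_eq (fun _ => rfl) (by simp)
    · exact ((hU _ m1).tri_mid S.TcF (hc _ h) (hU _ m3)).of_eq (fun _ => rfl) (by simp)
    · exact ((hU _ m1).tri_right S.TcF (hU _ m2) (hc _ h)).of_eq (fun _ => rfl) (by simp)
  have hp : UBdL 1 (fun _ => ⊤) (fun i : Pt D K θ => i.idx.p 1 i.t) (fun _ => 1) :=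
    (ubd_p hK 1 one_mem_modes).weight_le (by norm_num)
  have hpc : UBdL 1 (fun _ => ⊤) (fun i : Pt D K θ => i.idx.pc i.t) (fun _ => 1) :=
    (ubd_pc hK).weight_le (by norm_num)
  have hu : UBdL 1 (fun _ => ⊤) (fun i : Pt D K θ => i.idx.perp i.t) (fun i => i.idx.ε) :=
    (ubd_perp hK).weight_le (by norm_num)
  have hu1 : UBdL 1 (fun _ => ⊤) (fun i : Pt D K θ => i.idx.perp i.t) (fun _ => 1) :=
    hu.mono_one fun i => i.idx.le_one
  have sq {f g h : Pt D K θ → L1Space d n} {b₁ b₂ b₃ : Pt D K θ → ℝ}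
      (hf : UBdL 1 (fun _ => ⊤) f b₁) (hg : UBdL 1 (fun _ => ⊤) g b₂)
      (hh : UBdL 1 (fun _ => ⊤) h b₃) (hbb : ∀ i, b₁ i * b₂ i * b₃ i = i.idx.ε ^ 2) :
      UBdL 1 (fun i : Pt D K θ => i.R) (fun i => triL1 S.TcF (f i) (g i) (h i)) b :=
    ((hf.tri S.TcF hg hh).weight_le le_rfl).mono_one fun i => (hbb i).trans_le (hb i)
  have t2 := (((sq hu hu hp fun i => by ring).add (sq hu hp hu fun i => by ring)).add
    (sq hp hu hu fun i => by ring)).add (sq hu hu hu1 fun i => by ring)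
  have t3 : UBdL 1 (fun i : Pt D K θ => i.R) (fun i =>
      triL1 S.TcF (i.idx.p 1 i.t) (i.idx.p 1 i.t) (i.idx.p 1 i.t) - i.idx.cub i.t) b := by
    have hd := ubd_p_sub_pc (D := D) (θ := θ) hK
    exact ((UBdL.tri_sub hp hp hpc hpc hd hd hd).weight_le le_rfl).mono_one hb
  refine ((t1.add t2).add t3).of_eq (fun i => ?_) fun _ => rfl
  have hsplit : i.idx.U 1 i.t = i.idx.p 1 i.t + i.idx.perp i.t := by
    have h := i.idx.mult_op_U i.t 1 one_mem_posModes
    have h' : (D.mult i.idx.ε 1).op (i.idx.U 1 i.t) = i.idx.perp i.t := rfl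
    rw [← h', h]
    abel
  rw [N₃, sum_lin, N, nonlin, ← Finset.add_sum_erase _ _ mem_triads_three]
  simp only [hsplit, oneSlot, triL1_add₁, triL1_add₂, triL1_add₃]
  abel

/-- The third coefficient function is of order `ε²`. -/
lemma ubd_three (hK : 0 ≤ K) : UBdL 1 (fun _ => ⊤)
    (fun i : Pt D K θ => i.idx.U 3 i.t) (fun i => i.idx.ε ^ 2) := by
  have hε : ∀ i : Pt D K θ, 0 ≤ i.idx.ε := fun i => i.idx.pos.le
  set r : Pt D K θ → L1Space d n := fun i => (i.idx.corr D.inv₃ (i.idx.cub i.t)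
    + (Complex.I * (i.idx.ε : ℂ) ^ 3) • D.inv₃.compLp (i.idx.cor i.t))
    + ∑ l, (Complex.I * (i.idx.ε : ℂ) ^ 2) • (D.inv l).compLp (i.idx.lin l i.t) with hr
  have hcor : UBdL 1 (fun _ => ⊤) r (fun i => i.idx.ε ^ 2) := by
    have t1 : UBdL 1 (fun _ => ⊤) (fun i : Pt D K θ => i.idx.corr D.inv₃ (i.idx.cub i.t))
        (fun i => i.idx.ε ^ 2) :=
      (ubd_corr (φ := fun i : Pt D K θ => i.idx) ((ubd_cub hK).weight_le
        (by norm_num : 1 ≤ 3)) D.inv₃).of_eq (fun _ => rfl) fun i => mul_one _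
    have t2 : UBdL 1 (fun _ => ⊤) (fun i : Pt D K θ =>
        (Complex.I * (i.idx.ε : ℂ) ^ 3) • D.inv₃.compLp (i.idx.cor i.t))
        (fun i => i.idx.ε ^ 2) :=
      ((((ubd_cor hK).weight_le (by norm_num : 1 ≤ 2)).clm D.inv₃).smul
        fun i => i.idx.norm_corr_factor₃).mono_one fun i => by
          rw [mul_one]; exact pow_le_pow_of_le_one (hε i) i.idx.le_one (by norm_num)
    have t3 : ∀ l, UBdL 1 (fun _ => ⊤) (fun i : Pt D K θ =>
        (Complex.I * (i.idx.ε : ℂ) ^ 2) • (D.inv l).compLp (i.idx.lin l i.t))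
        (fun i => i.idx.ε ^ 2) := fun l =>
      ((((ubd_lin hK l).weight_le (by norm_num : 1 ≤ 2)).clm (D.inv l)).smul
        fun i => i.idx.norm_corr_factor).mono_one fun i =>
          mul_le_of_le_one_right (by positivity) i.idx.le_one
    exact (t1.add t2).add (UBdL.sum Finset.univ fun l _ => t3 l)
  have hq : ∀ i : Pt D K θ, i.idx.q₃ i.t = i.idx.U 3 i.t + r i := fun i => by
    rw [q₃, hr, add_assoc (i.idx.U 3 i.t), add_assoc (i.idx.U 3 i.t)]
  -- The third mode starts from zero, so the initial value of `q₃` consists of the corrections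
  -- alone, which are of order `ε²`.
  have h0 : UBdL 1 (fun _ => ⊤) (fun a : Admissible D K θ => a.q₃ 0) (fun a => a.ε ^ 2) := by
    refine (hcor.comp start).of_eq (fun a => ?_) fun _ => rfl
    have := hq a.start
    change a.q₃ 0 = a.U 3 0 + r a.start at this
    rw [this, a.init_three, zero_add]
  have hres : UBd 1 (fun i : Pt D K θ => i.R)
      (fun i k => i.idx.q₃' i.t k + (Complex.I / (i.idx.ε : ℂ)) •
        S.opD ((3 : ℤ) * ω) (((3 : ℤ) : ℝ) • κ + i.idx.ε • k) (i.idx.q₃ i.t k))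
      (fun i => i.idx.ε * (∑ l ∈ ({3} : Finset ℤ), wN (wt 1 i.R) (i.idx.q₃ i.t)
        + i.idx.ε ^ 2)) := by
    simp only [Finset.sum_singleton]
    have hnn : ∀ i : Pt D K θ, 0 ≤ wN (wt 1 i.R) (i.idx.q₃ i.t) := fun i => wN_nonneg _ _
    have hU3 : UBdL 1 (fun i : Pt D K θ => i.R) (fun i => i.idx.U 3 i.t)
        (fun i => wN (wt 1 i.R) (i.idx.q₃ i.t) + i.idx.ε ^ 2) := by
      have h1 : UBdL 1 (fun i : Pt D K θ => i.R) (fun i => i.idx.q₃ i.t)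
          (fun i => wN (wt 1 i.R) (i.idx.q₃ i.t) + i.idx.ε ^ 2) :=
        ⟨1, zero_le_one, fun i => (WBd.wN_Lp (wt_le 1 i.R) _).mono (by
          have := sq_nonneg i.idx.ε
          linarith)⟩
      have h2 : UBdL 1 (fun i : Pt D K θ => i.R) r
          (fun i => wN (wt 1 i.R) (i.idx.q₃ i.t) + i.idx.ε ^ 2) :=
        (hcor.weight_le le_rfl).mono_one fun i => by linarith [hnn i]
      refine (h1.sub h2).of_eq (fun i => ?_) fun _ => rfl
      rw [hq, add_sub_cancel_right]
    have hN := (ubd_N₃ hK (fun i => by linarith [hnn i]) hU3).smul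
      (z := fun i => (i.idx.ε : ℂ)) (c := fun i => i.idx.ε)
      fun i => Complex.norm_of_nonneg (hε i)
    refine UBdR.residual (UBd.mono_one (ubdR_q₃ hK) fun i => ?_) hN
    nlinarith [mul_nonneg (hε i) (hnn i)]
  have := uniform_gronwall S κ ω θ {3} 1 (ε := fun a : Admissible D K θ => a.ε)
    (τ := fun a => a.τ) (δ := fun a => a.ε ^ 2) (fun a => a.pos) (fun a => a.le_theta)
    (fun a => sq_nonneg _) (fun _ a => a.q₃) (fun _ a => a.q₃')
    (fun j hj a t ht => a.hasDerivWithinAt_q₃ ht) (fun j hj => h0)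
    (fun j hj => by rw [Finset.mem_singleton] at hj; subst hj; exact hres)
    3 (Finset.mem_singleton_self 3)
  refine (this.sub hcor).of_eq (fun i => ?_) fun _ => rfl
  rw [hq, add_sub_cancel_right]

end Admissible
end ThirdMode
end

noncomputable section

set_option linter.unusedSectionVars false

open scoped ENNReal NNReal Topology

/-! ### Spectral data of a smooth eigendecomposition -/

section Spectral
variable {d n : ℕ}

/-- The map `v ↦ ⟨ψ, v⟩ ψ`. -/
def rankOne (ψ : CVec n) : CVec n →L[ℂ] CVec n := (innerSL ℂ ψ).smulRight ψ

lemma rankOne_apply (ψ v : CVec n) : rankOne ψ v = (inner ℂ ψ v : ℂ) • ψ := rfl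

lemma continuous_rankOne : Continuous (rankOne : CVec n → CVec n →L[ℂ] CVec n) :=
  ((ContinuousLinearMap.smulRightL ℂ (CVec n) (CVec n)).continuous.comp
    (innerSL ℂ (E := CVec n)).continuous).clm_apply continuous_id

lemma norm_rankOne_le {ψ : CVec n} (hψ : ‖ψ‖ = 1) : ‖rankOne ψ‖ ≤ 1 := by
  refine ContinuousLinearMap.opNorm_le_bound _ zero_le_one fun v => ?_
  rw [rankOne_apply, norm_smul, hψ, mul_one]
  refine (norm_inner_le_norm _ _).trans ?_
  rw [hψ]

lemma norm_rankOne_sub_le {ψ φ : CVec n} (hψ : ‖ψ‖ = 1) (hφ : ‖φ‖ = 1) :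
    ‖rankOne ψ - rankOne φ‖ ≤ 2 * ‖ψ - φ‖ := by
  refine ContinuousLinearMap.opNorm_le_bound _ (by positivity) fun v => ?_
  have e : (rankOne ψ - rankOne φ) v
      = (inner ℂ (ψ - φ) v : ℂ) • ψ + (inner ℂ φ v : ℂ) • (ψ - φ) := by
    rw [_root_.sub_apply, rankOne_apply, rankOne_apply, inner_sub_left]
    module
  rw [e]
  refine (norm_add_le _ _).trans ?_
  rw [norm_smul, norm_smul, hψ, mul_one]
  have h1 := norm_inner_le_norm (𝕜 := ℂ) (ψ - φ) v
  have h2 := norm_inner_le_norm (𝕜 := ℂ) φ v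
  rw [hφ, one_mul] at h2
  have h3 := mul_le_mul_of_nonneg_right h2 (norm_nonneg (ψ - φ))
  linarith

lemma Orthonormal.exists_basis [NeZero n] {ψ : Fin n → CVec n} (h : Orthonormal ℂ ψ) :
    ∃ b : OrthonormalBasis (Fin n) ℂ (CVec n), ∀ l, b l = ψ l := by
  have hb : ⇑(basisOfOrthonormalOfCardEqFinrank h (by simp)) = ψ := by simp
  refine ⟨(basisOfOrthonormalOfCardEqFinrank h (by simp)).toOrthonormalBasis (by rwa [hb]),
    fun l => ?_⟩
  simp

lemma Orthonormal.sum_rankOne [NeZero n] {ψ : Fin n → CVec n} (h : Orthonormal ℂ ψ) (v : CVec n) :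
    ∑ l, rankOne (ψ l) v = v := by
  obtain ⟨b, hb⟩ := h.exists_basis
  have := b.sum_repr' v
  simp only [hb] at this
  exact this

namespace FriedrichsSystem
variable (S : FriedrichsSystem d n)

lemma opD_eq_sub (α : ℝ) (β : RVec d) (v : CVec n) : S.opD α β v = S.opD 0 β v - (α : ℂ) • v := by
  have : S.dispersion α β = S.dispersion 0 β - (α : ℂ) • (1 : Matrix (Fin n) (Fin n) ℂ) := by
    simp only [dispersion, Complex.ofReal_zero, zero_smul]
    abel
  rw [opD, this, map_sub, map_smul, map_one]
  rfl

end FriedrichsSystem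

namespace IsSmoothEigendecomposition
variable [NeZero n] {S : FriedrichsSystem d n} {κ : RVec d} {ω : ℝ} {freq : Fin n → RVec d → ℝ}
  {psi : Fin n → RVec d → CVec n}

lemma opD_psi (h : IsSmoothEigendecomposition S κ ω freq psi) (α : ℝ) (β : RVec d) (l : Fin n) :
    S.opD α β (psi l β) = ((freq l β - α : ℝ) : ℂ) • psi l β := by
  have := h.eigen l β
  rw [FriedrichsSystem.matVec_eq] at this
  rw [S.opD_eq_sub, FriedrichsSystem.opD, this, Complex.ofReal_sub, sub_smul]

lemma inner_psi_opD (h : IsSmoothEigendecomposition S κ ω freq psi) (α : ℝ) (β : RVec d)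
    (l : Fin n) (v : CVec n) : (inner ℂ (psi l β) (S.opD α β v) : ℂ)
      = ((freq l β - α : ℝ) : ℂ) * inner ℂ (psi l β) v := by
  rw [← S.opD_symm, h.opD_psi, inner_smul_left, Complex.conj_ofReal]

lemma opD_rankOne (h : IsSmoothEigendecomposition S κ ω freq psi) (α : ℝ) (β : RVec d)
    (l : Fin n) (v : CVec n) :
    S.opD α β (rankOne (psi l β) v) = ((freq l β - α : ℝ) : ℂ) • rankOne (psi l β) v := by
  rw [rankOne_apply, map_smul, h.opD_psi, smul_comm]

lemma rankOne_opD (h : IsSmoothEigendecomposition S κ ω freq psi) (α : ℝ) (β : RVec d)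
    (l : Fin n) (v : CVec n) :
    rankOne (psi l β) (S.opD α β v) = ((freq l β - α : ℝ) : ℂ) • rankOne (psi l β) v := by
  rw [rankOne_apply, rankOne_apply, h.inner_psi_opD, mul_smul]

lemma norm_psi (h : IsSmoothEigendecomposition S κ ω freq psi) (l : Fin n) (β : RVec d) :
    ‖psi l β‖ = 1 := (h.orthonormal β).1 l

variable (freq psi) in
/-- The inverse of `𝓛(α, β) - μ` on the span of the eigenvectors with indices in `s`. -/
def resolvent (s : Finset (Fin n)) (α μ : ℝ) (β : RVec d) : CVec n →L[ℂ] CVec n :=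
  ∑ l ∈ s, (((freq l β - α - μ)⁻¹ : ℝ) : ℂ) • rankOne (psi l β)

lemma opD_resolvent (h : IsSmoothEigendecomposition S κ ω freq psi) {s : Finset (Fin n)}
    {α μ : ℝ} {β : RVec d} (hs : ∀ l ∈ s, freq l β - α ≠ μ) (v : CVec n) :
    S.opD α β (resolvent freq psi s α μ β v)
      = ∑ l ∈ s, rankOne (psi l β) v + (μ : ℂ) • resolvent freq psi s α μ β v := by
  simp only [resolvent, _root_.sum_apply, _root_.smul_apply, map_sum, map_smul, h.opD_rankOne,
    Finset.smul_sum, ← Finset.sum_add_distrib, smul_smul]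
  refine Finset.sum_congr rfl fun l hl => ?_
  have hne : freq l β - α - μ ≠ 0 := sub_ne_zero.2 (hs l hl)
  have e : ((((freq l β - α - μ)⁻¹ : ℝ) : ℂ) * ((freq l β - α : ℝ) : ℂ))
      = 1 + (μ : ℂ) * (((freq l β - α - μ)⁻¹ : ℝ) : ℂ) := by
    norm_cast
    field_simp
    ring
  rw [e, add_smul, one_smul]

lemma measurable_psi (h : IsSmoothEigendecomposition S κ ω freq psi) (l : Fin n) :
    Measurable (psi l) :=
  measurable_of_continuousOn_compl_singleton 0 (h.smooth_psi l).continuousOn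

lemma measurable_freq (h : IsSmoothEigendecomposition S κ ω freq psi) (l : Fin n) :
    Measurable (freq l) :=
  measurable_of_continuousOn_compl_singleton 0 (h.smooth_freq l).continuousOn

/-- Near `κ ≠ 0` smoothness gives a Lipschitz bound. For `‖θ‖ ≥ δ` the difference of two unit
vectors is at most `2 ≤ (2/δ) ‖θ‖`, so the lack of regularity at the origin does no harm. -/
lemma exists_norm_psi_sub_le (h : IsSmoothEigendecomposition S κ ω freq psi) (hκ : κ ≠ 0)
    (l : Fin n) : ∃ C, 0 ≤ C ∧ ∀ θ, ‖psi l (κ + θ) - psi l κ‖ ≤ C * ‖θ‖ := by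
  have h1 : ContDiffAt ℝ 1 (psi l) κ :=
    ((h.smooth_psi l).contDiffAt (isOpen_compl_singleton.mem_nhds hκ)).of_le (by
      exact_mod_cast le_top)
  obtain ⟨K, t, ht, hK⟩ := h1.exists_lipschitzOnWith
  obtain ⟨δ, hδ, hball⟩ := Metric.mem_nhds_iff.1 ht
  refine ⟨K + 2 / δ, by positivity, fun θ => ?_⟩
  rcases lt_or_ge ‖θ‖ δ with hθ | hθ
  · have := hK.dist_le_mul (κ + θ) (hball (by simpa using hθ)) κ (hball (by simpa using hδ))
    rw [dist_eq_norm, dist_eq_norm, add_sub_cancel_left] at this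
    refine this.trans ?_
    gcongr
    linarith [div_nonneg zero_le_two hδ.le]
  · have h2 : ‖psi l (κ + θ) - psi l κ‖ ≤ 2 := by
      refine (norm_sub_le _ _).trans ?_
      rw [h.norm_psi, h.norm_psi]
      norm_num
    have h3 : 2 ≤ 2 / δ * ‖θ‖ := by
      calc (2 : ℝ) = 2 / δ * δ := by field_simp
        _ ≤ _ := by gcongr
    have h4 : 0 ≤ (K : ℝ) * ‖θ‖ := by positivity
    rw [add_mul]
    linarith

lemma exists_abs_freq_sub_le (h : IsSmoothEigendecomposition S κ ω freq psi) (l : Fin n) :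
    ∃ C, 0 ≤ C ∧ ∀ θ, |freq l (κ + θ) - freq l κ| ≤ C * ‖θ‖ := by
  obtain ⟨C, hC⟩ := h.lipschitz
  refine ⟨|C| * d, by positivity, fun θ => (hC l κ (κ + θ)).trans ?_⟩
  have h1 : ∑ i, |(κ + θ) i - κ i| ≤ d * ‖θ‖ := by
    have : ∀ i ∈ Finset.univ, |(κ + θ) i - κ i| ≤ ‖θ‖ := fun i _ => by
      rw [PiLp.add_apply, add_sub_cancel_left]
      exact PiLp.norm_apply_le θ i
    refine (Finset.sum_le_card_nsmul _ _ _ this).trans (by simp)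
  have h2 : 0 ≤ ∑ i, |(κ + θ) i - κ i| := by positivity
  calc C * ∑ i, |(κ + θ) i - κ i| ≤ |C| * (d * ‖θ‖) := by
        have := le_abs_self C
        gcongr
    _ = _ := by ring

/-- The spectral data of a smooth eigendecomposition. -/
def waveData (h : IsSmoothEigendecomposition S κ ω freq psi) (hκ : κ ≠ 0)
    (hres : ∀ i l, shiftedFreq κ ω freq 3 i 0 ≠ shiftedFreq κ ω freq 1 l 0) :
    WaveData S κ ω where
  P θ := rankOne (shiftedPsi κ psi 1 0 θ)
  lam θ := shiftedFreq κ ω freq 1 0 θ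
  C := 2 * (h.exists_norm_psi_sub_le hκ 0).choose + (h.exists_abs_freq_sub_le 0).choose
  C_nonneg := by
    have h1 := (h.exists_norm_psi_sub_le hκ 0).choose_spec.1
    have h2 := (h.exists_abs_freq_sub_le 0).choose_spec.1
    positivity
  meas_P := continuous_rankOne.comp_stronglyMeasurable
    ((h.measurable_psi 0).comp (measurable_const_add _)).stronglyMeasurable
  meas_lam := ((h.measurable_freq 0).comp (measurable_const_add _)).const_add _
  norm_P_le θ := norm_rankOne_le (h.norm_psi _ _)
  opD_P θ v := by
    rw [shiftedPsi, h.opD_rankOne, shiftedFreq, neg_add_eq_sub]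
  P_opD θ v := by
    rw [shiftedPsi, h.rankOne_opD, shiftedFreq, neg_add_eq_sub]
  abs_lam_le θ := by
    have h1 := (h.exists_norm_psi_sub_le hκ 0).choose_spec.1
    have h2 := (h.exists_abs_freq_sub_le 0).choose_spec.2 θ
    have e : shiftedFreq κ ω freq 1 0 θ = freq 0 (κ + θ) - freq 0 κ := by
      rw [shiftedFreq, Int.cast_one, one_mul, one_smul, ← h.first]
      ring
    rw [e]
    refine h2.trans ?_
    gcongr
    linarith
  norm_P_sub_le θ := by
    have h1 := (h.exists_norm_psi_sub_le hκ 0).choose_spec.2 θ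
    have h2 := (h.exists_abs_freq_sub_le 0).choose_spec.1
    refine (norm_rankOne_sub_le (h.norm_psi _ _) (h.norm_psi _ _)).trans ?_
    simp only [Int.cast_one, one_smul, add_zero]
    rw [add_mul, mul_assoc]
    have h3 := mul_nonneg h2 (norm_nonneg θ)
    linarith
  -- The first eigenvalue of `𝓛(ω, κ)` is zero and is left out; the others are nonzero by the gap.
  inv₁ := resolvent freq psi (Finset.univ.erase 0) ((1 : ℤ) * ω) 0 (((1 : ℤ) : ℝ) • κ)
  opD_inv₁ v := by
    obtain ⟨C, hC, hgap⟩ := h.gap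
    rw [h.opD_resolvent, Complex.ofReal_zero, zero_smul, add_zero, eq_sub_iff_add_eq]
    simp only [shiftedPsi, add_zero]
    rw [Finset.sum_erase_add _ _ (Finset.mem_univ _), (h.orthonormal _).sum_rankOne]
    intro l hl h0
    have := hgap l (Finset.ne_of_mem_erase hl) (((1 : ℤ) : ℝ) • κ)
    rw [Int.cast_one, one_mul, sub_eq_zero] at h0
    rw [Int.cast_one, h0, sub_self, abs_zero] at this
    linarith
  inv₃ := resolvent freq psi Finset.univ ((3 : ℤ) * ω) 0 (((3 : ℤ) : ℝ) • κ)
  opD_inv₃ v := by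
    rw [h.opD_resolvent, Complex.ofReal_zero, zero_smul, add_zero, (h.orthonormal _).sum_rankOne]
    intro l _ h0
    -- Since `λ_{11}(0) = 0`, this case of the non-resonance condition says that no eigenvalue of
    -- `𝓛(3ω, 3κ)` vanishes.
    refine hres l 0 ?_
    rw [shiftedFreq, shiftedFreq, add_zero, add_zero, neg_add_eq_sub, h0, Int.cast_one, one_mul,
      one_smul, ← h.first, neg_add_cancel]
  proj l := rankOne (psi l (((1 : ℤ) : ℝ) • κ))
  ev l := shiftedFreq κ ω freq 1 l 0
  sum_proj v := (h.orthonormal _).sum_rankOne v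
  proj_opD l v := by
    rw [h.rankOne_opD, shiftedFreq, add_zero, neg_add_eq_sub]
  inv l := resolvent freq psi Finset.univ ((3 : ℤ) * ω) (shiftedFreq κ ω freq 1 l 0)
    (((3 : ℤ) : ℝ) • κ)
  opD_inv l v := by
    rw [h.opD_resolvent, (h.orthonormal _).sum_rankOne]
    intro i _ h0
    refine hres i l ?_
    rw [← h0, shiftedFreq, add_zero, neg_add_eq_sub]

end IsSmoothEigendecomposition
end Spectral
end

noncomputable section

set_option linter.unusedSectionVars false

open scoped ENNReal NNReal Topology

/-! ### Initial data -/

section Initial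
variable {d n : ℕ}

/-- By convexity the pure third powers of the coordinates control the weight, so only the
multi-indices `0` and `3 e_l` in the definition of `W³` matter. -/
lemma one_add_norm_pow_three_le (k : RVec d) :
    (1 + ‖k‖) ^ 3 ≤ 4 * (1 + (d : ℝ) ^ 2 * ∑ l, |k l| ^ 3) := by
  have h1 : ‖k‖ ^ 3 ≤ (d : ℝ) ^ 2 * ∑ l, |k l| ^ 3 := by
    have h := pow_sum_le_card_mul_sum_pow (s := Finset.univ) (f := fun l => |k l|)
      (fun l _ => abs_nonneg _) 2
    rw [Finset.card_univ, Fintype.card_fin] at h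
    exact (pow_le_pow_left₀ (norm_nonneg k) (norm_le_sum_abs k) 3).trans h
  have h2 : (1 + ‖k‖) ^ 3 ≤ 4 * (1 + ‖k‖ ^ 3) := by
    nlinarith [mul_nonneg (sq_nonneg (1 - ‖k‖)) (by positivity : (0 : ℝ) ≤ 1 + ‖k‖)]
  linarith

lemma WBd.exists_of_integrable {g : RVec d → CVec n} {s : ℕ} {F : RVec d → ℝ} (hF : Integrable F)
    (hle : ∀ k, (1 + ‖k‖) ^ s * ‖g k‖ ≤ F k) : ∃ c, WBd (wt s ⊤) g c := by
  refine ⟨_, WBd.of_ne_top (ne_of_lt (lt_of_le_of_lt (lintegral_mono fun k => ?_) hF.2))⟩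
  have h0 : (0 : ℝ) ≤ (1 + ‖k‖) ^ s * ‖g k‖ := by positivity
  have e : wt s ⊤ k * ‖g k‖ₑ = ENNReal.ofReal ((1 + ‖k‖) ^ s * ‖g k‖) := by
    rw [wt_top, ENNReal.ofReal_mul (by positivity), ENNReal.ofReal_pow (by positivity),
      ENNReal.ofReal_add zero_le_one (norm_nonneg _), ENNReal.ofReal_one, ofReal_norm, ofReal_norm]
  rw [e, Real.enorm_eq_ofReal (h0.trans (hle k))]
  exact ENNReal.ofReal_le_ofReal (hle k)

lemma MemWiener.exists_bound {f : RVec d → CVec n} (hf : MemWiener 3 f) :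
    ∃ (g : L1Space d n) (c : ℝ), HasWienerTransform f g ∧ WBd (wt 3 ⊤) g c := by
  obtain ⟨g, hfg, hg⟩ := hf
  have h3 : ∀ l, Integrable (fun k : RVec d => |k l| ^ 3 * ‖g k‖) := by
    intro l
    have h := (hg (Pi.single l 3) (by simp)).norm
    refine h.congr (.of_forall fun k => ?_)
    simp only [norm_smul]
    rw [Finset.prod_eq_single l]
    · simp
    · intro b _ hb
      simp [Pi.single_eq_of_ne hb]
    · simp
  have hF : Integrable (fun k : RVec d =>
      4 * (‖g k‖ + (d : ℝ) ^ 2 * ∑ l, |k l| ^ 3 * ‖g k‖)) :=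
    ((Lp.integrable_one g).norm.add
      ((integrable_finsetSum _ fun l _ => h3 l).const_mul _)).const_mul _
  obtain ⟨c, hc⟩ := WBd.exists_of_integrable (g := fun k => g k) (s := 3) hF fun k => by
    calc (1 + ‖k‖) ^ 3 * ‖g k‖
        ≤ (4 * (1 + (d : ℝ) ^ 2 * ∑ l, |k l| ^ 3)) * ‖g k‖ := by
          gcongr
          exact one_add_norm_pow_three_le k
      _ = _ := by rw [← Finset.sum_mul]; ring
  exact ⟨g, c, hfg, hc⟩

variable [NeZero n] {S : FriedrichsSystem d n} {κ : RVec d} {ω : ℝ} {freq : Fin n → RVec d → ℝ}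
  {psi : Fin n → RVec d → CVec n}

lemma IsSmoothEigendecomposition.eq_rankOne_of_opD_eq_zero
    (h : IsSmoothEigendecomposition S κ ω freq psi) {v : CVec n} (hv : S.opD ω κ v = 0) :
    rankOne (psi 0 κ) v = v := by
  obtain ⟨C, hC, hgap⟩ := h.gap
  have h1 : ∀ l, l ≠ 0 → rankOne (psi l κ) v = 0 := by
    intro l hl
    have h2 := h.inner_psi_opD ω κ l v
    rw [hv, inner_zero_right, eq_comm, mul_eq_zero] at h2
    rcases h2 with h2 | h2
    · have h3 := hgap l hl κ
      rw [Complex.ofReal_eq_zero] at h2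
      rw [abs_sub_comm, h2, abs_zero] at h3
      linarith
    · rw [rankOne_apply, h2, zero_smul]
  conv_rhs => rw [← (h.orthonormal κ).sum_rankOne v]
  rw [Finset.sum_eq_single 0 (fun l _ hl => h1 l hl) (by simp)]

/-- A constant matrix commutes with the Fourier transform, so membership in the kernel passes from
almost every `x` to almost every `k`. -/
lemma IsSmoothEigendecomposition.polarized (h : IsSmoothEigendecomposition S κ ω freq psi)
    {p : RVec d → CVec n} {g : L1Space d n} (hg : HasWienerTransform p g)
    (hp : ∀ᵐ x, matVec (S.dispersion ω κ) (p x) = 0) :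
    ∀ᵐ k, rankOne (psi 0 κ) (g k) = g k := by
  have h1 : (S.opD ω κ).compLp g = 0 := by
    refine eq_zero_of_invFourier ?_
    filter_upwards [hp] with x hx
    rw [invFourier_compLp, ← hg x]
    exact hx
  have h2 := (S.opD ω κ).coeFn_compLp g
  rw [h1] at h2
  filter_upwards [h2, Lp.coeFn_zero (CVec n) 1 (volume : Measure (RVec d))] with k h3 h4
  rw [h4, Pi.zero_apply] at h3
  exact h.eq_rankOne_of_opD_eq_zero h3.symm

/-- The data are polarized with respect to `P 0`, not to `P (ε k)`. The difference of the
projections is `O(ε ‖k‖)`, hence one factor `ε` for one power of the weight. -/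
lemma WaveData.perpE_bound (D : WaveData S κ ω) {g : L1Space d n} {c ε : ℝ} (hε : 0 ≤ ε)
    (hg : ∀ᵐ k, D.P 0 (g k) = g k) (hc : WBd (wt 3 ⊤) g c) :
    WBd (wt 2 ⊤) ((D.perpE ε).op g) (D.C * ε * c) := by
  refine WBd.of_norm_le_norm_mul (s := 2) (mul_nonneg D.C_nonneg hε) hc ?_
  filter_upwards [hg, (D.perpE ε).coeFn_op g] with k h1 h2
  have h3 : (D.perpE ε).toFun k (g k) = -((D.P (ε • k) - D.P 0) (g k)) := by
    change g k - D.P (ε • k) (g k) = -(D.P (ε • k) (g k) - D.P 0 (g k))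
    rw [h1]
    abel
  have h4 := D.norm_P_sub_le (ε • k)
  rw [norm_smul, Real.norm_of_nonneg hε, ← mul_assoc] at h4
  rw [h2, h3, norm_neg]
  exact ContinuousLinearMap.le_of_opNorm_le _ h4 _

end Initial

/-! ### The uniform estimates -/

section Estimates
variable {d n : ℕ} {S : FriedrichsSystem d n} {κ : RVec d} {ω : ℝ}

lemma modeExt_of_pos {W : ℤ → ℝ → L1Space d n} {j : ℤ} (hj : 0 < j) : modeExt W j = W j := by
  funext t
  simp [modeExt, hj]

/-- As long as a solution with polarized initial data is bounded in `L¹`, its unpolarized part and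
its third coefficient function are small. -/
lemma exists_uniform_bound (D : WaveData S κ ω) {M : ℝ} (tend : ℝ)
    {p : ℝ → RVec d → CVec n} {u : ℝ → ℤ → ℝ → RVec d → CVec n} {uhat : ℝ → ℤ → ℝ → L1Space d n}
    (hu : ∀ ε ∈ Set.Ioc (0 : ℝ) 1, IsClassicalSolution S κ ω ε (tend / ε) (p ε) (u ε) (uhat ε))
    (h1 : ∀ ε ∈ Set.Ioc (0 : ℝ) 1, WBd (wt 3 ⊤) (uhat ε 1 0) M)
    (h1' : ∀ ε ∈ Set.Ioc (0 : ℝ) 1, WBd (wt 2 ⊤) ((D.perpE ε).op (uhat ε 1 0)) (M * ε))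
    (h3 : ∀ ε ∈ Set.Ioc (0 : ℝ) 1, uhat ε 3 0 = 0) (K : ℝ) :
    ∃ C, 0 ≤ C ∧ ∀ tstar ∈ Set.Ioc 0 tend, ∀ ε ∈ Set.Ioc (0 : ℝ) 1,
      (∀ t ∈ Set.Icc 0 (tstar / ε), ∀ j ∈ posModes, ‖uhat ε j t‖ ≤ K) →
      ∀ t ∈ Set.Icc 0 (tstar / ε), WBd (wt 1 ⊤) ((D.perpE ε).op (uhat ε 1 t)) (C * ε) ∧
        WBd (wt 1 ⊤) (uhat ε 3 t) (C * ε ^ 2) := by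
  have hM : 0 ≤ M := (h1 1 ⟨zero_lt_one, le_rfl⟩).nonneg
  set K' : ℝ := M * Real.exp (6 * nlC S * 4 ^ 3 * K ^ 2 * tend) + M with hK'
  have hK'0 : 0 ≤ K' := by positivity
  -- These constants are uniform over all admissible solutions with bound `K'` on times up to `tend
  -- / ε`; they depend neither on `ε` nor on `tstar`.
  obtain ⟨C₁, hC₁, hb₁⟩ := Admissible.ubd_perp (D := D) (θ := tend) hK'0
  obtain ⟨C₃, hC₃, hb₃⟩ := Admissible.ubd_three (D := D) (θ := tend) hK'0
  refine ⟨C₁ + C₃, by positivity, fun tstar hts ε hε hK t ht => ?_⟩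
  have hε0 := hε.1
  have htend : 0 < tend := hts.1.trans_le hts.2
  have hsys := ((hu ε hε).modeSystem hε0 (by positivity)).mono
    (τ' := tstar / ε) (by gcongr; exact hts.2)
  have hle : ε * (tstar / ε) ≤ tend := by
    rw [mul_div_cancel₀ _ hε0.ne']
    exact hts.2
  have e1 : modeExt (uhat ε) 1 = uhat ε 1 := modeExt_of_pos (by norm_num)
  have e3 : modeExt (uhat ε) 3 = uhat ε 3 := modeExt_of_pos (by norm_num)
  have hbd := hsys.persistence hε0 hle (K := K) (P := M)
    (fun t ht => posModes_forall (by rw [e1]; exact hK t ht 1 one_mem_posModes)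
      (by rw [e3]; exact hK t ht 3 three_mem_posModes)) 3 (by rw [e1]; exact h1 ε hε)
      (by rw [e3]; exact h3 ε hε)
  let a : Admissible D K' tend :=
    { ε := ε, τ := tstar / ε, U := modeExt (uhat ε), V := _, pos := hε0, le_one := hε.2,
      nonneg := (div_pos hts.1 hε0).le, le_theta := hle, sys := hsys,
      bd := fun t ht j hj => (hbd t ht j hj).mono (by linarith)
      init_one := by
        rw [e1]
        refine (h1' ε hε).mono ?_
        have : 0 ≤ M * Real.exp (6 * nlC S * 4 ^ 3 * K ^ 2 * tend) := by positivity
        gcongr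
        linarith
      init_three := by rw [e3]; exact h3 ε hε }
  let i : Admissible.Pt D K' tend := ⟨a, t, ht, 1, le_rfl⟩
  have r1 : WBd (wt 2 ⊤) ((D.perpE ε).op (modeExt (uhat ε) 1 t)) (C₁ * ε) := hb₁ i
  have r3 : WBd (wt 1 ⊤) (modeExt (uhat ε) 3 t) (C₃ * ε ^ 2) := hb₃ i
  rw [e1] at r1
  rw [e3] at r3
  refine ⟨(r1.weight_le).mono ?_, r3.mono ?_⟩
  · gcongr
    linarith
  · gcongr
    linarith

end Estimates

/-! ### The transformed functions -/

section Transformed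
variable {d n : ℕ} [NeZero n] {S : FriedrichsSystem d n} {κ : RVec d} {ω : ℝ}
  {freq : Fin n → RVec d → ℝ} {psi : Fin n → RVec d → CVec n}

/-- Parseval's identity. Only the moduli of the coordinates enter, so the oscillating exponentials
in `zTransform` drop out of all norms. -/
lemma Orthonormal.norm_eq_of_coords {ψ : Fin n → CVec n} (h : Orthonormal ℂ ψ) {x v : CVec n}
    (hx : ∀ l, ‖x l‖ = ‖(inner ℂ (ψ l) v : ℂ)‖) : ‖x‖ = ‖v‖ := by
  obtain ⟨b, hb⟩ := h.exists_basis
  have h1 := b.sum_sq_norm_inner_right v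
  have h2 := EuclideanSpace.norm_sq_eq x
  simp only [hx, ← hb] at h2
  rw [h1] at h2
  exact (sq_eq_sq₀ (norm_nonneg _) (norm_nonneg _)).1 h2

lemma norm_zTransform_apply (κ : RVec d) (ω : ℝ) (freq : Fin n → RVec d → ℝ)
    (psi : Fin n → RVec d → CVec n) (ε : ℝ) (j : ℤ) (t : ℝ) (w : RVec d → CVec n) (k : RVec d)
    (l : Fin n) : ‖zTransform κ ω freq psi ε j t w k l‖
      = ‖(inner ℂ (shiftedPsi κ psi j l (ε • k)) (w k) : ℂ)‖ := by
  change ‖_ * _‖ = _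
  rw [norm_mul, Complex.norm_exp_I_mul_ofReal, one_mul]

namespace IsSmoothEigendecomposition

lemma norm_zTransform (h : IsSmoothEigendecomposition S κ ω freq psi) (ε : ℝ) (j : ℤ) (t : ℝ)
    (w : RVec d → CVec n) (k : RVec d) : ‖zTransform κ ω freq psi ε j t w k‖ = ‖w k‖ :=
  (h.orthonormal ((j : ℝ) • κ + ε • k)).norm_eq_of_coords
    fun l => norm_zTransform_apply κ ω freq psi ε j t w k l

lemma inner_rankOne (h : IsSmoothEigendecomposition S κ ω freq psi) (β : RVec d) (l : Fin n)
    (v : CVec n) : (inner ℂ (psi l β) (rankOne (psi 0 β) v) : ℂ)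
      = if l = 0 then inner ℂ (psi 0 β) v else 0 := by
  rw [rankOne_apply, inner_smul_right, orthonormal_iff_ite.1 (h.orthonormal β) l 0]
  split_ifs <;> simp

lemma norm_firstProj (h : IsSmoothEigendecomposition S κ ω freq psi) (ε t : ℝ)
    (w : RVec d → CVec n) (k : RVec d) : ‖firstProj (zTransform κ ω freq psi ε 1 t w) k‖
      = ‖rankOne (shiftedPsi κ psi 1 0 (ε • k)) (w k)‖ := by
  refine (h.orthonormal (((1 : ℤ) : ℝ) • κ + ε • k)).norm_eq_of_coords fun l => ?_
  rw [shiftedPsi, h.inner_rankOne]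
  change ‖if l = 0 then zTransform κ ω freq psi ε 1 t w k l else 0‖ = _
  split_ifs with hl
  · rw [norm_zTransform_apply, hl, shiftedPsi]
  · rfl

lemma norm_firstProjPerp (h : IsSmoothEigendecomposition S κ ω freq psi) (ε t : ℝ)
    (w : RVec d → CVec n) (k : RVec d) : ‖firstProjPerp (zTransform κ ω freq psi ε 1 t w) k‖
      = ‖epsProjPerp κ psi ε w k‖ := by
  refine (h.orthonormal (((1 : ℤ) : ℝ) • κ + ε • k)).norm_eq_of_coords fun l => ?_
  have e : epsProjPerp κ psi ε w k = w k - rankOne (psi 0 (((1 : ℤ) : ℝ) • κ + ε • k)) (w k) := rfl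
  rw [e, inner_sub_right, h.inner_rankOne]
  change ‖zTransform κ ω freq psi ε 1 t w k l
    - (if l = 0 then zTransform κ ω freq psi ε 1 t w k l else 0)‖ = _
  split_ifs with hl
  · rw [sub_self, norm_zero, hl, sub_self, norm_zero]
  · rw [sub_zero, sub_zero, norm_zTransform_apply, shiftedPsi]

end IsSmoothEigendecomposition

lemma enorm_congr_norm {x y : CVec n} (h : ‖x‖ = ‖y‖) : ‖x‖ₑ = ‖y‖ₑ := by
  rw [← ofReal_norm, h, ofReal_norm]

lemma normL1_congr_norm {f g : RVec d → CVec n} (h : ∀ k, ‖f k‖ = ‖g k‖) :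
    normL1 f = normL1 g :=
  lintegral_congr fun k => enorm_congr_norm (h k)

lemma normL1_fourierD_congr_norm {f g : RVec d → CVec n} (h : ∀ k, ‖f k‖ = ‖g k‖) (μ : Fin d) :
    normL1 (fourierD μ f) = normL1 (fourierD μ g) :=
  normL1_congr_norm fun k => by rw [fourierD, fourierD, norm_smul, norm_smul, h]

lemma WBd.normL1_fourierD_le {f : RVec d → CVec n} {c : ℝ} (h : WBd (wt 1 ⊤) f c) (μ : Fin d) :
    normL1 (fourierD μ f) ≤ ENNReal.ofReal c := by
  refine (lintegral_mono fun k => ?_).trans h.2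
  rw [fourierD, enorm_smul, wt_top, pow_one]
  gcongr
  refine le_trans ?_ le_add_self
  rw [← ofReal_norm, ← ofReal_norm, norm_mul, Complex.norm_I, one_mul, Complex.norm_real]
  exact ENNReal.ofReal_le_ofReal (PiLp.norm_apply_le k μ)

lemma normL1_Lp (f : L1Space d n) : normL1 (fun k => f k) = ENNReal.ofReal ‖f‖ :=
  lintegral_enorm_Lp f

end Transformed
end

/-! ### The main estimates. -/

theorem proposition5p6 {d n : ℕ} [NeZero n] (S : FriedrichsSystem d n)
    (κ : RVec d) (hκ : κ ≠ 0) (ω : ℝ)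
    -- the kernel of `𝓛(ω, κ)` is one-dimensional (in particular `ω` is an eigenvalue)
    (hker : Module.finrank ℂ (LinearMap.ker (Matrix.mulVecLin (S.dispersion ω κ))) = 1)
    (freq : Fin n → RVec d → ℝ) (psi : Fin n → RVec d → CVec n)
    (heig : IsSmoothEigendecomposition S κ ω freq psi)
    -- non-resonance
    (hreg : IsUnit (S.dispersion (3 * ω) ((3 : ℝ) • κ)))
    (hres : ∀ i l, shiftedFreq κ ω freq 3 i 0 ≠ shiftedFreq κ ω freq 1 l 0)
    -- initial data
    (p₀ p₁ : RVec d → CVec n) (hp₀ : MemWiener 3 p₀) (hp₁ : MemWiener 3 p₁)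
    (hpol : ∀ᵐ x, matVec (S.dispersion ω κ) (p₀ x) = 0)
    -- for every `ε`, the classical solution on `[0, tend / ε]`
    (tend : ℝ) (htend : 0 < tend)
    (u : ℝ → ℤ → ℝ → RVec d → CVec n) (uhat : ℝ → ℤ → ℝ → L1Space d n)
    (hu : ∀ ε ∈ Set.Ioc (0 : ℝ) 1, IsClassicalSolution S κ ω ε (tend / ε)
      (fun x => p₀ x + (ε : ℂ) • p₁ x) (u ε) (uhat ε))
    (z : ℝ → ℤ → ℝ → RVec d → CVec n)
    (hz : ∀ ε j t, z ε j t = zTransform κ ω freq psi ε j t (fun k => uhat ε j t k)) :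
    ∃ r₀ : ℝ, ∀ r : ℝ, r₀ < r →
      -- for every sufficiently large `r` there are admissible times `tstar`,
      (∃ tstar ∈ Set.Ioc 0 tend, ∀ ε ∈ Set.Ioc (0 : ℝ) 1,
        (⨆ t ∈ Set.Icc 0 (tstar / ε), scaledNorm ε (z ε 1 t) (z ε 3 t)) ≤ ENNReal.ofReal r) ∧
      -- and for each of them the bounds hold with a constant independent of `ε`
      (∀ tstar ∈ Set.Ioc 0 tend,
        (∀ ε ∈ Set.Ioc (0 : ℝ) 1,
          (⨆ t ∈ Set.Icc 0 (tstar / ε), scaledNorm ε (z ε 1 t) (z ε 3 t)) ≤ ENNReal.ofReal r) →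
        ∃ C : ℝ, ∀ ε ∈ Set.Ioc (0 : ℝ) 1, ∀ μ : Fin d,
          (⨆ t ∈ Set.Icc 0 (tstar / ε),
              normL1 (fourierD μ (epsProjPerp κ psi ε (fun k => uhat ε 1 t k))))
            = (⨆ t ∈ Set.Icc 0 (tstar / ε), normL1 (fourierD μ (firstProjPerp (z ε 1 t)))) ∧
          (⨆ t ∈ Set.Icc 0 (tstar / ε),
              normL1 (fourierD μ (epsProjPerp κ psi ε (fun k => uhat ε 1 t k))))
            ≤ ENNReal.ofReal (C * ε) ∧
          (⨆ t ∈ Set.Icc 0 (tstar / ε), normL1 (fourierD μ (fun k => uhat ε 3 t k)))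
            = (⨆ t ∈ Set.Icc 0 (tstar / ε), normL1 (fourierD μ (z ε 3 t))) ∧
          (⨆ t ∈ Set.Icc 0 (tstar / ε), normL1 (fourierD μ (fun k => uhat ε 3 t k)))
            ≤ ENNReal.ofReal (C * ε ^ 2)) := by
  obtain ⟨g₀, c₀, hg₀, hc₀⟩ := hp₀.exists_bound
  obtain ⟨g₁, c₁, hg₁, hc₁⟩ := hp₁.exists_bound
  set D := heig.waveData hκ hres with hD
  have htε : ∀ ε ∈ Set.Ioc (0 : ℝ) 1, (0 : ℝ) ∈ Set.Icc 0 (tend / ε) := fun ε hε =>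
    ⟨le_rfl, (div_pos htend hε.1).le⟩
  have hinit₁ : ∀ ε ∈ Set.Ioc (0 : ℝ) 1, uhat ε 1 0 = g₀ + (ε : ℂ) • g₁ := by
    intro ε hε
    refine eq_of_invFourier (.of_forall fun x => ?_)
    rw [← (hu ε hε).transform 1 one_mem_posModes 0 (htε ε hε) x, (hu ε hε).init_one x, hg₀ x,
      hg₁ x, ← invFourierL_apply, ← invFourierL_apply, ← invFourierL_apply, map_add, map_smul]
  have hinit₃ : ∀ ε ∈ Set.Ioc (0 : ℝ) 1, uhat ε 3 0 = 0 := by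
    intro ε hε
    refine eq_zero_of_invFourier (.of_forall fun x => ?_)
    rw [← (hu ε hε).transform 3 three_mem_posModes 0 (htε ε hε) x, (hu ε hε).init_three x]
  have hpol' : ∀ᵐ k, D.P 0 (g₀ k) = g₀ k := by
    filter_upwards [heig.polarized hg₀ hpol] with k hk
    have e : D.P 0 = rankOne (psi 0 κ) := by
      change rankOne (shiftedPsi κ psi 1 0 0) = _
      simp only [shiftedPsi, Int.cast_one, one_smul, add_zero]
    rw [e, hk]
  have hc₀0 := hc₀.nonneg
  have hc₁0 := hc₁.nonneg
  have hC := D.C_nonneg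
  -- `M` bounds the data `g₀ + ε g₁` with weight 3, and `M ε` bounds their unpolarized part with
  -- weight 2: `D.C * c₀` stems from `perpE_bound` for `g₀`, and `2 * c₁` from the bound `2` of the
  -- multiplier applied to `ε g₁`.
  set M : ℝ := c₀ + 2 * c₁ + D.C * c₀ with hM
  have hM0 : 0 ≤ M := by positivity
  have hb₁ : ∀ ε ∈ Set.Ioc (0 : ℝ) 1, WBd (wt 3 ⊤) (uhat ε 1 0) M := by
    intro ε hε
    rw [hinit₁ ε hε]
    refine (hc₀.add_Lp (measurable_wt 3 ⊤) (hc₁.smul_Lp (ε : ℂ))).mono ?_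
    rw [Complex.norm_of_nonneg hε.1.le]
    have h1 : ε * c₁ ≤ 1 * c₁ := mul_le_mul_of_nonneg_right hε.2 hc₁0
    have h2 := mul_nonneg hC hc₀0
    linarith
  have hb₁' : ∀ ε ∈ Set.Ioc (0 : ℝ) 1,
      WBd (wt 2 ⊤) ((D.perpE ε).op (uhat ε 1 0)) (M * ε) := by
    intro ε hε
    rw [hinit₁ ε hε, map_add, map_smul]
    have h1 := D.perpE_bound hε.1.le hpol' hc₀
    have h2 : WBd (wt 2 ⊤) ((D.perpE ε).op g₁) (2 * c₁) :=
      (hc₁.op (D.perpE ε) (D.norm_perpE_le ε)).weight_le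
    refine (h1.add_Lp (measurable_wt 2 ⊤) (h2.smul_Lp (ε : ℂ))).mono ?_
    rw [Complex.norm_of_nonneg hε.1.le, hM]
    have h3 := mul_nonneg hε.1.le hc₀0
    linarith
  have hmain := exists_uniform_bound D tend hu hb₁ hb₁' hinit₃
  have hz₁ : ∀ ε t, normL1 (firstProj (z ε 1 t))
      = ENNReal.ofReal ‖(D.projE ε).op (uhat ε 1 t)‖ := by
    intro ε t
    rw [← lintegral_enorm_Lp, normL1]
    refine lintegral_congr_ae ?_
    filter_upwards [(D.projE ε).coeFn_op (uhat ε 1 t)] with k hk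
    rw [hk, hz]
    exact enorm_congr_norm (heig.norm_firstProj ε t _ k)
  have hperp : ∀ ε t, (fun k => (D.perpE ε).op (uhat ε 1 t) k) =ᵐ[volume]
      epsProjPerp κ psi ε (fun k => uhat ε 1 t k) := fun ε t =>
    (D.perpE ε).coeFn_op (uhat ε 1 t)
  have hz₂' : ∀ ε t, normL1 (firstProjPerp (z ε 1 t))
      = normL1 (epsProjPerp κ psi ε (fun k => uhat ε 1 t k)) := fun ε t =>
    normL1_congr_norm fun k => by rw [hz]; exact heig.norm_firstProjPerp ε t _ k
  have hz₂ : ∀ ε t, normL1 (firstProjPerp (z ε 1 t))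
      = ENNReal.ofReal ‖(D.perpE ε).op (uhat ε 1 t)‖ := by
    intro ε t
    rw [hz₂', ← lintegral_enorm_Lp, normL1]
    refine lintegral_congr_ae ?_
    filter_upwards [hperp ε t] with k hk
    rw [hk]
  have hz₃ : ∀ ε t, normL1 (z ε 3 t) = ENNReal.ofReal ‖uhat ε 3 t‖ := by
    intro ε t
    rw [← normL1_Lp, hz]
    exact normL1_congr_norm (heig.norm_zTransform ε 3 t _)
  have hscaled : ∀ ε ∈ Set.Ioc (0 : ℝ) 1, ∀ t, scaledNorm ε (z ε 1 t) (z ε 3 t)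
      = ENNReal.ofReal (2 * ‖(D.projE ε).op (uhat ε 1 t)‖
        + 2 / ε * ‖(D.perpE ε).op (uhat ε 1 t)‖ + 2 / ε ^ 2 * ‖uhat ε 3 t‖) := by
    intro ε hε t
    have h0 := hε.1
    rw [scaledNorm, hz₁, hz₂, hz₃, ENNReal.ofReal_add (by positivity) (by positivity),
      ENNReal.ofReal_add (by positivity) (by positivity), ENNReal.ofReal_mul (by positivity),
      ENNReal.ofReal_mul (by positivity), ENNReal.ofReal_mul (by positivity)]
    norm_num
  obtain ⟨t₁, ht₁, hloc⟩ := exists_local_bound S κ ω hM0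
  obtain ⟨C, hC0, hCb⟩ := hmain (M + 2)
  -- The summands bound the three parts of the scaled norm on the interval of `exists_local_bound`,
  -- where the `L¹` norm is at most `M + 2`; the factors `1/ε` and `1/ε²` cancel against the
  -- smallness of the corresponding parts.
  refine ⟨2 * (M + 2) + 2 * C + 2 * C, fun r hr => ⟨?_, ?_⟩⟩
  · refine ⟨min t₁ tend, ⟨lt_min ht₁ htend, min_le_right _ _⟩, fun ε hε => ?_⟩
    have hε0 := hε.1
    have hsys := ((hu ε hε).modeSystem hε0 (by positivity)).mono
      (τ' := min t₁ tend / ε) (by gcongr; exact min_le_right _ _)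
    have e1 : modeExt (uhat ε) 1 = uhat ε 1 := modeExt_of_pos (by norm_num)
    have e3 : modeExt (uhat ε) 3 = uhat ε 3 := modeExt_of_pos (by norm_num)
    have hbd : ∀ t ∈ Set.Icc 0 (min t₁ tend / ε), ‖uhat ε 1 t‖ + ‖uhat ε 3 t‖ ≤ M + 2 := by
      have := hloc ε _ hε0 (by rw [mul_div_cancel₀ _ hε0.ne']; exact min_le_left _ _) _ _ hsys
        (by rw [e1]; exact (hb₁ ε hε).norm_le (one_le_wt 3 le_top)) (by rw [e3]; exact hinit₃ ε hε)
      rwa [e1, e3] at this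
    have hest := hCb (min t₁ tend) ⟨lt_min ht₁ htend, min_le_right _ _⟩ ε hε fun t ht =>
      posModes_forall (by linarith [hbd t ht, norm_nonneg (uhat ε 3 t)])
        (by linarith [hbd t ht, norm_nonneg (uhat ε 1 t)])
    refine iSup₂_le fun t ht => ?_
    rw [hscaled ε hε]
    refine ENNReal.ofReal_le_ofReal ?_
    obtain ⟨h1, h3⟩ := hest t ht
    have n1 := h1.norm_le (one_le_wt 1 le_top)
    have n3 := h3.norm_le (one_le_wt 1 le_top)
    have n0 : ‖(D.projE ε).op (uhat ε 1 t)‖ ≤ M + 2 := by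
      have h := (WBd.norm_Lp (uhat ε 1 t) (w := 1) (R := 1) (by simp)).op (D.projE ε) (C := 1)
        fun k => D.norm_P_le _
      have h' := h.norm_le (by simp)
      simp only [NNReal.coe_one, one_mul] at h'
      linarith [hbd t ht, norm_nonneg (uhat ε 3 t)]
    have m1 : 2 / ε * ‖(D.perpE ε).op (uhat ε 1 t)‖ ≤ 2 * C := by
      calc _ ≤ 2 / ε * (C * ε) := by gcongr
        _ = 2 * C := by field_simp
    have m3 : 2 / ε ^ 2 * ‖uhat ε 3 t‖ ≤ 2 * C := by
      calc _ ≤ 2 / ε ^ 2 * (C * ε ^ 2) := by gcongr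
        _ = 2 * C := by field_simp
    linarith
  · intro tstar hts hsup
    have hr0 : 0 ≤ r := by linarith
    -- As `ε ≤ 1`, the scaled norm dominates the `L¹` norms of both modes, so `r` itself is an
    -- admissible `L¹` bound.
    obtain ⟨C', hC'0, hCb'⟩ := hmain r
    refine ⟨C', fun ε hε μ => ?_⟩
    have hε0 := hε.1
    have hK : ∀ t ∈ Set.Icc 0 (tstar / ε), ∀ j ∈ posModes, ‖uhat ε j t‖ ≤ r := by
      intro t ht
      have h := (le_iSup₂ (f := fun t (_ : t ∈ Set.Icc 0 (tstar / ε)) =>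
        scaledNorm ε (z ε 1 t) (z ε 3 t)) t ht).trans (hsup ε hε)
      rw [hscaled ε hε, ENNReal.ofReal_le_ofReal_iff hr0] at h
      have h2 : 2 ≤ 2 / ε := by rw [le_div_iff₀ hε0]; linarith [hε.2]
      have h3 : 2 ≤ 2 / ε ^ 2 := by
        rw [le_div_iff₀ (by positivity)]
        nlinarith [hε.2]
      have p1 := norm_nonneg ((D.projE ε).op (uhat ε 1 t))
      have p2 := mul_le_mul_of_nonneg_right h2 (norm_nonneg ((D.perpE ε).op (uhat ε 1 t)))
      have p2' := norm_nonneg ((D.perpE ε).op (uhat ε 1 t))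
      have p3 := mul_le_mul_of_nonneg_right h3 (norm_nonneg (uhat ε 3 t))
      have p3' := norm_nonneg (uhat ε 3 t)
      have htri : ‖uhat ε 1 t‖
          ≤ ‖(D.projE ε).op (uhat ε 1 t)‖ + ‖(D.perpE ε).op (uhat ε 1 t)‖ := by
        have e : uhat ε 1 t = (D.projE ε).op (uhat ε 1 t) + (D.perpE ε).op (uhat ε 1 t) := by
          rw [← D.sub_projE]
          abel
        conv_lhs => rw [e]
        exact norm_add_le _ _
      exact posModes_forall (by linarith) (by linarith)
    have hest := hCb' tstar hts ε hε hK
    refine ⟨?_, iSup₂_le fun t ht => ?_, ?_, iSup₂_le fun t ht => ?_⟩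
    · refine iSup_congr fun t => iSup_congr fun _ => ?_
      rw [hz]
      exact normL1_fourierD_congr_norm (fun k => (heig.norm_firstProjPerp ε t _ k).symm) μ
    · exact ((hest t ht).1.congr (hperp ε t)).normL1_fourierD_le μ
    · refine iSup_congr fun t => iSup_congr fun _ => ?_
      rw [hz]
      exact normL1_fourierD_congr_norm (fun k => (heig.norm_zTransform ε 3 t _ k).symm) μ
    · exact (hest t ht).2.normL1_fourierD_le μ
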